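/- Let $k\ge1$, $m\ge2$, $n=k+m$, $\gamma\in\mathbb R$, let $C\in L^\infty(0,1)^{n\times n}$ be real matrix-valued, $B\in\mathbb R^{k\times m}$ and $\Sigma(x)=\mathrm{diag}(-\lambda_1(x),\dots,-\lambda_k(x),\lambda_{k+1}(x),\dots,\lambda_{k+m}(x))$, where every $\lambda_i$ is Lipschitz on $[0,1]$ and $$-\lambda_1(x)<\dots<-\lambda_k(x)<0<\lambda_{k+1}(x)<\dots<\lambda_{k+m}(x)\qquad(x\in[0,1]).$$ Consider the control system $$\partial_t w=\Sigma(x)\,\partial_x w+\gamma C(x)w\ \text{ on }(0,T)\times(0,1),\qquad w_-(t,0)=B\,w_+(t,0),\qquad w_+(t,1)=W(t),$$ where $w_-=(w_1,\dots,w_k)^{\mathsf T}$, $w_+=(w_{k+1},\dots,w_{k+m})^{\mathsf T}$. Its solutions with initial datum $w_0\in L^2(0,1)^n$ and control $W\in L^2(0,T)^m$ are the broad solutions: $w\in C([0,T];L^2(0,1))^n\cap C([0,1];L^2(0,T))^n$ such that, for almost every $(\tau,\xi)\in(0,T)\times(0,1)$ and every $i$, $w_i(\tau,\xi)$ is the integral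 of $(\gamma Cw)_i$ along the characteristic $x_i$ through $(\tau,\xi)$ (that is, $\dot x_i=\lambda_i(x_i)$ if $i\le k$, $\dot x_i=-\lambda_i(x_i)$ if $i>k$, where $\lambda_i$ is extended by constants outside $[0,1]$), from the time at which this characteristic enters $[0,T]\times[0,1]$ up to $\tau$, plus the value at the entry point: $w_{0,i}$ if it enters at time $0$; $W_i$ if $i>k$ and it enters through $x=1$; $(Bw_+(t,0))_i$ if $i\le k$ and it enters through $x=0$ at time $t$, with $w_+(t,0)$ given by the same formula at the point $(t,0)$. The system is null-controllable at the time $T>0$ if for every $w_0\in L^2(0,1)^n$ there is a control $W\in L^2(0,T)^m$ such that the solution with $w(0,\cdot)=w_0$ satisfies $w(T,\cdot)=0$. Assume that $B\in\mathcal B$, that is, for every $1\le i\le\min\{k,m-1\}$ the $i\times i$ matrix formed from the last $i$ rows and the last $i$ columns of $B$ is invertible. Put $\tau_i=\int_0^1\frac{d\xi}{\lambda_i(\xi)}$ and $T_2=\tau_k+\tau_{k+1}$. Then there is a $\delta>0$, depending only on $C,B,\Sigma$ and $\gamma$, such that the system is null-controllable at the time $T_2-\delta$ (in particular $T_2-\delta>0$).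 This holds for every $\gamma\in\mathbb R$. -/

import Mathlib

open MeasureTheory Set Filter Topology

namespace HyperbolicControl

/-- The data of the boundary control system
`∂ₜ w = Σ(x) ∂ₓ w + γ C(x) w` on `0 < x < 1`, with `w₋(t, 0) = B w₊(t, 0)` and `w₊(t, 1) = W(t)`.
The components are indexed by `Fin k ⊕ Fin m`: `Sum.inl i` is the component with negative
eigenvalue `-lam (Sum.inl i) x` of `Σ(x)`, and `Sum.inr j` is the one with positive eigenvalue
`lam (Sum.inr j) x`. Only the values of `lam` and `C` on `[0, 1]` matter. -/
structure ControlSystem (k m : ℕ) where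
  lam : Fin k ⊕ Fin m → ℝ → ℝ
  C : ℝ → Matrix (Fin k ⊕ Fin m) (Fin k ⊕ Fin m) ℝ
  γ : ℝ
  B : Matrix (Fin k) (Fin m) ℝ

/-- The `i × i` matrix formed from the last `i` rows and the last `i` columns of `B`. -/
def lastBlock {k m : ℕ} (B : Matrix (Fin k) (Fin m) ℝ) (i : ℕ) (hk : i ≤ k) (hm : i ≤ m) :
    Matrix (Fin i) (Fin i) ℝ :=
  B.submatrix (fun a => ⟨k - i + a, by omega⟩) (fun b => ⟨m - i + b, by omega⟩)

/-- The class of the `k × m` matrices whose lower right `i × i` blocks are invertible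
for all `1 ≤ i ≤ min {k, m - 1}`. -/
def classB (k m : ℕ) : Set (Matrix (Fin k) (Fin m) ℝ) :=
  {B | ∀ (i : ℕ) (hk : i ≤ k) (hm : i ≤ m - 1), 1 ≤ i → IsUnit (lastBlock B i hk (by omega))}

/-- `u ∈ C(J; L²(I))`, for a function `u` whose slice `u t` represents the value at `t ∈ J`. -/
def ContinuousInL2 (u : ℝ → ℝ → ℝ) (J I : Set ℝ) : Prop :=
  (∀ t ∈ J, MemLp (u t) 2 (volume.restrict I)) ∧
  ∀ t₀ ∈ J, Tendsto (fun t => eLpNorm (fun x => u t x - u t₀ x) 2 (volume.restrict I))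
    (𝓝[J] t₀) (𝓝 0)

namespace ControlSystem

variable {k m : ℕ} (S : ControlSystem k m)

/-- `-lam₁ < ⋯ < -lam_k < 0 < lam_{k+1} < ⋯ < lam_{k+m}` on `[0, 1]`. -/
def SpeedsOrdered : Prop :=
  ∀ x ∈ Icc (0 : ℝ) 1,
    (∀ i, 0 < S.lam i x) ∧
    StrictMono (fun i : Fin k => -S.lam (Sum.inl i) x) ∧
    StrictMono (fun j : Fin m => S.lam (Sum.inr j) x)

/-- Every `lam i` is Lipschitz on `[0, 1]`. -/
def SpeedsLipschitz : Prop :=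
  ∀ i, ∃ K : NNReal, LipschitzOnWith K (S.lam i) (Icc 0 1)

/-- `C ∈ L^∞(0, 1)`. -/
def CouplingBounded : Prop :=
  ∀ i j, MemLp (fun x => S.C x i j) ⊤ (volume.restrict (Ioo (0 : ℝ) 1))

/-- The travel time `τ_i = ∫₀¹ 1 / lam_i`. -/
noncomputable def travelTime (i : Fin k ⊕ Fin m) : ℝ :=
  ∫ ξ in (0 : ℝ)..1, 1 / S.lam i ξ

/-- The velocity of the `i`-th characteristic, where `lam i` is extended to `ℝ` by `lam i 0` on the
left of `0` and by `lam i 1` on the right of `1`. -/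
def velocity : Fin k ⊕ Fin m → ℝ → ℝ
  | Sum.inl i, x => S.lam (Sum.inl i) (max 0 (min x 1))
  | Sum.inr j, x => -S.lam (Sum.inr j) (max 0 (min x 1))

/-- `x` is the `i`-th characteristic through the point `(s, ξ)`. -/
def IsCharacteristic (i : Fin k ⊕ Fin m) (s ξ : ℝ) (x : ℝ → ℝ) : Prop :=
  x s = ξ ∧ ∀ t, HasDerivAt x (S.velocity i (x t)) t

/-- The `i`-th characteristic `t ↦ x_i(t, s, ξ)`; it exists and is unique
by `existsUnique_isCharacteristic`. -/
noncomputable def characteristic (i : Fin k ⊕ Fin m) (s ξ : ℝ) : ℝ → ℝ :=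
  Classical.epsilon (S.IsCharacteristic i s ξ)

/-- The time at which a characteristic `x` passes through the point `a`. -/
noncomputable def passageTime (x : ℝ → ℝ) (a : ℝ) : ℝ :=
  Function.invFun x a

/-- The integral of `(γ C w)_i` along the `i`-th characteristic through `(τ, ξ)` from time `t`
to time `τ`. -/
noncomputable def sourceIntegral (w : ℝ → ℝ → Fin k ⊕ Fin m → ℝ) (i : Fin k ⊕ Fin m)
    (τ ξ t : ℝ) : ℝ :=
  ∫ s in t..τ, ∑ j, S.γ * S.C (S.characteristic i τ ξ s) i j * w s (S.characteristic i τ ξ s) j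

/-- The value at `(τ, ξ)` of the component `Sum.inr j`, obtained by following its characteristic
backwards to the side `x = 1`, where the control acts, or to the initial time. -/
noncomputable def positiveValue (w₀ : ℝ → Fin k ⊕ Fin m → ℝ) (W : ℝ → Fin m → ℝ)
    (w : ℝ → ℝ → Fin k ⊕ Fin m → ℝ) (j : Fin m) (τ ξ : ℝ) : ℝ :=
  let x := S.characteristic (Sum.inr j) τ ξ
  open Classical in
  if 1 < x 0 then
    S.sourceIntegral w (Sum.inr j) τ ξ (passageTime x 1) + W (passageTime x 1) j
  else
    S.sourceIntegral w (Sum.inr j) τ ξ 0 + w₀ (x 0) (Sum.inr j)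

/-- The value at `(τ, ξ)` of the component `Sum.inl i`, obtained by following its characteristic
backwards to the side `x = 0`, where `w₋ = B w₊`, or to the initial time. -/
noncomputable def negativeValue (w₀ : ℝ → Fin k ⊕ Fin m → ℝ) (W : ℝ → Fin m → ℝ)
    (w : ℝ → ℝ → Fin k ⊕ Fin m → ℝ) (i : Fin k) (τ ξ : ℝ) : ℝ :=
  let x := S.characteristic (Sum.inl i) τ ξ
  open Classical in
  if x 0 < 0 then
    S.sourceIntegral w (Sum.inl i) τ ξ (passageTime x 0) +
      ∑ j, S.B i j * S.positiveValue w₀ W w j (passageTime x 0) 0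
  else
    S.sourceIntegral w (Sum.inl i) τ ξ 0 + w₀ (x 0) (Sum.inl i)

/-- `w` is a broad solution on `(0, T) × (0, 1)` with initial datum `w₀` and control `W`, in the
class `C([0, T]; L²(0, 1)) ∩ C([0, 1]; L²(0, T))`. The function `w` is a representative whose
slices at every time `t ∈ [0, T]` and at every point `x ∈ [0, 1]` are the values of the two
continuous curves. -/
structure IsBroadSolution (T : ℝ) (w₀ : ℝ → Fin k ⊕ Fin m → ℝ) (W : ℝ → Fin m → ℝ)
    (w : ℝ → ℝ → Fin k ⊕ Fin m → ℝ) : Prop where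
  aestronglyMeasurable : ∀ i, AEStronglyMeasurable (fun p : ℝ × ℝ => w p.1 p.2 i)
    (volume.restrict (Ioo 0 T ×ˢ Ioo 0 1))
  continuous_time : ∀ i, ContinuousInL2 (fun t x => w t x i) (Icc 0 T) (Ioo 0 1)
  continuous_space : ∀ i, ContinuousInL2 (fun x t => w t x i) (Icc 0 1) (Ioo 0 T)
  positive : ∀ j : Fin m, ∀ᵐ p : ℝ × ℝ ∂volume.restrict (Ioo 0 T ×ˢ Ioo 0 1),
    w p.1 p.2 (Sum.inr j) = S.positiveValue w₀ W w j p.1 p.2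
  negative : ∀ i : Fin k, ∀ᵐ p : ℝ × ℝ ∂volume.restrict (Ioo 0 T ×ˢ Ioo 0 1),
    w p.1 p.2 (Sum.inl i) = S.negativeValue w₀ W w i p.1 p.2

/-- Null-controllability at the time `T > 0`: for every initial datum in `L²(0, 1)` there is a
control in `L²(0, T)` for which the solution exists and vanishes at the time `T`. -/
def NullControllableAt (T : ℝ) : Prop :=
  0 < T ∧
  ∀ w₀ : ℝ → Fin k ⊕ Fin m → ℝ,
    (∀ i, MemLp (fun x => w₀ x i) 2 (volume.restrict (Ioo 0 1))) →
    ∃ W : ℝ → Fin m → ℝ,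
      (∀ j, MemLp (fun t => W t j) 2 (volume.restrict (Ioo 0 T))) ∧
      (∃ w, S.IsBroadSolution T w₀ W w) ∧
      ∀ w, S.IsBroadSolution T w₀ W w →
        ∀ i, ∀ᵐ x ∂volume.restrict (Ioo (0 : ℝ) 1), w T x i = 0

variable {S}

theorem exists_flow_of_pos {v : ℝ → ℝ} {a b : ℝ} (ha : 0 < a) (hv : Continuous v)
    (hav : ∀ x, a ≤ v x) (hvb : ∀ x, v x ≤ b) (s ξ : ℝ) :
    ∃ x : ℝ → ℝ, x s = ξ ∧ ∀ t, HasDerivAt x (v (x t)) t := by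
  have hpos : ∀ x, 0 < v x := fun x => ha.trans_le (hav x)
  have hb : 0 < b := (hpos 0).trans_le (hvb 0)
  have hc : Continuous fun x => (v x)⁻¹ := hv.inv₀ fun x => (hpos x).ne'
  set F : ℝ → ℝ := fun x => s + ∫ y in ξ..x, (v y)⁻¹ with hF
  have hd : ∀ x, HasDerivAt F (v x)⁻¹ x := fun x =>
    (intervalIntegral.integral_hasDerivAt_right (hc.intervalIntegrable _ _)
      (hc.stronglyMeasurableAtFilter _ _) hc.continuousAt).const_add s
  have hcont : Continuous F := continuous_iff_continuousAt.2 fun x => (hd x).continuousAt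
  have hdiff : Differentiable ℝ F := fun x => (hd x).differentiableAt
  have hmono : StrictMono F := strictMono_of_deriv_pos fun x => by
    rw [(hd x).deriv]; exact inv_pos.2 (hpos x)
  -- `F x - x / b` is monotone, hence `F` is onto
  have hG : Monotone fun x => F x - x * b⁻¹ := by
    have hd' : ∀ x, HasDerivAt (fun x => F x - x * b⁻¹) ((v x)⁻¹ - 1 * b⁻¹) x := fun x =>
      (hd x).sub ((hasDerivAt_id x).mul_const _)
    refine monotone_of_deriv_nonneg (fun x => (hd' x).differentiableAt) fun x => ?_
    rw [(hd' x).deriv, one_mul, sub_nonneg]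
    exact inv_anti₀ (hpos x) (hvb x)
  have hsurj : Function.Surjective F := by
    refine hcont.surjective ?_ ?_
    · refine tendsto_atTop_mono' atTop (f₁ := fun x => x * b⁻¹ + F 0) ?_ ?_
      · filter_upwards [eventually_ge_atTop (0 : ℝ)] with x hx
        have := hG hx
        simp only [zero_mul, sub_zero] at this
        linarith
      · exact tendsto_atTop_add_const_right _ _ (tendsto_id.atTop_mul_const (inv_pos.2 hb))
    · refine tendsto_atBot_mono' atBot (f₁ := fun x => x * b⁻¹ + F 0) ?_ ?_
      · filter_upwards [eventually_le_atBot (0 : ℝ)] with x hx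
        have := hG hx
        simp only [zero_mul, sub_zero] at this
        linarith
      · exact tendsto_atBot_add_const_right _ _ (tendsto_id.atBot_mul_const (inv_pos.2 hb))
  let e : ℝ ≃o ℝ := hmono.orderIsoOfSurjective F hsurj
  have he : ∀ t, F (e.symm t) = t := fun t => e.apply_symm_apply t
  refine ⟨e.symm, ?_, fun t => ?_⟩
  · apply hmono.injective
    rw [he]; simp [hF]
  · have := HasDerivAt.of_local_left_inverse (f := F) (g := e.symm) (a := t)
      e.symm.continuous.continuousAt (hd (e.symm t)) (inv_ne_zero (hpos _).ne')
      (Eventually.of_forall he)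
    simpa using this

/-- The characteristics exist on the whole of `ℝ` and are unique. -/
theorem existsUnique_isCharacteristic (ho : S.SpeedsOrdered) (hl : S.SpeedsLipschitz)
    (i : Fin k ⊕ Fin m) (s ξ : ℝ) : ∃! x, S.IsCharacteristic i s ξ x := by
  obtain ⟨K, hK⟩ := hl i
  have hmem : ∀ x : ℝ, max 0 (min x 1) ∈ Icc (0 : ℝ) 1 := fun x => by simp
  have hproj : LipschitzWith 1 fun x : ℝ => max 0 (min x 1) :=
    (LipschitzWith.id.min_const 1).const_max 0
  have hlip : LipschitzWith (K * 1) fun x : ℝ => S.lam i (max 0 (min x 1)) := by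
    rw [← lipschitzOnWith_univ]
    exact hK.comp hproj.lipschitzOnWith fun x _ => hmem x
  obtain ⟨p, hp, hmin⟩ := isCompact_Icc.exists_isMinOn (nonempty_Icc.2 zero_le_one) hK.continuousOn
  obtain ⟨q, hq, hmax⟩ := isCompact_Icc.exists_isMaxOn (nonempty_Icc.2 zero_le_one) hK.continuousOn
  have hvel : LipschitzWith (K * 1) (S.velocity i) := by
    rcases i with i | j
    · exact hlip
    · exact hlip.neg
  obtain ⟨y, hy0, hy⟩ := exists_flow_of_pos ((ho p hp).1 i) hlip.continuous
    (fun x => hmin (hmem x)) (fun x => hmax (hmem x)) s ξ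
  have hex : ∃ x, S.IsCharacteristic i s ξ x := by
    rcases i with i | j
    · exact ⟨y, hy0, hy⟩
    · refine ⟨fun t => y (2 * s - t), ?_, fun t => ?_⟩
      · change y (2 * s - s) = ξ
        rw [show 2 * s - s = s by ring, hy0]
      · have := (hy (2 * s - t)).comp t ((hasDerivAt_id t).const_sub (2 * s))
        simpa [velocity, Function.comp_def] using this
  obtain ⟨x, hx⟩ := hex
  refine ⟨x, hx, fun z hz => ?_⟩
  exact ODE_solution_unique_univ (v := fun _ => S.velocity i) (s := fun _ => univ) (t₀ := s)
    (fun _ => hvel.lipschitzOnWith) (fun t => ⟨hz.2 t, mem_univ _⟩)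
    (fun t => ⟨hx.2 t, mem_univ _⟩) (hz.1.trans hx.1.symm)

end ControlSystem

end HyperbolicControl

/-!
The components of the system travel along the curves `t = c + ψ i x`, where `ψ i` is the signed
travel time from `0` to `x` and the label `c` is the time of passage through `x = 0`. A gauge factor
(`gauge`) removes the diagonal of the coupling. Then every coupling term integrates a component
`j ≠ i` along a characteristic of the component `i`, which crosses the characteristics of the
component `j` transversally: the integral of a transported `L²` function along each single
characteristic is finite, bounded by the `L²` norm, and a continuous function of the end point
(`integrableOn_comp_and_integral_abs_le`, `continuous_coupling_free`). Hence all solutions needed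
here are of the form `wave`: a freely transported `L²` function plus a bounded continuous function,
and the latter solves an integral equation which contracts a weighted sup norm (`IsContractive`).

Let `p` be the slowest component travelling from `0` to `1`, and `q` the slowest one travelling from
`1` to `0`, so that `T₂ = β + ψ p 1` for `β = -ψ q 1`; put `α = β - δ`. As `m ≥ 2`, there is a
component `r ≠ q` travelling from `1` to `0` with `B p r ≠ 0`, by the hypothesis on the last `1 × 1`
block of `B`. It is faster than `q`, so for small `δ` its trace at `x = 0` on the time interval
`(α, β)` does not depend on the initial datum and can be prescribed. The solution is assembled from
three problems. The forward problem has the given initial datum and a control of the component `r`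
on `(α, β)`. The mixed problem takes the traces on `(α, β)` of all components but `p` from the
forward problem, and the datum zero at `x = 1` for the component `p`. The third problem is an
evolution in the variable `x`, whose data at `x = 0` are the traces of the forward problem up to the
time `β` and zero afterwards; it provides the controlled solution, with the initial datum of the
forward problem (`wave_eq_forward`). If the mixed problem returns a trace of the component `p`
compatible with the reflection law, then the controlled solution agrees with the solution of the
mixed problem above the characteristic of `p` which leaves `x = 0` at the time `α` and arrives at
`x = 1` at the time `T₂ - δ` (`wave_eq_mixed`), and the latter vanishes at that time
(`wave_mixed_eq_zero`). The compatibility is a fixed point problem for the control on `(α, β)`, and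
it is contractive since its Lipschitz constant is of order `√δ`, by the smoothing effect
(`exists_matching`). The mixed problem is an evolution problem in neither variable; it is solved
with the coupling restricted to a short interval `(0, ε)`, which is a small perturbation, and for
small `δ` its relevant part does not notice the restriction. This is
`TransportSystem.IsSigned.exists_nullControl`.

It remains to see that this is a broad solution of the original system
(`ControlSystem.exists_isBroadSolution_of_wave`), and that broad solutions are unique, as null
controllability concerns all solutions with the chosen control
(`ControlSystem.IsBroadSolution.ae_eq`). Uniqueness follows from an estimate of the difference of
two solutions in `L¹` with the weight `exp (-L * t)`: the contributions of the past of a point along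
the characteristics gain a factor of order `1 / L` (`lintegral_kernel_le`).
-/

namespace HyperbolicControl

/-! ### Change of variables along transversal curves -/

theorem injective_of_le_abs_deriv {η η' : ℝ → ℝ} {κ : ℝ} (hκ : 0 < κ)
    (hη : ∀ x, HasDerivAt η (η' x) x) (hle : ∀ x, κ ≤ |η' x|) : Function.Injective η := by
  have key : ∀ a b, a < b → η a ≠ η b := fun a b hab h => by
    obtain ⟨c, -, hc⟩ := exists_hasDerivAt_eq_zero (f := η) (f' := η') hab
      (fun x _ => (hη x).continuousAt.continuousWithinAt) h fun x _ => hη x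
    have := hle c
    rw [hc, abs_zero] at this
    linarith
  intro a b hab
  by_contra hne
  rcases lt_or_gt_of_ne hne with h | h
  · exact key a b h hab
  · exact key b a h hab.symm

/-- A function composed with a curve of speed at least `κ` has an integral at most `κ⁻¹` times as
large. No measurability is needed, as the curve is injective. -/
theorem ofReal_mul_lintegral_comp_le {η η' : ℝ → ℝ} {κ : ℝ} (hκ : 0 < κ)
    (hη : ∀ x, HasDerivAt η (η' x) x) (hle : ∀ x, κ ≤ |η' x|) (g : ℝ → ENNReal) {s : Set ℝ}
    (hs : MeasurableSet s) :
    ENNReal.ofReal κ * ∫⁻ y in s, g (η y) ≤ ∫⁻ t, g t := by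
  have h := lintegral_image_eq_lintegral_abs_deriv_mul hs (fun x _ => (hη x).hasDerivWithinAt)
    (injective_of_le_abs_deriv hκ hη hle).injOn g
  calc ENNReal.ofReal κ * ∫⁻ y in s, g (η y)
      = ∫⁻ y in s, ENNReal.ofReal κ * g (η y) := (lintegral_const_mul' _ _ (by simp)).symm
    _ ≤ ∫⁻ y in s, ENNReal.ofReal |η' y| * g (η y) :=
        lintegral_mono fun y => mul_le_mul_left (ENNReal.ofReal_le_ofReal (hle y)) _
    _ = ∫⁻ t in η '' s, g t := h.symm
    _ ≤ ∫⁻ t, g t := setLIntegral_le_lintegral _ _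

/-- The `L²` version of `ofReal_mul_lintegral_comp_le`. -/
theorem eLpNorm_comp_le {η η' : ℝ → ℝ} {κ : ℝ} (hκ : 0 < κ)
    (hη : ∀ x, HasDerivAt η (η' x) x) (hle : ∀ x, κ ≤ |η' x|) (f : ℝ → ℝ) {s : Set ℝ}
    (hs : MeasurableSet s) :
    eLpNorm (fun y => f (η y)) 2 (volume.restrict s) ≤
      ENNReal.ofReal (√κ)⁻¹ * eLpNorm f 2 volume := by
  have h2 := ofReal_mul_lintegral_comp_le hκ hη hle (fun t => ‖f t‖ₑ ^ (2 : ℝ)) hs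
  rw [eLpNorm_eq_lintegral_rpow_enorm_toReal two_ne_zero ENNReal.ofNat_ne_top,
    eLpNorm_eq_lintegral_rpow_enorm_toReal two_ne_zero ENNReal.ofNat_ne_top]
  simp only [ENNReal.toReal_ofNat]
  have hsq : (0 : ℝ) < √κ := Real.sqrt_pos.2 hκ
  have h3 : ENNReal.ofReal (√κ) ≠ 0 := by simpa using hκ
  rw [ENNReal.ofReal_inv_of_pos hsq, mul_comm, ← div_eq_mul_inv,
    ENNReal.le_div_iff_mul_le (Or.inl h3) (Or.inl ENNReal.ofReal_ne_top)]
  have h4 : ENNReal.ofReal (√κ) = ENNReal.ofReal κ ^ (1 / 2 : ℝ) := by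
    rw [ENNReal.ofReal_rpow_of_pos hκ, Real.sqrt_eq_rpow]
  rw [h4, ← ENNReal.mul_rpow_of_nonneg _ _ (by norm_num), mul_comm]
  exact ENNReal.rpow_le_rpow h2 (by norm_num)

instance : IsProbabilityMeasure (volume.restrict (Ioo (0 : ℝ) 1)) := ⟨by simp⟩

/-- The smoothing effect of transversality: along a curve crossed with speed at least `κ`, a square
integrable function has an integral over `(0, 1)` controlled by its `L²` norm. -/
theorem integrableOn_comp_and_integral_abs_le {η η' : ℝ → ℝ} {κ : ℝ} (hκ : 0 < κ)
    (hη : ∀ x, HasDerivAt η (η' x) x) (hle : ∀ x, κ ≤ |η' x|) {f : ℝ → ℝ} (hf : Measurable f)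
    (hf2 : MemLp f 2 volume) :
    IntegrableOn (fun y => f (η y)) (Ioo 0 1) ∧
      ∫ y in Ioo (0 : ℝ) 1, |f (η y)| ≤ (√κ)⁻¹ * (eLpNorm f 2 volume).toReal := by
  have hηc : Continuous η := continuous_iff_continuousAt.2 fun x => (hη x).continuousAt
  have hm : AEStronglyMeasurable (fun y => f (η y)) (volume.restrict (Ioo 0 1)) :=
    (hf.comp hηc.measurable).aestronglyMeasurable
  have h1 : eLpNorm (fun y => f (η y)) 1 (volume.restrict (Ioo (0 : ℝ) 1)) ≤
      ENNReal.ofReal (√κ)⁻¹ * eLpNorm f 2 volume :=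
    (eLpNorm_le_eLpNorm_of_exponent_le (by norm_num) hm).trans
      (eLpNorm_comp_le hκ hη hle f measurableSet_Ioo)
  have htop : ENNReal.ofReal (√κ)⁻¹ * eLpNorm f 2 volume < ⊤ :=
    ENNReal.mul_lt_top ENNReal.ofReal_lt_top hf2.2
  have hi : Integrable (fun y => f (η y)) (volume.restrict (Ioo (0 : ℝ) 1)) :=
    memLp_one_iff_integrable.1 ⟨hm, h1.trans_lt htop⟩
  refine ⟨hi, ?_⟩
  have := integral_norm_eq_lintegral_enorm hm
  simp only [Real.norm_eq_abs] at this
  rw [this, ← eLpNorm_one_eq_lintegral_enorm]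
  refine (ENNReal.toReal_mono htop.ne h1).trans ?_
  rw [ENNReal.toReal_mul, ENNReal.toReal_ofReal (by positivity)]

/-- Approximation scheme for weighted estimates: a bound which improves from `A` to `A / 2 + s`
whenever it holds can be improved to `2 * s`. -/
theorem le_of_halving {α : Type*} {d ω : α → ℝ} {s A₀ : ℝ}
    (hω : ∀ p, 0 ≤ ω p) (h₀ : ∀ p, d p ≤ A₀ * ω p)
    (hA₀ : 0 ≤ A₀) (hs : 0 ≤ s)
    (h : ∀ A, 0 ≤ A → (∀ p, d p ≤ A * ω p) → ∀ p, d p ≤ (A / 2 + s) * ω p) (p : α) :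
    d p ≤ 2 * s * ω p := by
  have key : ∀ n : ℕ, ∀ p, d p ≤ (2 * s + A₀ * (1 / 2) ^ n) * ω p := by
    intro n
    induction n with
    | zero =>
      intro p
      rw [pow_zero, mul_one]
      have := mul_nonneg hs (hω p)
      linarith [h₀ p, add_mul (2 * s) A₀ (ω p), mul_assoc 2 s (ω p)]
    | succ n ih =>
      intro p
      have := h _ (by positivity) ih p
      convert this using 2
      ring
  have ht : Tendsto (fun n : ℕ => (2 * s + A₀ * (1 / 2) ^ n) * ω p) atTop
      (𝓝 ((2 * s + A₀ * 0) * ω p)) :=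
    (((tendsto_pow_atTop_nhds_zero_of_lt_one (by norm_num) (by norm_num)).const_mul A₀).const_add
      (2 * s)).mul_const _
  have := ge_of_tendsto ht (Eventually.of_forall fun n => key n p)
  simpa using this

/-! ### Hyperbolic systems in characteristic form -/

/-- A hyperbolic system written along its characteristics. The `i`-characteristics are the curves
`t = c + ψ i x`, labelled by their time `c` of passage through `x = 0`, and the derivative of the
`i`-th component along them is `∑ j, coeff i j x * w j`, for times in `(0, T)`; at the other times
there is no coupling. The diagonal of the coupling is zero, and the components are transversal to
the boundaries and to each other, with the common lower bound `κ` on the slopes and their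
differences. -/
structure TransportSystem (ι : Type*) where
  ψ : ι → ℝ → ℝ
  slope : ι → ℝ → ℝ
  coeff : ι → ι → ℝ → ℝ
  T : ℝ
  κ : ℝ
  bound : ℝ
  hasDerivAt_ψ : ∀ i x, HasDerivAt (ψ i) (slope i x) x
  ψ_zero : ∀ i, ψ i 0 = 0
  κ_pos : 0 < κ
  le_abs_slope : ∀ i x, κ ≤ |slope i x|
  le_abs_slope_sub : ∀ i j, i ≠ j → ∀ x, κ ≤ |slope i x - slope j x|
  measurable_coeff : ∀ i j, Measurable (coeff i j)
  abs_coeff_le : ∀ i j x, |coeff i j x| ≤ bound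
  coeff_self : ∀ i x, coeff i i x = 0
  coeff_of_notMem : ∀ i j x, x ∉ Ioo (0 : ℝ) 1 → coeff i j x = 0

/-- The functions of the form "solution of the free transport equation, with values `f i` at
`x = 0`" plus "bounded continuous function". All solutions constructed below are of this form. -/
def wave {ι : Type*} (ψ : ι → ℝ → ℝ) (f : ι → ℝ → ℝ) (z : ℝ → ℝ → ι → ℝ) : ℝ → ℝ → ι → ℝ :=
  fun t x i => f i (t - ψ i x) + z t x i

namespace TransportSystem

variable {ι : Type*} (P : TransportSystem ι)

/-- The indicator function of the times at which the coupling acts. -/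
noncomputable def cut (t : ℝ) : ℝ := (Ioo 0 P.T).indicator 1 t

/-- The square integrable data. -/
def IsDatum (f : ι → ℝ → ℝ) : Prop := ∀ i, Measurable (f i) ∧ MemLp (f i) 2 volume

variable {P}

theorem IsDatum.sub {f g : ι → ℝ → ℝ} (hf : IsDatum f) (hg : IsDatum g) : IsDatum (f - g) :=
  fun i => ⟨(hf i).1.sub (hg i).1, (hf i).2.sub (hg i).2⟩

variable (P)

theorem continuous_ψ (i : ι) : Continuous (P.ψ i) :=
  continuous_iff_continuousAt.2 fun x => (P.hasDerivAt_ψ i x).continuousAt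

theorem injective_ψ (i : ι) : Function.Injective (P.ψ i) :=
  injective_of_le_abs_deriv P.κ_pos (P.hasDerivAt_ψ i) (P.le_abs_slope i)

theorem measurable_cut : Measurable P.cut := measurable_one.indicator measurableSet_Ioo

theorem abs_cut_le (t : ℝ) : |P.cut t| ≤ 1 := by
  unfold cut; by_cases h : t ∈ Ioo 0 P.T <;> simp [h]

theorem cut_of_nonpos {t : ℝ} (h : t ≤ 0) : P.cut t = 0 := by
  simp [cut, h.not_gt]

theorem cut_of_mem {t : ℝ} (h : t ∈ Ioo 0 P.T) : P.cut t = 1 := by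
  simp [cut, -mem_Ioo, h]

theorem continuousAt_cut {t : ℝ} (h0 : t ≠ 0) (hT : t ≠ P.T) : ContinuousAt P.cut t := by
  by_cases h : t ∈ Ioo 0 P.T
  · refine (continuousAt_const (y := (1 : ℝ))).congr ?_
    filter_upwards [isOpen_Ioo.mem_nhds h] with s hs
    exact (P.cut_of_mem hs).symm
  · have : t ∈ (Icc 0 P.T)ᶜ := fun h' =>
      h ⟨lt_of_le_of_ne h'.1 h0.symm, lt_of_le_of_ne h'.2 hT⟩
    refine (continuousAt_const (y := (0 : ℝ))).congr ?_
    filter_upwards [isClosed_Icc.isOpen_compl.mem_nhds this] with s hs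
    have hs' : s ∉ Ioo 0 P.T := fun h' => hs (Ioo_subset_Icc_self h')
    simp [cut, -mem_Ioo, hs']

theorem bound_nonneg [Nonempty ι] : 0 ≤ P.bound :=
  let ⟨i⟩ := ‹Nonempty ι›
  (abs_nonneg _).trans (P.abs_coeff_le i i 0)

/-- Along an `i`-characteristic, the freely transported component `j ≠ i` is integrable. -/
theorem integrableOn_transported {f : ι → ℝ → ℝ} (hf : IsDatum f) {i j : ι} (hij : i ≠ j) (c : ℝ) :
    IntegrableOn (fun y => f j (c + P.ψ i y - P.ψ j y)) (Ioo 0 1) ∧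
      ∫ y in Ioo (0 : ℝ) 1, |f j (c + P.ψ i y - P.ψ j y)| ≤
        (√P.κ)⁻¹ * (eLpNorm (f j) 2 volume).toReal :=
  integrableOn_comp_and_integral_abs_le P.κ_pos
    (fun x => ((P.hasDerivAt_ψ i x).const_add c).sub (P.hasDerivAt_ψ j x))
    (P.le_abs_slope_sub i j hij) (hf j).1 (hf j).2

theorem measurable_free {f : ι → ℝ → ℝ} (hf : IsDatum f) (j : ι) :
    Measurable fun p : ℝ × ℝ => wave P.ψ f 0 p.1 p.2 j := by
  simp only [wave, Pi.zero_apply, add_zero]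
  exact (hf j).1.comp (measurable_fst.sub ((P.continuous_ψ j).measurable.comp measurable_snd))

/-- The splitting of a wave into its free part and its bounded part. -/
theorem wave_eq_add (f : ι → ℝ → ℝ) (z : ℝ → ℝ → ι → ℝ) : wave P.ψ f z = wave P.ψ f 0 + z := by
  ext t x i; simp [wave]

theorem wave_sub_wave (f f' : ι → ℝ → ℝ) (z z' : ℝ → ℝ → ι → ℝ) :
    wave P.ψ f z - wave P.ψ f' z' = wave P.ψ (f - f') (z - z') := by
  ext t x i; simp [wave]; ring

variable [Fintype ι]

/-- The derivative of the `i`-th component along the characteristic with label `c`. -/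
noncomputable def source (w : ℝ → ℝ → ι → ℝ) (i : ι) (c y : ℝ) : ℝ :=
  ∑ j, P.coeff i j y * P.cut (c + P.ψ i y) * w (c + P.ψ i y) y j

/-- The integral of the source term along the `i`-characteristic with label `c`, from the abscissa
`e` to the abscissa `x`. -/
noncomputable def coupling (e : ℝ) (w : ℝ → ℝ → ι → ℝ) (i : ι) (c x : ℝ) : ℝ :=
  ∫ y in e..x, P.source w i c y

/-- The sum of the `L²` norms of the components. -/
noncomputable def size (f : ι → ℝ → ℝ) : ℝ := ∑ i, (eLpNorm (f i) 2 volume).toReal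

theorem size_nonneg (f : ι → ℝ → ℝ) : 0 ≤ size f :=
  Finset.sum_nonneg fun _ _ => ENNReal.toReal_nonneg

theorem source_eq_zero_of_notMem (w : ℝ → ℝ → ι → ℝ) (i : ι) (c : ℝ) {y : ℝ}
    (hy : y ∉ Ioo (0 : ℝ) 1) : P.source w i c y = 0 :=
  Finset.sum_eq_zero fun j _ => by rw [P.coeff_of_notMem i j y hy]; ring

theorem source_eq_zero_of_nonpos (w : ℝ → ℝ → ι → ℝ) (i : ι) {c y : ℝ}
    (hy : c + P.ψ i y ≤ 0) : P.source w i c y = 0 :=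
  Finset.sum_eq_zero fun j _ => by rw [P.cut_of_nonpos hy]; ring

theorem source_congr {w w' : ℝ → ℝ → ι → ℝ} {i : ι} {c y : ℝ}
    (h : ∀ j, w (c + P.ψ i y) y j = w' (c + P.ψ i y) y j) :
    P.source w i c y = P.source w' i c y := by simp only [source, h]

theorem measurable_source {w : ℝ → ℝ → ι → ℝ} (hw : ∀ j, Measurable fun p : ℝ × ℝ => w p.1 p.2 j)
    (i : ι) (c : ℝ) : Measurable (P.source w i c) := by
  have h : Measurable fun y => c + P.ψ i y := ((P.continuous_ψ i).measurable).const_add c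
  exact Finset.measurable_sum _ fun j _ => ((P.measurable_coeff i j).mul
    (P.measurable_cut.comp h)).mul ((hw j).comp (h.prodMk measurable_id))

theorem source_add (w w' : ℝ → ℝ → ι → ℝ) (i : ι) (c y : ℝ) :
    P.source (w + w') i c y = P.source w i c y + P.source w' i c y := by
  simp only [source, ← Finset.sum_add_distrib, Pi.add_apply, mul_add]

theorem source_sub (w w' : ℝ → ℝ → ι → ℝ) (i : ι) (c y : ℝ) :
    P.source (w - w') i c y = P.source w i c y - P.source w' i c y := by
  simp only [source, ← Finset.sum_sub_distrib, Pi.sub_apply, mul_sub]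

/-- Only the components `j ≠ i`, which cross the `i`-characteristics transversally, contribute. -/
theorem abs_source_le_sum [Nonempty ι] [DecidableEq ι] (w : ℝ → ℝ → ι → ℝ) (i : ι) (c y : ℝ) :
    |P.source w i c y| ≤ ∑ j ∈ {j | j ≠ i}, P.bound * |w (c + P.ψ i y) y j| := by
  classical
  unfold source
  rw [← Finset.sum_filter_add_sum_filter_not Finset.univ (fun j => j ≠ i)]
  have : ∑ j ∈ {j | ¬ j ≠ i}, P.coeff i j y * P.cut (c + P.ψ i y) * w (c + P.ψ i y) y j = 0 :=
    Finset.sum_eq_zero fun j hj => by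
      have : j = i := by simpa using hj
      rw [this, P.coeff_self]; ring
  rw [this, add_zero]
  refine (Finset.abs_sum_le_sum_abs _ _).trans (Finset.sum_le_sum fun j _ => ?_)
  rw [abs_mul, abs_mul]
  refine mul_le_mul_of_nonneg_right ?_ (abs_nonneg _)
  calc _ ≤ P.bound * 1 := mul_le_mul (P.abs_coeff_le i j y) (P.abs_cut_le _) (abs_nonneg _)
        P.bound_nonneg
    _ = P.bound := mul_one _

/-- The source term vanishes off `(0, 1) × (0, T)`, so a bound on the unknown gives a bound on it
there. -/
theorem abs_source_le [Nonempty ι] {w : ℝ → ℝ → ι → ℝ} {i : ι} {c y R : ℝ}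
    (h : ∀ j, |w (c + P.ψ i y) y j| ≤ R) :
    |P.source w i c y| ≤
      Fintype.card ι * P.bound * |P.cut (c + P.ψ i y)| * R * (Ioo (0 : ℝ) 1).indicator 1 y := by
  by_cases hy : y ∈ Ioo (0 : ℝ) 1
  · rw [indicator_of_mem hy, Pi.one_apply, mul_one]
    unfold source
    refine (Finset.abs_sum_le_sum_abs _ _).trans ?_
    calc ∑ j, |P.coeff i j y * P.cut (c + P.ψ i y) * w (c + P.ψ i y) y j|
        ≤ ∑ j : ι, P.bound * |P.cut (c + P.ψ i y)| * R := Finset.sum_le_sum fun j _ => by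
          rw [abs_mul, abs_mul]
          exact mul_le_mul (mul_le_mul_of_nonneg_right (P.abs_coeff_le i j y) (abs_nonneg _)) (h j)
            (abs_nonneg _) (mul_nonneg P.bound_nonneg (abs_nonneg _))
      _ = _ := by rw [Finset.sum_const, Finset.card_univ, nsmul_eq_mul]; ring
  · rw [P.source_eq_zero_of_notMem w i c hy, indicator_of_notMem hy]; simp

theorem integrable_source_of_bounded [Nonempty ι] {w : ℝ → ℝ → ι → ℝ}
    (hw : ∀ j, Measurable fun p : ℝ × ℝ => w p.1 p.2 j) {R : ℝ} (hR : ∀ t x j, |w t x j| ≤ R)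
    (i : ι) (c : ℝ) : Integrable (P.source w i c) := by
  have hR0 : 0 ≤ R := (abs_nonneg _).trans (hR 0 0 i)
  refine Integrable.mono' (g := (Ioo (0 : ℝ) 1).indicator fun _ => Fintype.card ι * P.bound * R)
    ?_ (P.measurable_source hw i c).aestronglyMeasurable (Eventually.of_forall fun y => ?_)
  · exact (integrable_indicator_iff measurableSet_Ioo).2 (integrableOn_const (by simp))
  · rw [Real.norm_eq_abs]
    refine (P.abs_source_le (R := R) fun j => hR _ _ j).trans ?_
    by_cases hy : y ∈ Ioo (0 : ℝ) 1
    · simp only [indicator_of_mem hy, Pi.one_apply, mul_one]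
      have := mul_nonneg (mul_nonneg (Nat.cast_nonneg (α := ℝ) (Fintype.card ι)) P.bound_nonneg) hR0
      calc _ = Fintype.card ι * P.bound * R * |P.cut (c + P.ψ i y)| := by ring
        _ ≤ Fintype.card ι * P.bound * R * 1 := mul_le_mul_of_nonneg_left (P.abs_cut_le _) this
        _ = _ := mul_one _
    · simp [indicator_of_notMem hy]

/-- The source term of a freely transported function: by transversality, its integral along every
single characteristic is controlled by the `L²` norms of the data. -/
theorem integrable_source_free [Nonempty ι] {f : ι → ℝ → ℝ} (hf : IsDatum f) (i : ι) (c : ℝ) :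
    Integrable (P.source (wave P.ψ f 0) i c) ∧
      ∫ y, |P.source (wave P.ψ f 0) i c y| ≤ P.bound * (√P.κ)⁻¹ * size f := by
  classical
  have hm := P.measurable_source (P.measurable_free hf) i c
  have hsum : IntegrableOn (fun y => ∑ j ∈ {j | j ≠ i}, P.bound * |f j (c + P.ψ i y - P.ψ j y)|)
      (Ioo 0 1) := integrable_finsetSum _ fun j hj =>
    ((P.integrableOn_transported hf (Ne.symm (by simpa using hj)) c).1.abs).const_mul _
  have hle : ∀ y, |P.source (wave P.ψ f 0) i c y| ≤
      ∑ j ∈ {j | j ≠ i}, P.bound * |f j (c + P.ψ i y - P.ψ j y)| := fun y => by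
    simpa [wave] using P.abs_source_le_sum (wave P.ψ f 0) i c y
  have hon : IntegrableOn (P.source (wave P.ψ f 0) i c) (Ioo 0 1) :=
    hsum.mono' hm.aestronglyMeasurable (Eventually.of_forall fun y => hle y)
  have hsupp : Function.support (P.source (wave P.ψ f 0) i c) ⊆ Ioo 0 1 := fun y hy => by
    by_contra h
    exact hy (P.source_eq_zero_of_notMem _ _ _ h)
  refine ⟨(integrableOn_iff_integrable_of_support_subset hsupp).1 hon, ?_⟩
  rw [← setIntegral_eq_integral_of_forall_compl_eq_zero (s := Ioo (0 : ℝ) 1) fun y hy => by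
    rw [P.source_eq_zero_of_notMem _ _ _ hy, abs_zero]]
  calc ∫ y in Ioo (0 : ℝ) 1, |P.source (wave P.ψ f 0) i c y|
      ≤ ∫ y in Ioo (0 : ℝ) 1, ∑ j ∈ {j | j ≠ i}, P.bound * |f j (c + P.ψ i y - P.ψ j y)| :=
        integral_mono hon.abs hsum hle
    _ = ∑ j ∈ {j | j ≠ i}, P.bound * ∫ y in Ioo (0 : ℝ) 1, |f j (c + P.ψ i y - P.ψ j y)| := by
        rw [integral_finsetSum]
        · simp only [integral_const_mul]
        · exact fun j hj =>
            ((P.integrableOn_transported hf (Ne.symm (by simpa using hj)) c).1.abs).const_mul _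
    _ ≤ ∑ j ∈ {j | j ≠ i}, P.bound * ((√P.κ)⁻¹ * (eLpNorm (f j) 2 volume).toReal) :=
        Finset.sum_le_sum fun j hj => mul_le_mul_of_nonneg_left
          (P.integrableOn_transported hf (Ne.symm (by simpa using hj)) c).2 P.bound_nonneg
    _ ≤ ∑ j, P.bound * ((√P.κ)⁻¹ * (eLpNorm (f j) 2 volume).toReal) :=
        Finset.sum_le_sum_of_subset_of_nonneg (Finset.filter_subset _ _) fun j _ _ =>
          mul_nonneg P.bound_nonneg (by positivity)
    _ = _ := by rw [size, Finset.mul_sum]; exact Finset.sum_congr rfl fun _ _ => by ring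

theorem abs_coupling_free_le [Nonempty ι] {f : ι → ℝ → ℝ} (hf : IsDatum f) (e : ℝ) (i : ι)
    (c x : ℝ) : |P.coupling e (wave P.ψ f 0) i c x| ≤ P.bound * (√P.κ)⁻¹ * size f := by
  have h := P.integrable_source_free hf i c
  refine le_trans ?_ h.2
  rw [← Real.norm_eq_abs]
  refine (intervalIntegral.norm_integral_le_integral_norm_uIoc).trans ?_
  exact setIntegral_le_integral h.1.norm (Eventually.of_forall fun _ => norm_nonneg _)

theorem integrable_source_wave [Nonempty ι] {f : ι → ℝ → ℝ} (hf : IsDatum f) {z : ℝ → ℝ → ι → ℝ}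
    (hz : ∀ j, Measurable fun p : ℝ × ℝ => z p.1 p.2 j) {R : ℝ} (hR : ∀ t x j, |z t x j| ≤ R)
    (i : ι) (c : ℝ) : Integrable (P.source (wave P.ψ f z) i c) := by
  rw [wave_eq_add, show P.source (wave P.ψ f 0 + z) i c = P.source (wave P.ψ f 0) i c +
    P.source z i c from funext fun y => P.source_add _ _ i c y]
  exact (P.integrable_source_free hf i c).1.add (P.integrable_source_of_bounded hz hR i c)

end TransportSystem

/-! ### Integral equations with a contractive weight -/

namespace TransportSystem

variable {ι : Type*} [Fintype ι] (P : TransportSystem ι)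

theorem coupling_add {w w' : ℝ → ℝ → ι → ℝ} {i : ι} {c : ℝ} (hw : Integrable (P.source w i c))
    (hw' : Integrable (P.source w' i c)) (e x : ℝ) :
    P.coupling e (w + w') i c x = P.coupling e w i c x + P.coupling e w' i c x := by
  simp only [coupling, source_add]
  exact intervalIntegral.integral_add hw.intervalIntegrable hw'.intervalIntegrable

theorem coupling_sub {w w' : ℝ → ℝ → ι → ℝ} {i : ι} {c : ℝ} (hw : Integrable (P.source w i c))
    (hw' : Integrable (P.source w' i c)) (e x : ℝ) :
    P.coupling e (w - w') i c x = P.coupling e w i c x - P.coupling e w' i c x := by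
  simp only [coupling, source_sub]
  exact intervalIntegral.integral_sub hw.intervalIntegrable hw'.intervalIntegrable

/-- The integral equation for the bounded part `z` of a solution: `e i` is the end of the interval
`[0, 1]` at which the data for the `i`-th component are given, and `ρ` is a matrix of reflection
coefficients at `x = 0`. The truncation `max x 0` only matters off the physical domain. -/
def IsSolution (e : ι → ℝ) (ρ : Matrix ι ι ℝ) (f : ι → ℝ → ℝ) (z : ℝ → ℝ → ι → ℝ) : Prop :=
  ∀ t x i, z t x i = ∑ j, ρ i j * z (t - P.ψ i (max x 0)) 0 j +
    P.coupling (e i) (wave P.ψ f z) i (t - P.ψ i x) x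

/-- The weight `ω`, with `1 ≤ ω ≤ Ω`, makes the integral equation contractive: its right-hand side
maps functions bounded by `A * ω` to functions bounded by `A / 2 * ω`. -/
structure IsContractive (e : ι → ℝ) (ρ : Matrix ι ι ℝ) (ω : ℝ → ℝ → ι → ℝ) (Ω : ℝ) : Prop where
  one_le : ∀ t x i, 1 ≤ ω t x i
  le : ∀ t x i, ω t x i ≤ Ω
  halving : ∀ (w : ℝ → ℝ → ι → ℝ) (A : ℝ), 0 ≤ A → (∀ t x j, |w t x j| ≤ A * ω t x j) →
    ∀ t x i, |∑ j, ρ i j * w (t - P.ψ i (max x 0)) 0 j +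
      P.coupling (e i) w i (t - P.ψ i x) x| ≤ A / 2 * ω t x i

variable {P}

/-- Domains of dependence: if a region `D` contains, with each of its points, the parts of the
characteristics that carry the data to it, then a bounded function without data which solves the
integral equation in `D` vanishes in `D`. -/
theorem IsContractive.eq_zero_of_mem {e : ι → ℝ} {ω : ℝ → ℝ → ι → ℝ} {Ω : ℝ}
    (hω : P.IsContractive e 0 ω Ω) {D : Set (ℝ × ℝ)} {d : ℝ → ℝ → ι → ℝ} {R : ℝ}
    (hR : ∀ p ∈ D, ∀ i, |d p.1 p.2 i| ≤ R)
    (hd : ∀ p ∈ D, ∀ i, d p.1 p.2 i = P.coupling (e i) d i (p.1 - P.ψ i p.2) p.2)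
    (hD : ∀ p ∈ D, ∀ i, ∀ y ∈ uIcc (e i) p.2, y ∈ Ioo (0 : ℝ) 1 →
      (p.1 - P.ψ i p.2 + P.ψ i y, y) ∈ D) {p : ℝ × ℝ} (hp : p ∈ D) (i : ι) :
    d p.1 p.2 i = 0 := by
  classical
  let d' : ℝ → ℝ → ι → ℝ := fun t x i => if (t, x) ∈ D then d t x i else 0
  have hd' : ∀ p ∈ D, ∀ i, d' p.1 p.2 i = P.coupling (e i) d' i (p.1 - P.ψ i p.2) p.2 :=
    fun p hp i => by
      have h1 : d' p.1 p.2 i = d p.1 p.2 i := if_pos hp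
      rw [h1, hd p hp i]
      refine intervalIntegral.integral_congr fun y hy => ?_
      by_cases hy' : y ∈ Ioo (0 : ℝ) 1
      · exact P.source_congr fun j => (if_pos (hD p hp i y hy hy')).symm
      · rw [P.source_eq_zero_of_notMem _ _ _ hy', P.source_eq_zero_of_notMem _ _ _ hy']
  have hR0 : 0 ≤ R := (abs_nonneg _).trans (hR p hp i)
  have key := le_of_halving (α := ℝ × ℝ × ι) (d := fun p => |d' p.1 p.2.1 p.2.2|)
    (ω := fun p => ω p.1 p.2.1 p.2.2) (A₀ := R) (s := 0)
    (fun p => zero_le_one.trans (hω.one_le _ _ _)) (fun q => ?_) hR0 le_rfl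
    (fun A hA h q => ?_) (p.1, p.2, i)
  · have h2 : d' p.1 p.2 i = d p.1 p.2 i := if_pos hp
    rw [← h2]
    simpa using key
  · obtain ⟨t, x, j⟩ := q
    have h1 := hω.one_le t x j
    by_cases hq : (t, x) ∈ D
    · simp only [d', if_pos hq]
      exact (hR _ hq j).trans (le_mul_of_one_le_right hR0 h1)
    · simp only [d', if_neg hq, abs_zero]
      exact mul_nonneg hR0 (zero_le_one.trans h1)
  · obtain ⟨t, x, j⟩ := q
    rw [add_zero]
    by_cases hq : (t, x) ∈ D
    · have h1 := hω.halving d' A hA (fun t x j => h (t, x, j)) t x j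
      simp only [Matrix.zero_apply, zero_mul, Finset.sum_const_zero, zero_add] at h1
      rw [← hd' _ hq] at h1
      exact h1
    · simp only [d', if_neg hq, abs_zero]
      exact mul_nonneg (by positivity) (zero_le_one.trans (hω.one_le _ _ _))

variable [Nonempty ι] (P)

theorem continuous_coupling_of_bounded {w : ℝ → ℝ → ι → ℝ}
    (hw : ∀ j, Continuous fun p : ℝ × ℝ => w p.1 p.2 j) {R : ℝ} (hR : ∀ t x j, |w t x j| ≤ R)
    (e : ℝ) (i : ι) : Continuous fun p : ℝ × ℝ => P.coupling e w i p.1 p.2 := by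
  rw [continuous_iff_continuousAt]
  rintro ⟨c₀, x₀⟩
  have hR0 : 0 ≤ R := (abs_nonneg _).trans (hR 0 0 i)
  have hm := fun c => P.measurable_source (fun j => (hw j).measurable) i c
  refine intervalIntegral.continuousAt_parametric_primitive_of_dominated
    (fun _ => Fintype.card ι * P.bound * R) (min e x₀ - 1) (max e x₀ + 1)
    (fun c => (hm c).aestronglyMeasurable) ?_ intervalIntegrable_const ?_
    ⟨by linarith [min_le_left e x₀], by linarith [le_max_left e x₀]⟩
    ⟨by linarith [min_le_right e x₀], by linarith [le_max_right e x₀]⟩ (by simp)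
  · refine Eventually.of_forall fun c => Eventually.of_forall fun y => ?_
    have h0 := mul_nonneg
      (mul_nonneg (Nat.cast_nonneg (α := ℝ) (Fintype.card ι)) P.bound_nonneg) hR0
    have h1 : (Ioo (0 : ℝ) 1).indicator (1 : ℝ → ℝ) y ≤ 1 := by
      by_cases hy : y ∈ Ioo (0 : ℝ) 1 <;> simp [hy]
    have h2 : 0 ≤ (Ioo (0 : ℝ) 1).indicator (1 : ℝ → ℝ) y :=
      indicator_nonneg (fun _ _ => zero_le_one) _
    rw [Real.norm_eq_abs]
    refine (P.abs_source_le (R := R) fun j => hR _ _ j).trans ?_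
    calc _ = Fintype.card ι * P.bound * R *
          (|P.cut (c + P.ψ i y)| * (Ioo (0 : ℝ) 1).indicator 1 y) := by ring
      _ ≤ Fintype.card ι * P.bound * R * (1 * 1) := mul_le_mul_of_nonneg_left
          (mul_le_mul (P.abs_cut_le _) h1 h2 zero_le_one) h0
      _ = _ := by ring
  · -- the cutoff jumps at two points of the characteristic only
    have h : ∀ s : ℝ, ∀ᵐ y ∂volume.restrict (uIoc (min e x₀ - 1) (max e x₀ + 1)),
        c₀ + P.ψ i y ≠ s := fun s => by
      refine ae_restrict_of_ae ?_
      have : {y | c₀ + P.ψ i y = s}.Subsingleton := fun y hy y' hy' =>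
        P.injective_ψ i (add_left_cancel (hy.trans (Eq.symm hy')))
      exact this.finite.countable.ae_notMem volume
    filter_upwards [h 0, h P.T] with y h0 hT
    have hc : Continuous fun c : ℝ => c + P.ψ i y := continuous_id.add continuous_const
    refine tendsto_finsetSum _ fun j _ => ?_
    refine ContinuousAt.mul (ContinuousAt.mul continuousAt_const ?_) ?_
    · exact ContinuousAt.comp (f := fun c : ℝ => c + P.ψ i y) (P.continuousAt_cut h0 hT)
        hc.continuousAt
    · exact ((hw j).comp (hc.prodMk continuous_const)).continuousAt

/-- After integration along the characteristics, a freely transported `L²` function is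
continuous. -/
theorem continuous_coupling_free {f : ι → ℝ → ℝ} (hf : IsDatum f) (e : ℝ) (i : ι) :
    Continuous fun p : ℝ × ℝ => P.coupling e (wave P.ψ f 0) i p.1 p.2 := by
  refine continuous_of_uniform_approx_of_continuous fun u hu => ?_
  obtain ⟨ε, hε, hu⟩ := Metric.mem_uniformity_dist.1 hu
  -- the smoothing estimate makes an `L²` approximation of the data uniform after integration
  set M : ℝ := P.bound * (√P.κ)⁻¹ * Fintype.card ι with hM
  have hM0 : 0 ≤ M := mul_nonneg (mul_nonneg P.bound_nonneg (by positivity)) (by positivity)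
  have hη : 0 < ε / (M + 1) := by positivity
  choose g hg hg2 using fun j => (hf j).2.exists_boundedContinuous_eLpNorm_sub_le
    ENNReal.ofNat_ne_top (ε := ENNReal.ofReal (ε / (M + 1))) (by simpa using hη)
  have hgd : IsDatum fun j => (g j : ℝ → ℝ) :=
    fun j => ⟨(g j).continuous.measurable, hg2 j⟩
  refine ⟨fun p => P.coupling e (wave P.ψ (fun j => (g j : ℝ → ℝ)) 0) i p.1 p.2,
    P.continuous_coupling_of_bounded (R := ∑ j, ‖g j‖) (fun j => ?_) (fun t x j => ?_) e i,
    fun p => hu ?_⟩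
  · simp only [wave, Pi.zero_apply, add_zero]
    exact (g j).continuous.comp (continuous_fst.sub ((P.continuous_ψ j).comp continuous_snd))
  · simp only [wave, Pi.zero_apply, add_zero]
    exact ((g j).norm_coe_le_norm _).trans
      (Finset.single_le_sum (f := fun j => ‖g j‖) (fun _ _ => norm_nonneg _) (Finset.mem_univ j))
  · rw [Real.dist_eq, ← P.coupling_sub (P.integrable_source_free hf i _).1
      (P.integrable_source_free hgd i _).1, wave_sub_wave, sub_zero]
    refine (P.abs_coupling_free_le (hf.sub hgd) e i _ _).trans_lt ?_
    have hs : size (f - fun j => (g j : ℝ → ℝ)) ≤ Fintype.card ι * (ε / (M + 1)) := by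
      refine (Finset.sum_le_card_nsmul _ _ (ε / (M + 1)) fun j _ => ?_).trans_eq (by simp)
      exact ENNReal.toReal_le_of_le_ofReal hη.le (hg j)
    calc P.bound * (√P.κ)⁻¹ * size (f - fun j => (g j : ℝ → ℝ))
        ≤ P.bound * (√P.κ)⁻¹ * (Fintype.card ι * (ε / (M + 1))) :=
          mul_le_mul_of_nonneg_left hs (mul_nonneg P.bound_nonneg (by positivity))
      _ = M * ε / (M + 1) := by rw [hM]; ring
      _ < ε := by rw [div_lt_iff₀ (by positivity)]; linarith [mul_comm M ε, mul_add ε M 1]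

variable {P}

/-- The bounded part depends continuously on the difference of the data. -/
theorem IsContractive.abs_sub_le {e : ι → ℝ} {ρ : Matrix ι ι ℝ} {ω : ℝ → ℝ → ι → ℝ} {Ω : ℝ}
    (hω : P.IsContractive e ρ ω Ω) {f f' : ι → ℝ → ℝ} (hf : IsDatum f) (hf' : IsDatum f')
    {z z' : ℝ → ℝ → ι → ℝ} (hz : P.IsSolution e ρ f z) (hz' : P.IsSolution e ρ f' z')
    (hm : ∀ j, Measurable fun p : ℝ × ℝ => z p.1 p.2 j)
    (hm' : ∀ j, Measurable fun p : ℝ × ℝ => z' p.1 p.2 j)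
    {R : ℝ} (hR : ∀ t x j, |z t x j| ≤ R) (hR' : ∀ t x j, |z' t x j| ≤ R) (t x : ℝ) (i : ι) :
    |z t x i - z' t x i| ≤ 2 * (P.bound * (√P.κ)⁻¹ * size (f - f')) * Ω := by
  set s := P.bound * (√P.κ)⁻¹ * size (f - f')
  have hs : 0 ≤ s := mul_nonneg (mul_nonneg P.bound_nonneg (by positivity)) (size_nonneg _)
  have hR0 : 0 ≤ R := (abs_nonneg _).trans (hR 0 0 i)
  refine le_trans ?_ (mul_le_mul_of_nonneg_left (hω.le t x i) (by positivity))
  refine le_of_halving (α := ℝ × ℝ × ι) (d := fun p => |z p.1 p.2.1 p.2.2 - z' p.1 p.2.1 p.2.2|)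
    (ω := fun p => ω p.1 p.2.1 p.2.2) (A₀ := 2 * R)
    (fun p => zero_le_one.trans (hω.one_le _ _ _)) (fun p => ?_) (by positivity) hs
    (fun A hA h p => ?_) (t, x, i)
  · have h1 := abs_sub (z p.1 p.2.1 p.2.2) (z' p.1 p.2.1 p.2.2)
    have h2 := hR p.1 p.2.1 p.2.2
    have h3 := hR' p.1 p.2.1 p.2.2
    nlinarith [hω.one_le p.1 p.2.1 p.2.2]
  · obtain ⟨t, x, i⟩ := p
    dsimp only
    have hsub : P.coupling (e i) (wave P.ψ f z) i (t - P.ψ i x) x -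
        P.coupling (e i) (wave P.ψ f' z') i (t - P.ψ i x) x =
        P.coupling (e i) (wave P.ψ (f - f') 0) i (t - P.ψ i x) x +
        P.coupling (e i) (z - z') i (t - P.ψ i x) x := by
      rw [← P.coupling_sub (P.integrable_source_wave hf hm hR i _)
        (P.integrable_source_wave hf' hm' hR' i _), wave_sub_wave, wave_eq_add,
        P.coupling_add (P.integrable_source_free (hf.sub hf') i _).1
        (P.integrable_source_of_bounded (R := R + R) (fun j => (hm j).sub (hm' j)) (fun t x j => ?_)
          i _)]
      exact (abs_sub _ _).trans (add_le_add (hR _ _ _) (hR' _ _ _))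
    have key := hω.halving (z - z') A hA (fun t x j => h (t, x, j)) t x i
    have key2 := P.abs_coupling_free_le (hf.sub hf') (e i) i (t - P.ψ i x) x
    have : z t x i - z' t x i = (∑ j, ρ i j * (z - z') (t - P.ψ i (max x 0)) 0 j +
        P.coupling (e i) (z - z') i (t - P.ψ i x) x) +
        P.coupling (e i) (wave P.ψ (f - f') 0) i (t - P.ψ i x) x := by
      rw [hz t x i, hz' t x i]
      simp only [Pi.sub_apply, mul_sub, Finset.sum_sub_distrib]
      linarith
    rw [this]
    refine (abs_add_le _ _).trans ?_
    have := hω.one_le t x i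
    nlinarith

/-- Existence of solutions, by Picard iteration in the space of bounded continuous functions. -/
theorem IsContractive.exists_isSolution {e : ι → ℝ} {ρ : Matrix ι ι ℝ} {ω : ℝ → ℝ → ι → ℝ} {Ω : ℝ}
    (hω : P.IsContractive e ρ ω Ω) {f : ι → ℝ → ℝ} (hf : IsDatum f) :
    ∃ Z : BoundedContinuousFunction (ℝ × ℝ) (ι → ℝ), P.IsSolution e ρ f fun t x => Z (t, x) := by
  classical
  set s := P.bound * (√P.κ)⁻¹ * size f
  have hs : 0 ≤ s := mul_nonneg (mul_nonneg P.bound_nonneg (by positivity)) (size_nonneg _)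
  have hΩ : 1 ≤ Ω := (hω.one_le 0 0 (Classical.arbitrary ι)).trans (hω.le 0 0 _)
  let F : BoundedContinuousFunction (ℝ × ℝ) (ι → ℝ) → ℝ × ℝ → ι → ℝ := fun Z p i =>
    ∑ j, ρ i j * Z (p.1 - P.ψ i (max p.2 0), 0) j +
      P.coupling (e i) (wave P.ψ f fun t x => Z (t, x)) i (p.1 - P.ψ i p.2) p.2
  have hcoord : ∀ (Z : BoundedContinuousFunction (ℝ × ℝ) (ι → ℝ)) p j, |Z p j| ≤ ‖Z‖ :=
    fun Z p j => (norm_le_pi_norm (Z p) j).trans (Z.norm_coe_le_norm p)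
  have hcont : ∀ (Z : BoundedContinuousFunction (ℝ × ℝ) (ι → ℝ)) j,
      Continuous fun p : ℝ × ℝ => Z (p.1, p.2) j := fun Z j =>
    (continuous_apply j).comp Z.continuous
  have hsplit : ∀ (Z : BoundedContinuousFunction (ℝ × ℝ) (ι → ℝ)) i c x,
      P.coupling (e i) (wave P.ψ f fun t x => Z (t, x)) i c x =
      P.coupling (e i) (wave P.ψ f 0) i c x + P.coupling (e i) (fun t x => Z (t, x)) i c x :=
    fun Z i c x => by
      rw [wave_eq_add, P.coupling_add (P.integrable_source_free hf i c).1
        (P.integrable_source_of_bounded (fun j => (hcont Z j).measurable)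
          (fun t x j => hcoord Z (t, x) j) i c)]
  have hFc : ∀ Z, Continuous (F Z) := fun Z => by
    refine continuous_pi fun i => Continuous.add ?_ ?_
    · refine continuous_finsetSum _ fun j _ => continuous_const.mul ?_
      refine (continuous_apply j).comp (Z.continuous.comp (Continuous.prodMk ?_ continuous_const))
      exact continuous_fst.sub ((P.continuous_ψ i).comp (continuous_snd.max continuous_const))
    · simp only [hsplit]
      have h1 : Continuous fun p : ℝ × ℝ => (p.1 - P.ψ i p.2, p.2) :=
        (continuous_fst.sub ((P.continuous_ψ i).comp continuous_snd)).prodMk continuous_snd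
      exact ((P.continuous_coupling_free hf (e i) i).comp h1).add
        ((P.continuous_coupling_of_bounded (hcont Z) (fun t x j => hcoord Z (t, x) j)
          (e i) i).comp h1)
  have hFb : ∀ Z p i, |F Z p i| ≤ ‖Z‖ / 2 * Ω + s := fun Z p i => by
    have h1 := hω.halving (fun t x => Z (t, x)) ‖Z‖ (norm_nonneg _) (fun t x j =>
      (hcoord Z (t, x) j).trans (le_mul_of_one_le_right (norm_nonneg _) (hω.one_le t x j)))
      p.1 p.2 i
    have h2 := P.abs_coupling_free_le hf (e i) i (p.1 - P.ψ i p.2) p.2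
    have h3 : ‖Z‖ / 2 * ω p.1 p.2 i ≤ ‖Z‖ / 2 * Ω :=
      mul_le_mul_of_nonneg_left (hω.le _ _ _) (by positivity)
    simp only [F, hsplit]
    rw [add_left_comm, ← add_comm]
    exact (abs_add_le _ _).trans (add_le_add (h1.trans h3) h2)
  let G : BoundedContinuousFunction (ℝ × ℝ) (ι → ℝ) → BoundedContinuousFunction (ℝ × ℝ) (ι → ℝ) :=
    fun Z => BoundedContinuousFunction.ofNormedAddCommGroup (F Z) (hFc Z) (‖Z‖ / 2 * Ω + s)
      fun p => (pi_norm_le_iff_of_nonneg (by positivity)).2 fun i => hFb Z p i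
  have hG : ∀ Z Z' (A : ℝ), 0 ≤ A → (∀ p j, |Z p j - Z' p j| ≤ A * ω p.1 p.2 j) →
      ∀ p i, |G Z p i - G Z' p i| ≤ A / 2 * ω p.1 p.2 i := fun Z Z' A hA h p i => by
    have h1 := hω.halving (fun t x => Z (t, x) - Z' (t, x)) A hA (fun t x j => h (t, x) j) p.1 p.2 i
    have h2 := P.coupling_sub (P.integrable_source_of_bounded (fun j => (hcont Z j).measurable)
          (fun t x j => hcoord Z (t, x) j) i (p.1 - P.ψ i p.2))
          (P.integrable_source_of_bounded (fun j => (hcont Z' j).measurable)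
          (fun t x j => hcoord Z' (t, x) j) i (p.1 - P.ψ i p.2)) (e i) p.2
    change |F Z p i - F Z' p i| ≤ _
    simp only [F, hsplit]
    convert h1 using 2
    simp only [Pi.sub_apply, mul_sub, Finset.sum_sub_distrib]
    change _ = _ + P.coupling (e i) ((fun t x => Z (t, x)) - fun t x => Z' (t, x)) _ _ _
    rw [h2]
    ring
  -- the Picard iterates converge geometrically in the weighted norm, hence in the sup norm
  let u : ℕ → BoundedContinuousFunction (ℝ × ℝ) (ι → ℝ) := fun n => G^[n] 0
  have hu : ∀ n p j, |u n p j - u (n + 1) p j| ≤ ‖G 0‖ * (1 / 2) ^ n * ω p.1 p.2 j := by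
    intro n
    induction n with
    | zero =>
      intro p j
      have : |u 0 p j - u (0 + 1) p j| = |G 0 p j| := by simp [u]
      rw [this, pow_zero, mul_one]
      exact (hcoord _ _ _).trans (le_mul_of_one_le_right (norm_nonneg _) (hω.one_le _ _ _))
    | succ n ih =>
      intro p j
      have := hG (u n) (u (n + 1)) _ (by positivity) ih p j
      simp only [u, Function.iterate_succ_apply'] at this ⊢
      convert this using 1
      ring
  have hd : ∀ n, dist (u n) (u (n + 1)) ≤ ‖G 0‖ * Ω * (1 / 2) ^ n := fun n => by
    rw [BoundedContinuousFunction.dist_le (by positivity)]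
    intro p
    rw [dist_eq_norm, pi_norm_le_iff_of_nonneg (by positivity)]
    intro j
    refine (hu n p j).trans ?_
    calc ‖G 0‖ * (1 / 2) ^ n * ω p.1 p.2 j ≤ ‖G 0‖ * (1 / 2) ^ n * Ω :=
          mul_le_mul_of_nonneg_left (hω.le _ _ _) (by positivity)
      _ = _ := by ring
  obtain ⟨Z, hZ⟩ := cauchySeq_tendsto_of_complete
    (cauchySeq_of_le_geometric _ _ (by norm_num) hd)
  have hlip : LipschitzWith (Real.toNNReal (Ω / 2)) G := LipschitzWith.of_dist_le_mul fun Z Z' => by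
    rw [BoundedContinuousFunction.dist_le (by positivity)]
    intro p
    rw [dist_eq_norm, pi_norm_le_iff_of_nonneg (by positivity), Real.coe_toNNReal _ (by positivity)]
    intro j
    refine (hG Z Z' (dist Z Z') dist_nonneg (fun p j => ?_) p j).trans ?_
    · refine le_trans ?_ (le_mul_of_one_le_right dist_nonneg (hω.one_le _ _ _))
      rw [dist_eq_norm]
      exact hcoord (Z - Z') p j
    · calc dist Z Z' / 2 * ω p.1 p.2 j ≤ dist Z Z' / 2 * Ω :=
            mul_le_mul_of_nonneg_left (hω.le _ _ _) (by positivity)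
        _ = _ := by ring
  have hfix : G Z = Z := by
    refine tendsto_nhds_unique ?_ ((tendsto_add_atTop_iff_nat 1).2 hZ)
    simp only [u, Function.iterate_succ_apply']
    exact (hlip.continuous.tendsto Z).comp hZ
  refine ⟨Z, fun t x i => ?_⟩
  conv_lhs => rw [← hfix]
  rfl

end TransportSystem

/-! ### Three contractive problems -/

namespace TransportSystem

variable {ι : Type*} [Fintype ι] [Nonempty ι] (P : TransportSystem ι)

theorem intervalIntegral_exp_le {L a : ℝ} (hL : 0 < L) :
    ∫ y in (0 : ℝ)..a, Real.exp (L * y) ≤ Real.exp (L * a) / L := by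
  have hd : ∀ y ∈ uIcc 0 a, HasDerivAt (fun y => Real.exp (L * y) / L) (Real.exp (L * y)) y :=
    fun y _ => by
      have := (((hasDerivAt_id y).const_mul L).exp).div_const L
      simpa [mul_div_assoc, hL.ne'] using this
  rw [intervalIntegral.integral_eq_sub_of_hasDerivAt hd
    (Continuous.intervalIntegrable (by fun_prop) _ _)]
  have : 0 < Real.exp (L * 0) / L := by positivity
  linarith

theorem abs_source_le_of_bounded {w : ℝ → ℝ → ι → ℝ} {i : ι} {c y R : ℝ} (hR : 0 ≤ R)
    (h : ∀ j, |w (c + P.ψ i y) y j| ≤ R) :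
    |P.source w i c y| ≤ Fintype.card ι * P.bound * R := by
  refine (P.abs_source_le h).trans ?_
  have h0 := mul_nonneg (mul_nonneg (Nat.cast_nonneg (α := ℝ) (Fintype.card ι)) P.bound_nonneg) hR
  have h1 : (Ioo (0 : ℝ) 1).indicator (1 : ℝ → ℝ) y ≤ 1 := by
    by_cases hy : y ∈ Ioo (0 : ℝ) 1 <;> simp [hy]
  calc _ = Fintype.card ι * P.bound * R *
        (|P.cut (c + P.ψ i y)| * (Ioo (0 : ℝ) 1).indicator 1 y) := by ring
    _ ≤ Fintype.card ι * P.bound * R * (1 * 1) := mul_le_mul_of_nonneg_left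
        (mul_le_mul (P.abs_cut_le _) h1 (indicator_nonneg (fun _ _ => zero_le_one) _)
          zero_le_one) h0
    _ = _ := by ring

/-- If all data are given at `x = 0`, the problem is an evolution problem in the variable `x`, and
an exponential weight in `x` is contractive. -/
theorem exists_isContractive_left :
    ∃ ω Ω, P.IsContractive (fun _ => 0) 0 ω Ω := by
  set L : ℝ := 2 * (Fintype.card ι * P.bound) + 1
  have hb : 0 ≤ Fintype.card ι * P.bound := mul_nonneg (Nat.cast_nonneg _) P.bound_nonneg
  have hL : 0 < L := by positivity
  refine ⟨fun _ x _ => Real.exp (L * max 0 (min x 1)), Real.exp (L * 1), fun t x i => ?_,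
    fun t x i => ?_, fun w A hA h t x i => ?_⟩
  · exact Real.one_le_exp (mul_nonneg hL.le (le_max_left _ _))
  · exact Real.exp_le_exp.2
      (mul_le_mul_of_nonneg_left (max_le zero_le_one (min_le_right _ _)) hL.le)
  · simp only [Matrix.zero_apply, zero_mul, Finset.sum_const_zero, zero_add]
    set c := t - P.ψ i x
    set a := max 0 (min x 1) with ha
    -- the source vanishes off `(0, 1)`
    have hx : P.coupling 0 w i c x = ∫ y in (0 : ℝ)..a, P.source w i c y := by
      have h0 : ∀ u v : ℝ, (∀ y ∈ uIcc u v, y ∉ Ioo (0 : ℝ) 1) →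
          ∫ y in u..v, P.source w i c y = 0 := fun u v huv => by
        rw [intervalIntegral.integral_congr (g := fun _ => 0) fun y hy =>
          P.source_eq_zero_of_notMem w i c (huv y hy)]
        simp
      unfold coupling
      rcases le_total x 0 with hx0 | hx0
      · rw [h0 0 x fun y hy hy' => ?_, show a = 0 from max_eq_left (min_le_of_left_le hx0)]
        · simp
        · rw [uIcc_of_ge hx0] at hy
          exact hy'.1.not_ge hy.2
      rcases le_total x 1 with hx1 | hx1
      · rw [ha, min_eq_left hx1, max_eq_right hx0]
      · rw [ha, min_eq_right hx1, max_eq_right zero_le_one]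
        rw [intervalIntegral.integral_of_le hx0, intervalIntegral.integral_of_le zero_le_one]
        refine setIntegral_eq_of_subset_of_forall_sdiff_eq_zero measurableSet_Ioc
          (Ioc_subset_Ioc_right hx1) fun y hy => P.source_eq_zero_of_notMem _ _ _ fun hy' =>
            hy.2 ⟨hy'.1, hy'.2.le⟩
    have ha0 : 0 ≤ a := le_max_left _ _
    have ha1 : a ≤ 1 := max_le zero_le_one (min_le_right _ _)
    have hbound : ∀ y ∈ Ioc 0 a, ‖P.source w i c y‖ ≤
        Fintype.card ι * P.bound * A * Real.exp (L * y) := fun y hy => by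
      rw [Real.norm_eq_abs, mul_assoc]
      refine P.abs_source_le_of_bounded (by positivity) fun j => (h _ _ j).trans_eq ?_
      rw [min_eq_left (hy.2.trans ha1), max_eq_right hy.1.le]
    rw [hx, ← Real.norm_eq_abs]
    refine (intervalIntegral.norm_integral_le_of_norm_le ha0 (Eventually.of_forall hbound)
      (Continuous.intervalIntegrable (by fun_prop) _ _)).trans ?_
    rw [intervalIntegral.integral_const_mul]
    have h1 := intervalIntegral_exp_le (a := a) hL
    have h2 := mul_le_mul_of_nonneg_left h1 (mul_nonneg hb hA)
    refine h2.trans ?_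
    rw [mul_div_assoc', div_le_iff₀ hL]
    have : 0 < Real.exp (L * a) := Real.exp_pos _
    have h3 : Fintype.card ι * P.bound ≤ L / 2 := by simp only [L]; linarith
    calc Fintype.card ι * P.bound * A * Real.exp (L * a) ≤ L / 2 * A * Real.exp (L * a) := by gcongr
      _ = _ := by ring

/-- If the coupling is concentrated on a short interval, then it is a small perturbation, whatever
the sides on which the data are given. -/
theorem isContractive_of_coeff_eq_zero {ε : ℝ} (hε : 0 < ε)
    (hP : ∀ i j x, ε ≤ x → P.coeff i j x = 0)
    (hsmall : Fintype.card ι * P.bound * ε ≤ 1 / 2) (e : ι → ℝ) :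
    P.IsContractive e 0 (fun _ _ _ => 1) 1 := by
  refine ⟨fun _ _ _ => le_rfl, fun _ _ _ => le_rfl, fun w A hA h t x i => ?_⟩
  simp only [Matrix.zero_apply, zero_mul, Finset.sum_const_zero, zero_add, mul_one] at h ⊢
  set c := t - P.ψ i x
  set R := Fintype.card ι * P.bound * A with hRdef
  have hR : 0 ≤ R := mul_nonneg (mul_nonneg (Nat.cast_nonneg _) P.bound_nonneg) hA
  have hbound : ∀ y, ‖P.source w i c y‖ ≤ (Ioc 0 ε).indicator (fun _ => R) y := fun y => by
    by_cases hy : y ∈ Ioc 0 ε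
    · rw [indicator_of_mem hy]
      exact P.abs_source_le_of_bounded hA fun j => h _ _ j
    · rw [indicator_of_notMem hy, norm_le_zero_iff]
      by_cases hy0 : 0 < y
      · exact Finset.sum_eq_zero fun j _ => by
          rw [hP i j y (le_of_not_ge fun h' => hy ⟨hy0, h'⟩)]; ring
      · exact P.source_eq_zero_of_notMem _ _ _ fun h' => hy0 h'.1
  have hint : Integrable ((Ioc 0 ε).indicator fun _ : ℝ => R) :=
    (integrable_indicator_iff measurableSet_Ioc).2 (integrableOn_const (by simp))
  rw [← Real.norm_eq_abs]
  calc ‖P.coupling (e i) w i c x‖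
      ≤ |∫ y in (e i)..x, (Ioc 0 ε).indicator (fun _ => R) y| :=
        intervalIntegral.norm_integral_le_abs_of_norm_le (Eventually.of_forall hbound)
          hint.intervalIntegrable
    _ ≤ ∫ y in uIoc (e i) x, ‖(Ioc 0 ε).indicator (fun _ => R) y‖ :=
        Real.norm_eq_abs (∫ y in (e i)..x, (Ioc 0 ε).indicator (fun _ => R) y) ▸
          intervalIntegral.norm_integral_le_integral_norm_uIoc
    _ ≤ ∫ y, ‖(Ioc 0 ε).indicator (fun _ => R) y‖ :=
        setIntegral_le_integral hint.norm (Eventually.of_forall fun _ => norm_nonneg _)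
    _ = ∫ y, (Ioc 0 ε).indicator (fun _ => R) y := by
        congr 1; ext y
        exact Real.norm_of_nonneg (indicator_nonneg (fun _ _ => hR) _)
    _ = ε * R := by
        rw [integral_indicator measurableSet_Ioc]; simp [hε.le]
    _ ≤ A / 2 := by
        calc ε * R = Fintype.card ι * P.bound * ε * A := by rw [hRdef]; ring
          _ ≤ 1 / 2 * A := mul_le_mul_of_nonneg_right hsmall hA
          _ = _ := by ring

end TransportSystem

namespace TransportSystem

variable {k m : ℕ} (P : TransportSystem (Fin k ⊕ Fin m))

/-- The components of the first kind travel from `x = 0` to `x = 1`, those of the second kind from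
`x = 1` to `x = 0`. -/
structure IsSigned : Prop where
  slope_inl : ∀ i x, 0 < P.slope (Sum.inl i) x
  slope_inr : ∀ j x, P.slope (Sum.inr j) x < 0

/-- The end of the interval at which the components enter. -/
def entry : Fin k ⊕ Fin m → ℝ
  | Sum.inl _ => 0
  | Sum.inr _ => 1

/-- The matrix of the reflection of the components of the second kind at `x = 0`. -/
def reflection (B : Matrix (Fin k) (Fin m) ℝ) : Matrix (Fin k ⊕ Fin m) (Fin k ⊕ Fin m) ℝ :=
  Matrix.fromBlocks 0 B 0 0

variable {P}

theorem IsSigned.strictMono (h : P.IsSigned) (i : Fin k) : StrictMono (P.ψ (Sum.inl i)) :=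
  strictMono_of_deriv_pos fun x => by rw [(P.hasDerivAt_ψ _ x).deriv]; exact h.slope_inl i x

theorem IsSigned.strictAnti (h : P.IsSigned) (j : Fin m) : StrictAnti (P.ψ (Sum.inr j)) :=
  strictAnti_of_deriv_neg fun x => by rw [(P.hasDerivAt_ψ _ x).deriv]; exact h.slope_inr j x

/-- Following a characteristic back to the side at which it enters means going back in time. -/
theorem IsSigned.time_le (h : P.IsSigned) (i : Fin k ⊕ Fin m) {t x y : ℝ}
    (hy : y ∈ uIcc (entry i) x) (hy' : y ∈ Ioo (0 : ℝ) 1) : t - P.ψ i x + P.ψ i y ≤ t := by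
  rcases i with i | j
  · have : y ≤ x := by
      rcases le_total 0 x with h0 | h0
      · rw [entry, uIcc_of_le h0] at hy; exact hy.2
      · rw [entry, uIcc_of_ge h0] at hy; exact absurd hy.2 hy'.1.not_ge
    linarith [(h.strictMono i).monotone this]
  · have : x ≤ y := by
      rcases le_total x 1 with h0 | h0
      · rw [entry, uIcc_of_ge h0] at hy; exact hy.1
      · rw [entry, uIcc_of_le h0] at hy; exact absurd hy.1 hy'.2.not_ge
    linarith [(h.strictAnti j).antitone this]

/-- With the reflection law at `x = 0`, and with the data of the components of the second kind given
at `x = 1`, the problem is an evolution problem in the variable `t`. -/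
theorem IsSigned.exists_isContractive_forward [Nonempty (Fin k ⊕ Fin m)] (hs : P.IsSigned)
    (hT : 0 ≤ P.T) (B : Matrix (Fin k) (Fin m) ℝ) :
    ∃ ω Ω, P.IsContractive entry (reflection B) ω Ω := by
  set β : ℝ := ∑ i, ∑ j, |B i j|
  have hβ : 0 ≤ β := Finset.sum_nonneg fun _ _ => Finset.sum_nonneg fun _ _ => abs_nonneg _
  -- the components produced by the reflection get a large weight, which absorbs the factor `B`
  set H : ℝ := 1 + 4 * β with hH
  have hH1 : 1 ≤ H := by linarith
  set N : ℝ := Fintype.card (Fin k ⊕ Fin m) * P.bound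
  have hN : 0 ≤ N := mul_nonneg (Nat.cast_nonneg _) P.bound_nonneg
  have hκ := P.κ_pos
  -- for this rate the coupling term has at most a quarter of the size of the weight
  set L : ℝ := 4 * N * H / P.κ + 1
  have hL : 0 < L := by positivity
  set τ : ℝ → ℝ := fun t => max 0 (min t P.T) with hτ
  have hτmono : Monotone τ := fun s t h => max_le_max le_rfl (min_le_min h le_rfl)
  set a : Fin k ⊕ Fin m → ℝ := Sum.elim (fun _ => H) fun _ => 1 with ha
  have ha1 : ∀ i, 1 ≤ a i := by rintro (i | j) <;> simp [ha, hH1]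
  have haH : ∀ i, a i ≤ H := by rintro (i | j) <;> simp [ha, hH1]
  have hτ0 : ∀ t, 0 ≤ τ t := fun t => le_max_left _ _
  refine ⟨fun t _ i => a i * Real.exp (L * τ t), H * Real.exp (L * P.T), fun t x i => ?_,
    fun t x i => ?_, fun w A hA h t x i => ?_⟩
  · exact one_le_mul_of_one_le_of_one_le (ha1 i) (Real.one_le_exp (mul_nonneg hL.le (hτ0 t)))
  · exact mul_le_mul (haH i) (Real.exp_le_exp.2 (mul_le_mul_of_nonneg_left
      (max_le hT (min_le_right _ _)) hL.le)) (Real.exp_pos _).le (by positivity)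
  set X := Real.exp (L * τ t) with hX
  have hX0 : 0 < X := Real.exp_pos _
  have hcoup : |P.coupling (entry i) w i (t - P.ψ i x) x| ≤ A / 4 * X := by
    set c := t - P.ψ i x with hc
    set φ : ℝ → ENNReal := (Ioc 0 (τ t)).indicator fun s => ENNReal.ofReal (Real.exp (L * s))
    have hφ : ∫⁻ s, φ s ≤ ENNReal.ofReal (X / L) := by
      rw [lintegral_indicator measurableSet_Ioc, ← ofReal_integral_eq_lintegral_ofReal]
      · refine ENNReal.ofReal_le_ofReal ?_
        rw [← intervalIntegral.integral_of_le (hτ0 t)]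
        exact intervalIntegral_exp_le hL
      · exact ((by fun_prop : Continuous fun s => Real.exp (L * s)).integrableOn_Ioc)
      · exact Eventually.of_forall fun s => (Real.exp_pos _).le
    have hpt : ∀ y ∈ uIoc (entry i) x, ‖P.source w i c y‖ₑ ≤
        ENNReal.ofReal (N * (A * H)) * φ (c + P.ψ i y) := fun y hy => by
      by_cases hy' : y ∈ Ioo (0 : ℝ) 1
      swap
      · rw [P.source_eq_zero_of_notMem _ _ _ hy']; simp
      by_cases hcut : c + P.ψ i y ∈ Ioo 0 P.T
      swap
      · have : P.source w i c y = 0 := Finset.sum_eq_zero fun j _ => by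
          simp [cut, -mem_Ioo, hcut]
        rw [this]; simp
      have hle : c + P.ψ i y ≤ t := hs.time_le i (uIoc_subset_uIcc hy) hy'
      have hmem : c + P.ψ i y ∈ Ioc 0 (τ t) :=
        ⟨hcut.1, le_max_of_le_right (le_min hle hcut.2.le)⟩
      have hτs : τ (c + P.ψ i y) = c + P.ψ i y := by
        simp only [hτ]
        rw [min_eq_left hcut.2.le, max_eq_right hcut.1.le]
      simp only [φ, indicator_of_mem hmem]
      rw [← ENNReal.ofReal_mul (by positivity), Real.enorm_eq_ofReal_abs]
      refine ENNReal.ofReal_le_ofReal ?_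
      rw [mul_assoc]
      refine P.abs_source_le_of_bounded (by positivity) fun j => (h _ _ j).trans ?_
      rw [hτs, mul_assoc]
      have := haH j
      gcongr
    have h1 : ‖P.coupling (entry i) w i c x‖ₑ ≤ ENNReal.ofReal (N * (A * H) * (X / L / P.κ)) := by
      calc ‖P.coupling (entry i) w i c x‖ₑ
          = ‖∫ y in uIoc (entry i) x, P.source w i c y‖ₑ := by
            rw [← ofReal_norm, ← ofReal_norm, coupling,
              intervalIntegral.norm_intervalIntegral_eq]
        _ ≤ ∫⁻ y in uIoc (entry i) x, ‖P.source w i c y‖ₑ := enorm_integral_le_lintegral_enorm _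
        _ ≤ ∫⁻ y in uIoc (entry i) x, ENNReal.ofReal (N * (A * H)) * φ (c + P.ψ i y) :=
            setLIntegral_mono' measurableSet_uIoc hpt
        _ = ENNReal.ofReal (N * (A * H)) * ∫⁻ y in uIoc (entry i) x, φ (c + P.ψ i y) :=
            lintegral_const_mul' _ _ ENNReal.ofReal_ne_top
        _ ≤ ENNReal.ofReal (N * (A * H)) * ENNReal.ofReal (X / L / P.κ) := by
            gcongr
            rw [ENNReal.ofReal_div_of_pos hκ, ENNReal.le_div_iff_mul_le
              (Or.inl (by simpa using hκ)) (Or.inl ENNReal.ofReal_ne_top), mul_comm]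
            exact (ofReal_mul_lintegral_comp_le hκ (fun y => (P.hasDerivAt_ψ i y).const_add c)
              (P.le_abs_slope i) φ measurableSet_uIoc).trans hφ
        _ = _ := (ENNReal.ofReal_mul (by positivity)).symm
    rw [Real.enorm_eq_ofReal_abs, ENNReal.ofReal_le_ofReal_iff (by positivity)] at h1
    refine h1.trans ?_
    have h2 : 4 * N * H ≤ L * P.κ := by
      have : L * P.κ = 4 * N * H + P.κ := by simp only [L]; field_simp
      linarith
    rw [div_div, mul_div_assoc', div_le_iff₀ (by positivity)]
    nlinarith [mul_nonneg hA hX0.le]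
  have hsum : |∑ j, reflection B i j * w (t - P.ψ i (max x 0)) 0 j| ≤ (a i - 1) / 4 * A * X := by
    rcases i with i | i
    · have hle : t - P.ψ (Sum.inl i) (max x 0) ≤ t := by
        have := (hs.strictMono i).monotone (le_max_right x 0)
        rw [P.ψ_zero] at this
        linarith
      have h4 : (a (Sum.inl i) - 1) / 4 = β := by simp [ha, hH]
      rw [h4, Fintype.sum_sum_type]
      simp only [reflection, Matrix.fromBlocks_apply₁₁, Matrix.fromBlocks_apply₁₂,
        Matrix.zero_apply, zero_mul, Finset.sum_const_zero, zero_add]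
      refine (Finset.abs_sum_le_sum_abs _ _).trans ?_
      have h5 : ∀ j, |B i j * w (t - P.ψ (Sum.inl i) (max x 0)) 0 (Sum.inr j)| ≤
          |B i j| * (A * X) := fun j => by
        rw [abs_mul]
        refine mul_le_mul_of_nonneg_left ((h _ _ _).trans ?_) (abs_nonneg _)
        simp only [ha, Sum.elim_inr, one_mul]
        refine mul_le_mul_of_nonneg_left (Real.exp_le_exp.2 ?_) hA
        exact mul_le_mul_of_nonneg_left (hτmono hle) hL.le
      refine (Finset.sum_le_sum fun j _ => h5 j).trans ?_
      rw [← Finset.sum_mul, mul_assoc]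
      refine mul_le_mul_of_nonneg_right ?_ (by positivity)
      exact Finset.single_le_sum (f := fun i => ∑ j, |B i j|)
        (fun _ _ => Finset.sum_nonneg fun _ _ => abs_nonneg _) (Finset.mem_univ i)
    · have h4 : (a (Sum.inr i) - 1) / 4 * A * X = 0 := by simp [ha]
      rw [h4, Fintype.sum_sum_type]
      simp [reflection]
  refine (abs_add_le _ _).trans ((add_le_add hsum hcoup).trans ?_)
  have := ha1 i
  have h6 := mul_nonneg hA hX0.le
  nlinarith [mul_nonneg h6 (sub_nonneg.2 this)]

/-- The solution of the forward problem is freely transported before time `0`. -/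
theorem IsSigned.eq_zero_of_nonpos (hs : P.IsSigned) {B : Matrix (Fin k) (Fin m) ℝ}
    {f : Fin k ⊕ Fin m → ℝ → ℝ} {z : ℝ → ℝ → Fin k ⊕ Fin m → ℝ}
    (hz : P.IsSolution entry (reflection B) f z) {t : ℝ} (ht : t ≤ 0) (x : ℝ)
    (i : Fin k ⊕ Fin m) : z t x i = 0 := by
  have hcoup : ∀ {t : ℝ}, t ≤ 0 → ∀ i x,
      P.coupling (entry i) (wave P.ψ f z) i (t - P.ψ i x) x = 0 := fun {t} ht i x => by
    unfold coupling
    rw [intervalIntegral.integral_congr (g := fun _ => 0) fun y hy => ?_]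
    · simp
    · by_cases hy' : y ∈ Ioo (0 : ℝ) 1
      · exact P.source_eq_zero_of_nonpos _ _ ((hs.time_le i hy hy').trans ht)
      · exact P.source_eq_zero_of_notMem _ _ _ hy'
  have hinr : ∀ {t : ℝ}, t ≤ 0 → ∀ x j, z t x (Sum.inr j) = 0 := fun {t} ht x j => by
    rw [hz, hcoup ht, Fintype.sum_sum_type]
    simp [reflection]
  rcases i with i | j
  · rw [hz, hcoup ht, add_zero, Fintype.sum_sum_type]
    simp only [reflection, Matrix.fromBlocks_apply₁₁, Matrix.fromBlocks_apply₁₂,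
        Matrix.zero_apply, zero_mul, Finset.sum_const_zero, zero_add]
    refine Finset.sum_eq_zero fun j _ => ?_
    have := (hs.strictMono i).monotone (le_max_right x 0)
    rw [P.ψ_zero] at this
    rw [hinr (by linarith), mul_zero]
  · exact hinr ht x j

end TransportSystem

/-! ### Matching the forward and the mixed problem -/

namespace TransportSystem

section general

variable {ι : Type*} (P : TransportSystem ι)

/-- The system whose coupling is restricted to the abscissas less than `ε`. -/
noncomputable def truncate (ε : ℝ) : TransportSystem ι where
  __ := P
  coeff i j := (Iio ε).indicator (P.coeff i j)
  measurable_coeff i j := (P.measurable_coeff i j).indicator measurableSet_Iio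
  abs_coeff_le i j x := by
    by_cases h : x ∈ Iio ε
    · rw [indicator_of_mem h]; exact P.abs_coeff_le i j x
    · rw [indicator_of_notMem h, abs_zero]; exact (abs_nonneg _).trans (P.abs_coeff_le i j x)
  coeff_self i x := by
    by_cases h : x ∈ Iio ε
    · rw [indicator_of_mem h]; exact P.coeff_self i x
    · exact indicator_of_notMem h _
  coeff_of_notMem i j x hx := by
    by_cases h : x ∈ Iio ε
    · rw [indicator_of_mem h]; exact P.coeff_of_notMem i j x hx
    · exact indicator_of_notMem h _

variable {P}

theorem memLp_of_abs_le_indicator {g : ℝ → ℝ} (hg : Measurable g) {a b A : ℝ}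
    (h : ∀ c, |g c| ≤ (Ioo a b).indicator (fun _ => A) c) : MemLp g 2 volume :=
  (memLp_indicator_const 2 measurableSet_Ioo A (Or.inr (by simp))).mono' hg.aestronglyMeasurable
    (Eventually.of_forall h)

theorem strictMono_or_strictAnti_sub {i j : ι} (h : i ≠ j) :
    StrictMono (fun x => P.ψ i x - P.ψ j x) ∨ StrictAnti (fun x => P.ψ i x - P.ψ j x) :=
  Continuous.strictMono_of_inj ((P.continuous_ψ i).sub (P.continuous_ψ j))
    (injective_of_le_abs_deriv P.κ_pos
      (fun x => (P.hasDerivAt_ψ i x).sub (P.hasDerivAt_ψ j x)) (P.le_abs_slope_sub i j h))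

theorem strictMono_sub_of_slope_lt {i j : ι} (h : ∀ x, P.slope i x < P.slope j x) :
    StrictMono fun x => P.ψ j x - P.ψ i x :=
  strictMono_of_deriv_pos fun x => by
    rw [((P.hasDerivAt_ψ j x).fun_sub (P.hasDerivAt_ψ i x)).deriv, sub_pos]; exact h x

variable [Fintype ι]

theorem source_truncate_of_lt {ε y : ℝ} (hy : y < ε) (w : ℝ → ℝ → ι → ℝ) (i : ι) (c : ℝ) :
    (P.truncate ε).source w i c y = P.source w i c y :=
  Finset.sum_congr rfl fun j _ => by
    change (Iio ε).indicator (P.coeff i j) y * P.cut _ * _ = _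
    rw [indicator_of_mem (mem_Iio.2 hy)]
    rfl

theorem source_eq_zero_of_eq_zero {w : ℝ → ℝ → ι → ℝ} {i : ι} {c y : ℝ}
    (h : ∀ j, w (c + P.ψ i y) y j = 0) : P.source w i c y = 0 :=
  Finset.sum_eq_zero fun j _ => by rw [h j, mul_zero]

/-- Solutions satisfy the integral equation between any two points of a characteristic. -/
theorem IsSolution.wave_eq [Nonempty ι] {e : ι → ℝ} {ρ : Matrix ι ι ℝ} {f : ι → ℝ → ℝ}
    {z : ℝ → ℝ → ι → ℝ} (hz : P.IsSolution e ρ f z) (hf : IsDatum f)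
    (hm : ∀ j, Measurable fun p : ℝ × ℝ => z p.1 p.2 j) {R : ℝ} (hR : ∀ t x j, |z t x j| ≤ R)
    (t : ℝ) {x : ℝ} (hx : 0 ≤ x) (i : ι) :
    wave P.ψ f z t x i = wave P.ψ f z (t - P.ψ i x) 0 i +
      P.coupling 0 (wave P.ψ f z) i (t - P.ψ i x) x := by
  have hi := P.integrable_source_wave hf hm hR i (t - P.ψ i x)
  have h1 := hz t x i
  have h2 := hz (t - P.ψ i x) 0 i
  simp only [max_self, P.ψ_zero, sub_zero, max_eq_left hx] at h1 h2
  simp only [wave, P.ψ_zero, sub_zero]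
  have h3 : P.coupling (e i) (wave P.ψ f z) i (t - P.ψ i x) x -
      P.coupling (e i) (wave P.ψ f z) i (t - P.ψ i x) 0 =
      P.coupling 0 (wave P.ψ f z) i (t - P.ψ i x) x :=
    intervalIntegral.integral_interval_sub_left hi.intervalIntegrable hi.intervalIntegrable
  linarith

/-- Bounded data on a short interval are small in `L²`. -/
theorem size_le_of_abs_le {g : ι → ℝ → ℝ} {a b A : ℝ} (hab : a ≤ b) (hA : 0 ≤ A)
    (hg : ∀ i c, |g i c| ≤ (Ioo a b).indicator (fun _ => A) c) :
    size g ≤ Fintype.card ι * (A * √(b - a)) := by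
  refine (Finset.sum_le_card_nsmul _ _ (A * √(b - a)) fun i _ => ?_).trans_eq (by simp)
  refine ENNReal.toReal_le_of_le_ofReal (by positivity) ?_
  refine (eLpNorm_mono_real (g := (Ioo a b).indicator fun _ => A) (hg i)).trans ?_
  rw [eLpNorm_indicator_const measurableSet_Ioo two_ne_zero ENNReal.ofNat_ne_top, Real.volume_Ioo,
    ENNReal.ofReal_mul hA, Real.enorm_of_nonneg hA, Real.sqrt_eq_rpow,
    ← ENNReal.ofReal_rpow_of_nonneg (by linarith) (by norm_num)]
  simp

theorem bcf_measurable (Z : BoundedContinuousFunction (ℝ × ℝ) (ι → ℝ)) (j : ι) :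
    Measurable fun p : ℝ × ℝ => Z (p.1, p.2) j :=
  ((continuous_apply j).comp Z.continuous).measurable

theorem bcf_abs_le (Z : BoundedContinuousFunction (ℝ × ℝ) (ι → ℝ)) (t x : ℝ) (j : ι) :
    |Z (t, x) j| ≤ ‖Z‖ :=
  (norm_le_pi_norm (Z (t, x)) j).trans (Z.norm_coe_le_norm _)

end general

variable {k m : ℕ} (P : TransportSystem (Fin k ⊕ Fin m))

/-- The data of the forward problem: the initial data `a`, transported freely to `x = 0`, and on the
interval `(α, β)` a control of the component `r`, chosen such that the `p`-th row of the reflection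
law gives the value `u`. -/
noncomputable def forwardDatum (B : Matrix (Fin k) (Fin m) ℝ) (p : Fin k) (r : Fin m) (α β : ℝ)
    (a : Fin k ⊕ Fin m → ℝ → ℝ) (u : ℝ → ℝ) : Fin k ⊕ Fin m → ℝ → ℝ :=
  let g : Fin m → ℝ → ℝ := fun j => if j = r then
      fun c => (Ioo α β).indicator
        (fun c => (B p r)⁻¹ * (u c - ∑ j ∈ {j | j ≠ r}, B p j * a (Sum.inr j) c)) c +
        (Ioo α β)ᶜ.indicator (a (Sum.inr r)) c
    else a (Sum.inr j)
  Sum.elim (fun i c => (Ioi 0).indicator (fun c => ∑ j, B i j * g j c) c +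
    (Iic 0).indicator (a (Sum.inl i)) c) g

section forwardDatum

variable {P} {B : Matrix (Fin k) (Fin m) ℝ} {p : Fin k} {r : Fin m} {α β : ℝ}
  {a : Fin k ⊕ Fin m → ℝ → ℝ}

theorem isDatum_forwardDatum (ha : IsDatum a) {u : ℝ → ℝ} (hu : Continuous u) {R : ℝ}
    (hR : ∀ c, |u c| ≤ R) : IsDatum (forwardDatum B p r α β a u) := by
  have hum : MemLp ((Ioo α β).indicator u) 2 volume :=
    memLp_of_abs_le_indicator (a := α) (b := β) (A := R)
      (hu.measurable.indicator measurableSet_Ioo) fun c => by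
        by_cases h : c ∈ Ioo α β
        · simpa only [indicator_of_mem h] using hR c
        · simp only [indicator_of_notMem h, abs_zero, le_refl]
  have hsum : MemLp (fun c => ∑ j ∈ {j | j ≠ r}, B p j * a (Sum.inr j) c) 2 volume :=
    memLp_finsetSum _ fun j _ => (ha (Sum.inr j)).2.const_mul _
  have hsumm : Measurable (fun c => ∑ j ∈ {j | j ≠ r}, B p j * a (Sum.inr j) c) :=
    Finset.measurable_sum _ fun j _ => (ha (Sum.inr j)).1.const_mul _
  have hg : ∀ j, Measurable (forwardDatum B p r α β a u (Sum.inr j)) ∧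
      MemLp (forwardDatum B p r α β a u (Sum.inr j)) 2 volume := fun j => by
    by_cases hj : j = r
    · simp only [forwardDatum, Sum.elim_inr, if_pos hj]
      refine ⟨?_, ?_⟩
      · exact (((hu.measurable.sub hsumm).const_mul _).indicator measurableSet_Ioo).add
          ((ha _).1.indicator measurableSet_Ioo.compl)
      · refine MemLp.add ?_ ((ha _).2.indicator measurableSet_Ioo.compl)
        have h1 := (hum.sub (hsum.indicator (measurableSet_Ioo (a := α) (b := β)))).const_mul
          (B p r)⁻¹
        refine h1.ae_eq (Eventually.of_forall fun c => ?_)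
        by_cases h : c ∈ Ioo α β <;> simp [-mem_Ioo, h]
    · simp only [forwardDatum, Sum.elim_inr, if_neg hj]
      exact ha _
  rintro (i | j)
  · have h1 : MemLp (fun c => ∑ j, B i j * forwardDatum B p r α β a u (Sum.inr j) c) 2 volume :=
      memLp_finsetSum _ fun j _ => (hg j).2.const_mul _
    have h2 : Measurable (fun c => ∑ j, B i j * forwardDatum B p r α β a u (Sum.inr j) c) :=
      Finset.measurable_sum _ fun j _ => (hg j).1.const_mul _
    exact ⟨(h2.indicator measurableSet_Ioi).add ((ha _).1.indicator measurableSet_Iic),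
      (h1.indicator measurableSet_Ioi).add ((ha _).2.indicator measurableSet_Iic)⟩
  · exact hg j

theorem forwardDatum_inl_of_pos {u : ℝ → ℝ} (i : Fin k) {c : ℝ} (hc : 0 < c) :
    forwardDatum B p r α β a u (Sum.inl i) c =
      ∑ j, B i j * forwardDatum B p r α β a u (Sum.inr j) c := by
  simp [forwardDatum, hc]

theorem forwardDatum_inl_of_nonpos {u : ℝ → ℝ} (i : Fin k) {c : ℝ} (hc : c ≤ 0) :
    forwardDatum B p r α β a u (Sum.inl i) c = a (Sum.inl i) c := by
  simp [forwardDatum, hc]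

theorem forwardDatum_inr_of_notMem {u : ℝ → ℝ} (j : Fin m) {c : ℝ} (hc : c ∉ Ioo α β) :
    forwardDatum B p r α β a u (Sum.inr j) c = a (Sum.inr j) c := by
  by_cases h : j = r
  · subst h; simp [forwardDatum, -mem_Ioo, hc]
  · simp [forwardDatum, h]

/-- The defining property of the control on `(α, β)`. -/
theorem sum_forwardDatum (hB : B p r ≠ 0) {u : ℝ → ℝ} {c : ℝ} (hc : c ∈ Ioo α β) :
    ∑ j, B p j * forwardDatum B p r α β a u (Sum.inr j) c = u c := by
  rw [← Finset.sum_filter_add_sum_filter_not Finset.univ (fun j => j ≠ r)]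
  have h1 : (Finset.univ.filter fun j : Fin m => ¬ j ≠ r) = {r} := by ext; simp
  have h2 : ∑ j ∈ {j | j ≠ r}, B p j * forwardDatum B p r α β a u (Sum.inr j) c =
      ∑ j ∈ {j | j ≠ r}, B p j * a (Sum.inr j) c := Finset.sum_congr rfl fun j hj => by
    have : j ≠ r := by simpa using hj
    simp [forwardDatum, this]
  rw [h1, Finset.sum_singleton, h2]
  simp only [forwardDatum, Sum.elim_inr, if_true, indicator_of_mem hc,
    indicator_of_notMem (notMem_compl_iff.2 hc), add_zero]
  rw [mul_inv_cancel_left₀ hB]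
  ring

/-- The forward data depend on the prescribed value `u` on `(α, β)` only, in a Lipschitz way. -/
theorem abs_forwardDatum_sub_le (hα : 0 ≤ α) {u u' : ℝ → ℝ} {A : ℝ} (hA : 0 ≤ A)
    (h : ∀ c, |u c - u' c| ≤ A) (i : Fin k ⊕ Fin m) (c : ℝ) :
    |(forwardDatum B p r α β a u - forwardDatum B p r α β a u') i c| ≤
      (Ioo α β).indicator (fun _ => |(B p r)⁻¹| * (1 + ∑ i, ∑ j, |B i j|) * A) c := by
  set b := ∑ i, ∑ j, |B i j|
  have hb : 0 ≤ b := Finset.sum_nonneg fun _ _ => Finset.sum_nonneg fun _ _ => abs_nonneg _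
  simp only [Pi.sub_apply]
  by_cases hc : c ∈ Ioo α β
  swap
  · have hinr : ∀ j, forwardDatum B p r α β a u (Sum.inr j) c =
        forwardDatum B p r α β a u' (Sum.inr j) c := fun j => by
      rw [forwardDatum_inr_of_notMem j hc, forwardDatum_inr_of_notMem j hc]
    rw [indicator_of_notMem hc, abs_nonpos_iff, sub_eq_zero]
    rcases i with i | j
    · rcases le_or_gt c 0 with h0 | h0
      · rw [forwardDatum_inl_of_nonpos i h0, forwardDatum_inl_of_nonpos i h0]
      · rw [forwardDatum_inl_of_pos i h0, forwardDatum_inl_of_pos i h0]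
        simp only [hinr]
    · exact hinr j
  rw [indicator_of_mem hc]
  have hinr : ∀ j, forwardDatum B p r α β a u (Sum.inr j) c -
      forwardDatum B p r α β a u' (Sum.inr j) c = if j = r then (B p r)⁻¹ * (u c - u' c) else 0 :=
    fun j => by
      by_cases hj : j = r
      · simp only [forwardDatum, Sum.elim_inr, if_pos hj, indicator_of_mem hc]
        ring
      · simp [forwardDatum, hj]
  have hBA : 0 ≤ |(B p r)⁻¹| * A := by positivity
  have h1 : |(B p r)⁻¹ * (u c - u' c)| ≤ |(B p r)⁻¹| * A := by
    rw [abs_mul]; exact mul_le_mul_of_nonneg_left (h c) (abs_nonneg _)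
  rcases i with i | j
  · rw [forwardDatum_inl_of_pos i (hα.trans_lt hc.1), forwardDatum_inl_of_pos i (hα.trans_lt hc.1),
      ← Finset.sum_sub_distrib]
    simp only [← mul_sub, hinr, mul_ite, mul_zero, Finset.sum_ite_eq', Finset.mem_univ, if_true]
    rw [abs_mul]
    have h2 : |B i r| ≤ b := (Finset.single_le_sum (f := fun j => |B i j|)
        (fun _ _ => abs_nonneg _) (Finset.mem_univ r)).trans
      (Finset.single_le_sum (f := fun i => ∑ j, |B i j|)
        (fun _ _ => Finset.sum_nonneg fun _ _ => abs_nonneg _) (Finset.mem_univ i))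
    calc |B i r| * |(B p r)⁻¹ * (u c - u' c)| ≤ b * (|(B p r)⁻¹| * A) :=
          mul_le_mul h2 h1 (abs_nonneg _) hb
      _ ≤ _ := by nlinarith
  · rw [hinr]
    by_cases hj : j = r
    · rw [if_pos hj]; refine h1.trans ?_
      nlinarith
    · rw [if_neg hj, abs_zero]; positivity

end forwardDatum

/-- The data of the mixed problem: the trace at `x = 0` of the forward solution on `(α, β)`, except
for the component `p`, whose datum is zero at `x = 1`. -/
noncomputable def mixedDatum (p : Fin k) (α β : ℝ) (f : Fin k ⊕ Fin m → ℝ → ℝ)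
    (z : ℝ → ℝ → Fin k ⊕ Fin m → ℝ) : Fin k ⊕ Fin m → ℝ → ℝ :=
  fun i => if i = Sum.inl p then 0 else (Ioo α β).indicator fun c => f i c + z c 0 i

/-- The sides at which the data of the mixed problem are given: `x = 1` for the component `p`, and
`x = 0` for the others. -/
noncomputable def mixedEntry (p : Fin k) (i : Fin k ⊕ Fin m) : ℝ := if i = Sum.inl p then 1 else 0

theorem isDatum_mixedDatum (p : Fin k) (α β : ℝ) {f : Fin k ⊕ Fin m → ℝ → ℝ} (hf : IsDatum f)
    (Z : BoundedContinuousFunction (ℝ × ℝ) (Fin k ⊕ Fin m → ℝ)) :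
    IsDatum (mixedDatum p α β f fun t x => Z (t, x)) := fun i => by
  by_cases hi : i = Sum.inl p
  · simp only [mixedDatum, if_pos hi]
    exact ⟨measurable_zero, MemLp.zero⟩
  · simp only [mixedDatum, if_neg hi]
    have hz : Measurable fun c => Z (c, 0) i :=
      (bcf_measurable Z i).comp (measurable_id.prodMk measurable_const)
    refine ⟨((hf i).1.add hz).indicator measurableSet_Ioo, ?_⟩
    have h1 : MemLp ((Ioo α β).indicator fun c => Z (c, 0) i) 2 volume :=
      memLp_of_abs_le_indicator (a := α) (b := β) (A := ‖Z‖) (hz.indicator measurableSet_Ioo)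
        fun c => by
          by_cases h : c ∈ Ioo α β
          · simpa only [indicator_of_mem h] using bcf_abs_le Z c 0 i
          · simp only [indicator_of_notMem h, abs_zero, le_refl]
    exact (((hf i).2.indicator (measurableSet_Ioo (a := α) (b := β))).add h1).ae_eq
      (Eventually.of_forall fun c => by by_cases h : c ∈ Ioo α β <;> simp [-mem_Ioo, h])

/-- If the interval `(α, β)` is short, then the control of the component `r` can be chosen such that
the forward solution and the solution of the mixed problem have the same `p`-th trace on it. -/
theorem exists_matching [Nonempty (Fin k ⊕ Fin m)] {P : TransportSystem (Fin k ⊕ Fin m)}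
    {B : Matrix (Fin k) (Fin m) ℝ}
    {p : Fin k} {r : Fin m} {ε : ℝ} {ω₁ : ℝ → ℝ → Fin k ⊕ Fin m → ℝ} {Ω₁ : ℝ}
    (h₁ : P.IsContractive entry (reflection B) ω₁ Ω₁)
    (h₂ : (P.truncate ε).IsContractive (mixedEntry p) 0 (fun _ _ _ => 1) 1) :
    ∃ δ₀ > 0, ∀ α β, 0 ≤ α → α ≤ β → β - α ≤ δ₀ → ∀ a : Fin k ⊕ Fin m → ℝ → ℝ, IsDatum a →
      ∃ (u : BoundedContinuousFunction ℝ ℝ)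
        (Z₁ Z₂ : BoundedContinuousFunction (ℝ × ℝ) (Fin k ⊕ Fin m → ℝ)),
        P.IsSolution entry (reflection B) (forwardDatum B p r α β a u) (fun t x => Z₁ (t, x)) ∧
        (P.truncate ε).IsSolution (mixedEntry p) 0
          (mixedDatum p α β (forwardDatum B p r α β a u) fun t x => Z₁ (t, x))
          (fun t x => Z₂ (t, x)) ∧
        ∀ c, u c = Z₂ (c, 0) (Sum.inl p) - Z₁ (c, 0) (Sum.inl p) := by
  classical
  set n : ℝ := (Fintype.card (Fin k ⊕ Fin m) : ℝ)
  set b := ∑ i, ∑ j, |B i j|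
  have hb : 0 ≤ b := Finset.sum_nonneg fun _ _ => Finset.sum_nonneg fun _ _ => abs_nonneg _
  -- `G₁ * √(β - α)` and `G₂ * √(β - α)` are Lipschitz constants of the bounded parts of the two
  -- solutions as functions of `u`
  set M := P.bound * (√P.κ)⁻¹
  have hM : 0 ≤ M := mul_nonneg P.bound_nonneg (by positivity)
  have hΩ : 0 ≤ Ω₁ := zero_le_one.trans
    ((h₁.one_le 0 0 (Classical.arbitrary _)).trans (h₁.le 0 0 _))
  set K := |(B p r)⁻¹| * (1 + b)
  have hK : 0 ≤ K := by positivity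
  set G₁ := 2 * (M * (n * K)) * Ω₁
  have hG₁ : 0 ≤ G₁ := by positivity
  set G₂ := 2 * (M * (n * (K + G₁))) * 1
  have hG₂ : 0 ≤ G₂ := by positivity
  set Γ := 2 * (G₁ + G₂) + 1
  have hΓ : 0 < Γ := by positivity
  refine ⟨min 1 (Γ⁻¹ ^ 2), by positivity, fun α β hα hαβ hδ a ha => ?_⟩
  have hs1 : √(β - α) ≤ 1 := Real.sqrt_le_one.2 (hδ.trans (min_le_left _ _))
  have hsΓ : √(β - α) ≤ Γ⁻¹ := Real.sqrt_le_iff.2 ⟨by positivity, hδ.trans (min_le_right _ _)⟩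
  have hs0 := Real.sqrt_nonneg (β - α)
  let f : BoundedContinuousFunction ℝ ℝ → Fin k ⊕ Fin m → ℝ → ℝ := fun u =>
    forwardDatum B p r α β a u
  have hf : ∀ u, IsDatum (f u) := fun u =>
    isDatum_forwardDatum ha u.continuous fun c => u.norm_coe_le_norm c
  choose Z₁ hZ₁ using fun u => h₁.exists_isSolution (hf u)
  have hg := fun u => isDatum_mixedDatum p α β (hf u) (Z₁ u)
  choose Z₂ hZ₂ using fun u => h₂.exists_isSolution (hg u)
  have hdist : ∀ u u' : BoundedContinuousFunction ℝ ℝ, ∀ c, |u c - u' c| ≤ dist u u' :=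
    fun u u' c => by rw [← Real.dist_eq]; exact BoundedContinuousFunction.dist_coe_le_dist c
  have hd₁ : ∀ u u' t x i, |Z₁ u (t, x) i - Z₁ u' (t, x) i| ≤ G₁ * √(β - α) * dist u u' :=
    fun u u' t x i => by
      refine (h₁.abs_sub_le (hf u) (hf u') (hZ₁ u) (hZ₁ u') (bcf_measurable _) (bcf_measurable _)
        (fun t x j => (bcf_abs_le _ t x j).trans (le_max_left ‖Z₁ u‖ ‖Z₁ u'‖))
        (fun t x j => (bcf_abs_le _ t x j).trans (le_max_right ‖Z₁ u‖ ‖Z₁ u'‖)) t x i).trans ?_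
      have := size_le_of_abs_le hαβ (mul_nonneg hK dist_nonneg)
        (abs_forwardDatum_sub_le (B := B) (p := p) (r := r) (β := β) (a := a) hα dist_nonneg
          (hdist u u'))
      calc 2 * (M * size (f u - f u')) * Ω₁
          ≤ 2 * (M * (n * (K * dist u u' * √(β - α)))) * Ω₁ := by gcongr
        _ = _ := by simp only [G₁]; ring
  have hd₂ : ∀ u u' t x i, |Z₂ u (t, x) i - Z₂ u' (t, x) i| ≤ G₂ * √(β - α) * dist u u' :=
    fun u u' t x i => by
      refine (h₂.abs_sub_le (hg u) (hg u') (hZ₂ u) (hZ₂ u') (bcf_measurable _) (bcf_measurable _)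
        (fun t x j => (bcf_abs_le _ t x j).trans (le_max_left ‖Z₂ u‖ ‖Z₂ u'‖))
        (fun t x j => (bcf_abs_le _ t x j).trans (le_max_right ‖Z₂ u‖ ‖Z₂ u'‖)) t x i).trans ?_
      have := size_le_of_abs_le (g := mixedDatum p α β (f u) (fun t x => Z₁ u (t, x)) -
          mixedDatum p α β (f u') fun t x => Z₁ u' (t, x)) hαβ
        (A := (K + G₁) * dist u u') (by positivity) (fun i c => by
          by_cases hi : i = Sum.inl p
          · simp only [Pi.sub_apply, mixedDatum, if_pos hi, Pi.zero_apply, sub_zero, abs_zero]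
            exact indicator_nonneg (fun _ _ => by positivity) _
          · simp only [Pi.sub_apply, mixedDatum, if_neg hi]
            by_cases hc : c ∈ Ioo α β
            · simp only [indicator_of_mem hc]
              have h3 := abs_forwardDatum_sub_le (B := B) (p := p) (r := r) (β := β) (a := a) hα
                dist_nonneg (hdist u u') i c
              rw [indicator_of_mem hc] at h3
              have h4 := hd₁ u u' c 0 i
              have h5 : G₁ * √(β - α) * dist u u' ≤ G₁ * 1 * dist u u' := by gcongr
              rw [add_sub_add_comm, add_mul]
              rw [mul_one] at h5
              exact (abs_add_le _ _).trans (add_le_add h3 (h4.trans h5))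
            · simp only [indicator_of_notMem hc, sub_zero, abs_zero, le_refl])
      calc 2 * (M * size _) * 1
          ≤ 2 * (M * (n * ((K + G₁) * dist u u' * √(β - α)))) * 1 := by gcongr
        _ = _ := by simp only [G₂]; ring
  have hc : ∀ (Z : BoundedContinuousFunction (ℝ × ℝ) (Fin k ⊕ Fin m → ℝ)),
      Continuous fun c : ℝ => Z (c, 0) (Sum.inl p) := fun Z =>
    (continuous_apply _).comp (Z.continuous.comp (continuous_id.prodMk continuous_const))
  -- the matching condition is a fixed point equation for `u`
  let Φ : BoundedContinuousFunction ℝ ℝ → BoundedContinuousFunction ℝ ℝ := fun u =>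
    BoundedContinuousFunction.ofNormedAddCommGroup
      (fun c => Z₂ u (c, 0) (Sum.inl p) - Z₁ u (c, 0) (Sum.inl p)) ((hc _).sub (hc _))
      (‖Z₂ u‖ + ‖Z₁ u‖) fun c =>
        (norm_sub_le _ _).trans (add_le_add (bcf_abs_le _ _ _ _) (bcf_abs_le _ _ _ _))
  have hΦ : ContractingWith (1 / 2) Φ := by
    refine ⟨by rw [← NNReal.coe_lt_coe]; norm_num, LipschitzWith.of_dist_le_mul fun u u' => ?_⟩
    rw [BoundedContinuousFunction.dist_le (by positivity)]
    intro c
    have h3 := hd₁ u u' c 0 (Sum.inl p)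
    have h4 := hd₂ u u' c 0 (Sum.inl p)
    have h5 : (G₁ + G₂) * √(β - α) ≤ 1 / 2 := by
      calc (G₁ + G₂) * √(β - α) ≤ (G₁ + G₂) * Γ⁻¹ := by gcongr
        _ ≤ 1 / 2 := by
          rw [← div_eq_mul_inv, div_le_iff₀ hΓ]; simp only [Γ]; linarith
    have h6 := mul_le_mul_of_nonneg_right h5 (dist_nonneg (x := u) (y := u'))
    rw [Real.dist_eq]
    change |Z₂ u (c, 0) (Sum.inl p) - Z₁ u (c, 0) (Sum.inl p) -
      (Z₂ u' (c, 0) (Sum.inl p) - Z₁ u' (c, 0) (Sum.inl p))| ≤ _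
    rw [sub_sub_sub_comm]
    refine (abs_sub _ _).trans ((add_le_add h4 h3).trans ?_)
    simp only [NNReal.coe_div, NNReal.coe_one, NNReal.coe_ofNat]
    linarith
  refine ⟨hΦ.fixedPoint, Z₁ _, Z₂ _, hZ₁ _, hZ₂ _, fun c => ?_⟩
  conv_lhs => rw [← hΦ.fixedPoint_isFixedPt]
  rfl

end TransportSystem

/-! ### Null control in characteristic form -/

namespace TransportSystem

variable {k m : ℕ} {P : TransportSystem (Fin k ⊕ Fin m)}

/-- The data at `x = 0` of the controlled solution: the trace of the forward solution up to the time
`β`, and zero afterwards. -/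
noncomputable def gluedDatum (β : ℝ) (f : Fin k ⊕ Fin m → ℝ → ℝ)
    (z : ℝ → ℝ → Fin k ⊕ Fin m → ℝ) : Fin k ⊕ Fin m → ℝ → ℝ :=
  fun i => (Iio β).indicator fun c => f i c + z c 0 i

theorem isDatum_gluedDatum {β : ℝ} {f : Fin k ⊕ Fin m → ℝ → ℝ} (hf : IsDatum f)
    (Z : BoundedContinuousFunction (ℝ × ℝ) (Fin k ⊕ Fin m → ℝ))
    (hZ : ∀ c ≤ 0, ∀ i, Z (c, 0) i = 0) :
    IsDatum (gluedDatum β f fun t x => Z (t, x)) := fun i => by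
  have hz : Measurable fun c => Z (c, 0) i :=
    (bcf_measurable Z i).comp (measurable_id.prodMk measurable_const)
  refine ⟨((hf i).1.add hz).indicator measurableSet_Iio, ?_⟩
  have h1 : MemLp ((Iio β).indicator fun c => Z (c, 0) i) 2 volume :=
    memLp_of_abs_le_indicator (a := 0) (b := β) (A := ‖Z‖) (hz.indicator measurableSet_Iio)
      fun c => by
        by_cases h : c < β
        · rw [indicator_of_mem (mem_Iio.2 h)]
          rcases le_or_gt c 0 with h0 | h0
          · rw [hZ c h0, abs_zero]; exact indicator_nonneg (fun _ _ => norm_nonneg _) _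
          · rw [indicator_of_mem (show c ∈ Ioo 0 β from ⟨h0, h⟩)]; exact bcf_abs_le Z c 0 i
        · rw [indicator_of_notMem (show c ∉ Iio β from h), abs_zero]
          exact indicator_nonneg (fun _ _ => norm_nonneg _) _
  exact (((hf i).2.indicator (measurableSet_Iio (a := β))).add h1).ae_eq
    (Eventually.of_forall fun c => by by_cases h : c < β <;> simp [gluedDatum, h])

section

variable {B : Matrix (Fin k) (Fin m) ℝ} {p : Fin k} {q r : Fin m} {ε α β : ℝ}
  {a : Fin k ⊕ Fin m → ℝ → ℝ} {u : ℝ → ℝ}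
  {Z₁ Z₂ Z : BoundedContinuousFunction (ℝ × ℝ) (Fin k ⊕ Fin m → ℝ)}

/-- The trace at `x = 0` of a solution of the forward problem satisfies the reflection law. -/
theorem trace_inl_of_pos
    (h₁ : P.IsSolution entry (reflection B) (forwardDatum B p r α β a u) fun t x => Z₁ (t, x))
    {c : ℝ} (hc : 0 < c) (i : Fin k) :
    forwardDatum B p r α β a u (Sum.inl i) c + Z₁ (c, 0) (Sum.inl i) =
      ∑ j, B i j * (forwardDatum B p r α β a u (Sum.inr j) c + Z₁ (c, 0) (Sum.inr j)) := by
  have := h₁ c 0 (Sum.inl i)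
  simp only [max_self, P.ψ_zero, sub_zero, coupling, entry, intervalIntegral.integral_same,
    add_zero, Fintype.sum_sum_type, reflection, Matrix.fromBlocks_apply₁₁,
    Matrix.fromBlocks_apply₁₂, Matrix.zero_apply, zero_mul, Finset.sum_const_zero, zero_add] at this
  rw [this, forwardDatum_inl_of_pos i hc, ← Finset.sum_add_distrib]
  exact Finset.sum_congr rfl fun j _ => by ring

/-- Without reflection, the bounded part vanishes at the side where the data are given. -/
theorem trace_eq_of_entry {e : Fin k ⊕ Fin m → ℝ} {f : Fin k ⊕ Fin m → ℝ → ℝ}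
    {z : ℝ → ℝ → Fin k ⊕ Fin m → ℝ} (h : P.IsSolution e 0 f z) {i : Fin k ⊕ Fin m}
    (he : e i = 0) (c : ℝ) : z c 0 i = 0 := by
  rw [h c 0 i, he]
  simp [coupling]

/-- The solution of the mixed problem vanishes above all the characteristics, other than the slowest
one with positive slope, which leave `x = 0` at the time `β`. -/
theorem wave_mixed_eq_zero {P' : TransportSystem (Fin k ⊕ Fin m)}
    (hω : P'.IsContractive (mixedEntry p) 0 (fun _ _ _ => 1) 1)
    (hp : ∀ i, i ≠ Sum.inl p → ∀ x, P'.slope i x < P'.slope (Sum.inl p) x)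
    {f : Fin k ⊕ Fin m → ℝ → ℝ} {z : ℝ → ℝ → Fin k ⊕ Fin m → ℝ}
    (h₂ : P'.IsSolution (mixedEntry p) 0 (mixedDatum p α β f z) fun t x => Z₂ (t, x))
    {t x : ℝ} (hx : 0 ≤ x) (hx1 : x ≤ 1) (ht : ∀ l, l ≠ Sum.inl p → β ≤ t - P'.ψ l x)
    (i : Fin k ⊕ Fin m) :
    wave P'.ψ (mixedDatum p α β f z) (fun t x => Z₂ (t, x)) t x i = 0 := by
  set w := wave P'.ψ (mixedDatum p α β f z) fun t x => Z₂ (t, x) with hw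
  have hwz : ∀ t x, (∀ l, l ≠ Sum.inl p → β ≤ t - P'.ψ l x) → ∀ i, w t x i = Z₂ (t, x) i :=
    fun t x ht i => by
      by_cases hi : i = Sum.inl p
      · simp [hw, wave, mixedDatum, hi]
      · have : t - P'.ψ i x ∉ Ioo α β := fun h => h.2.not_ge (ht i hi)
        simp [hw, wave, mixedDatum, hi, -mem_Ioo, indicator_of_notMem this]
  refine hω.eq_zero_of_mem (R := ‖Z₂‖)
    (D := {p' : ℝ × ℝ | (0 ≤ p'.2 ∧ p'.2 ≤ 1) ∧ ∀ l, l ≠ Sum.inl p → β ≤ p'.1 - P'.ψ l p'.2})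
    ?_ ?_ ?_ (p := (t, x)) ⟨⟨hx, hx1⟩, ht⟩ i
  · rintro ⟨t, x⟩ ⟨-, ht⟩ i
    simp only at ht ⊢
    rw [hwz t x ht i]; exact bcf_abs_le _ _ _ _
  · rintro ⟨t, x⟩ ⟨-, ht⟩ i
    simp only at ht ⊢
    have e1 := h₂ t x i
    simp only [Matrix.zero_apply, zero_mul, Finset.sum_const_zero, zero_add] at e1
    rw [hwz t x ht i]
    exact e1
  · rintro ⟨t, x⟩ ⟨⟨hx, hx1⟩, ht⟩ i y hy hy'
    simp only at hx hx1 ht hy ⊢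
    refine ⟨⟨hy'.1.le, hy'.2.le⟩, fun l hl => ?_⟩
    simp only
    by_cases hi : i = Sum.inl p
    · subst hi
      rw [mixedEntry, if_pos rfl, uIcc_of_ge hx1] at hy
      have := (strictMono_sub_of_slope_lt (hp l hl)).monotone hy.1
      linarith [ht l hl]
    · rw [mixedEntry, if_neg hi, uIcc_of_le hx] at hy
      by_cases hil : i = l
      · subst hil; linarith [ht i hi]
      rcases strictMono_or_strictAnti_sub (P := P') hil with hm | hm
      · have := hm.monotone hy.1
        simp only [P'.ψ_zero, sub_zero] at this
        linarith [ht i hi]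
      · have := hm.antitone hy.2
        linarith [ht l hl]

variable [Nonempty (Fin k ⊕ Fin m)]

/-- The controlled solution coincides with the forward solution below the slowest characteristic
that comes from `x = 1` and reaches `x = 0` at the time `β`. -/
theorem wave_eq_forward {ω : ℝ → ℝ → Fin k ⊕ Fin m → ℝ} {Ω : ℝ}
    (hω : P.IsContractive (fun _ => 0) 0 ω Ω)
    (hq : ∀ i, i ≠ Sum.inr q → ∀ x, P.slope (Sum.inr q) x < P.slope i x)
    {f : Fin k ⊕ Fin m → ℝ → ℝ} (hf : IsDatum f) {ρ : Matrix (Fin k ⊕ Fin m) (Fin k ⊕ Fin m) ℝ}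
    {e : Fin k ⊕ Fin m → ℝ} (h₁ : P.IsSolution e ρ f fun t x => Z₁ (t, x))
    (hg : IsDatum (gluedDatum β f fun t x => Z₁ (t, x)))
    (h : P.IsSolution (fun _ => 0) 0 (gluedDatum β f fun t x => Z₁ (t, x)) fun t x => Z (t, x))
    {t x : ℝ} (hx : 0 ≤ x) (ht : t - P.ψ (Sum.inr q) x < β) (i : Fin k ⊕ Fin m) :
    wave P.ψ (gluedDatum β f fun t x => Z₁ (t, x)) (fun t x => Z (t, x)) t x i =
      wave P.ψ f (fun t x => Z₁ (t, x)) t x i := by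
  set w := wave P.ψ (gluedDatum β f fun t x => Z₁ (t, x)) fun t x => Z (t, x) with hw
  set w₁ := wave P.ψ f fun t x => Z₁ (t, x) with hw₁
  have hmono : ∀ i {y x : ℝ}, y ≤ x →
      P.ψ i y - P.ψ (Sum.inr q) y ≤ P.ψ i x - P.ψ (Sum.inr q) x := fun i y x hyx => by
    by_cases hi : i = Sum.inr q
    · subst hi; simp
    · exact (strictMono_sub_of_slope_lt (hq i hi)).monotone hyx
  have hZ0 : ∀ c i, Z (c, 0) i = 0 := fun c i => trace_eq_of_entry h rfl c
  have htrace : ∀ t x, 0 ≤ x → t - P.ψ (Sum.inr q) x < β → ∀ i,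
      w (t - P.ψ i x) 0 i = w₁ (t - P.ψ i x) 0 i := fun t x hx ht i => by
    have hc : t - P.ψ i x < β := by
      have := hmono i hx
      rw [P.ψ_zero, P.ψ_zero] at this
      linarith
    simp only [hw, hw₁, wave, P.ψ_zero, sub_zero, hZ0, add_zero, gluedDatum,
      indicator_of_mem (mem_Iio.2 hc)]
  have key := hω.eq_zero_of_mem (D := {p : ℝ × ℝ | 0 ≤ p.2 ∧ p.1 - P.ψ (Sum.inr q) p.2 < β})
    (d := w - w₁) (R := ‖Z₁‖ + ‖Z‖ + ‖Z₁‖) ?_ ?_ ?_ (p := (t, x)) ⟨hx, ht⟩ i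
  · exact sub_eq_zero.1 key
  · rintro ⟨t, x⟩ ⟨hx, ht⟩ i
    have h0 := htrace t x hx ht i
    simp only [hw, hw₁, wave, P.ψ_zero, sub_zero, hZ0, add_zero] at h0
    have : (w - w₁) t x i = Z₁ (t - P.ψ i x, 0) i + Z (t, x) i - Z₁ (t, x) i := by
      simp only [Pi.sub_apply, hw, hw₁, wave]
      linarith
    rw [this]
    exact (abs_sub _ _).trans (add_le_add ((abs_add_le _ _).trans
      (add_le_add (bcf_abs_le _ _ _ _) (bcf_abs_le _ _ _ _))) (bcf_abs_le _ _ _ _))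
  · rintro ⟨t, x⟩ ⟨hx, ht⟩ i
    rw [P.coupling_sub (P.integrable_source_wave hg (bcf_measurable Z) (bcf_abs_le Z) i _)
      (P.integrable_source_wave hf (bcf_measurable Z₁) (bcf_abs_le Z₁) i _)]
    have e1 := h.wave_eq hg (bcf_measurable Z) (bcf_abs_le Z) t (x := x) hx i
    have e2 := h₁.wave_eq hf (bcf_measurable Z₁) (bcf_abs_le Z₁) t (x := x) hx i
    have e3 := htrace t x hx ht i
    simp only [Pi.sub_apply, hw, hw₁] at e3 ⊢
    rw [e1, e2, e3]
    ring
  · rintro ⟨t, x⟩ ⟨hx, ht⟩ i y hy hy'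
    simp only at hx ht hy ⊢
    rw [uIcc_of_le hx] at hy
    refine ⟨hy.1, ?_⟩
    have := hmono i hy.2
    simp only
    linarith

/-- The controlled solution coincides with the solution of the mixed problem above the slowest
characteristic which leaves `x = 0` at the time `α`. -/
theorem wave_eq_mixed {ω : ℝ → ℝ → Fin k ⊕ Fin m → ℝ} {Ω : ℝ}
    (hω : P.IsContractive (fun _ => 0) 0 ω Ω)
    (hω₂ : (P.truncate ε).IsContractive (mixedEntry p) 0 (fun _ _ _ => 1) 1)
    (hp : ∀ i, i ≠ Sum.inl p → ∀ x, P.slope i x < P.slope (Sum.inl p) x)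
    (hB : B p r ≠ 0) (hα : 0 ≤ α)
    (hε : ∀ l, l ≠ Sum.inl p → β ≤ α + (P.ψ (Sum.inl p) ε - P.ψ l ε))
    (hf : IsDatum (forwardDatum B p r α β a u))
    (h₂ : (P.truncate ε).IsSolution (mixedEntry p) 0
      (mixedDatum p α β (forwardDatum B p r α β a u) fun t x => Z₁ (t, x)) fun t x => Z₂ (t, x))
    (hu : ∀ c, u c = Z₂ (c, 0) (Sum.inl p) - Z₁ (c, 0) (Sum.inl p))
    (hg : IsDatum (gluedDatum β (forwardDatum B p r α β a u) fun t x => Z₁ (t, x)))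
    (h : P.IsSolution (fun _ => 0) 0
      (gluedDatum β (forwardDatum B p r α β a u) fun t x => Z₁ (t, x)) fun t x => Z (t, x))
    {t x : ℝ} (hx : 0 ≤ x) (hx1 : x ≤ 1) (ht : α < t - P.ψ (Sum.inl p) x) (i : Fin k ⊕ Fin m) :
    wave P.ψ (gluedDatum β (forwardDatum B p r α β a u) fun t x => Z₁ (t, x))
        (fun t x => Z (t, x)) t x i =
      wave P.ψ (mixedDatum p α β (forwardDatum B p r α β a u) fun t x => Z₁ (t, x))
        (fun t x => Z₂ (t, x)) t x i := by
  set f := forwardDatum B p r α β a u with hfdef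
  set g := gluedDatum β f fun t x => Z₁ (t, x) with hgdef
  set f₂ := mixedDatum p α β f fun t x => Z₁ (t, x) with hf₂def
  have hf₂ : IsDatum f₂ := isDatum_mixedDatum p α β hf Z₁
  set w := wave P.ψ g fun t x => Z (t, x) with hw
  set w₂ := wave P.ψ f₂ fun t x => Z₂ (t, x) with hw₂
  have hzero : ∀ {t x : ℝ}, 0 ≤ x → x ≤ 1 → (∀ l, l ≠ Sum.inl p → β ≤ t - P.ψ l x) →
      ∀ i, w₂ t x i = 0 := fun {t x} hx hx1 ht i =>
    wave_mixed_eq_zero (P' := P.truncate ε) hω₂ hp h₂ hx hx1 ht i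
  have hmono : ∀ i {y x : ℝ}, y ≤ x →
      P.ψ (Sum.inl p) y - P.ψ i y ≤ P.ψ (Sum.inl p) x - P.ψ i x := fun i y x hyx => by
    by_cases hi : i = Sum.inl p
    · subst hi; simp
    · exact (strictMono_sub_of_slope_lt (hp i hi)).monotone hyx
  have hZ0 : ∀ c i, Z (c, 0) i = 0 := fun c i => trace_eq_of_entry h rfl c
  -- the traces at `x = 0` agree after the time `α`
  have htrace0 : ∀ c, α < c → ∀ i, g i c = f₂ i c + Z₂ (c, 0) i := fun c hc i => by
    have hcβ : c < β → c ∈ Ioo α β := fun h => ⟨hc, h⟩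
    by_cases hi : i = Sum.inl p
    · subst hi
      have hf₂0 : f₂ (Sum.inl p) c = 0 := by simp [hf₂def, mixedDatum]
      rw [hf₂0, zero_add]
      by_cases hb : c < β
      · have := hu c
        rw [hgdef, gluedDatum, indicator_of_mem (mem_Iio.2 hb), hfdef,
          forwardDatum_inl_of_pos p (hα.trans_lt hc), sum_forwardDatum hB (hcβ hb), this]
        ring
      · have := hzero (t := c) le_rfl zero_le_one (fun l _ => by
          rw [P.ψ_zero, sub_zero]; exact le_of_not_gt hb) (Sum.inl p)
        simp only [hw₂, wave, P.ψ_zero, sub_zero, hf₂0, zero_add] at this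
        rw [this, hgdef, gluedDatum, indicator_of_notMem (show c ∉ Iio β from hb)]
    · have h0 : Z₂ (c, 0) i = 0 :=
        trace_eq_of_entry (P := P.truncate ε) h₂ (by simp [mixedEntry, hi]) c
      rw [h0, add_zero, hgdef, hf₂def, gluedDatum, mixedDatum, if_neg hi]
      by_cases hb : c < β
      · rw [indicator_of_mem (mem_Iio.2 hb), indicator_of_mem (hcβ hb)]
      · rw [indicator_of_notMem (show c ∉ Iio β from hb),
          indicator_of_notMem (show c ∉ Ioo α β from fun h => hb h.2)]
  have htrace : ∀ t x, 0 ≤ x → α < t - P.ψ (Sum.inl p) x → ∀ i,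
      g i (t - P.ψ i x) = f₂ i (t - P.ψ i x) + Z₂ (t - P.ψ i x, 0) i := fun t x hx ht i => by
    refine htrace0 _ ?_ i
    have := hmono i hx
    rw [P.ψ_zero, P.ψ_zero] at this
    linarith
  -- the truncation is immaterial, as the solution vanishes at the abscissas greater than `ε`
  have htrunc : ∀ t x, 0 ≤ x → x ≤ 1 → α < t - P.ψ (Sum.inl p) x → ∀ i,
      (P.truncate ε).coupling 0 w₂ i (t - P.ψ i x) x = P.coupling 0 w₂ i (t - P.ψ i x) x :=
    fun t x hx hx1 ht i => by
      refine intervalIntegral.integral_congr fun y hy => ?_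
      rw [uIcc_of_le hx] at hy
      rcases lt_or_ge y ε with hyε | hyε
      · exact source_truncate_of_lt hyε _ _ _
      · have hv : ∀ j, w₂ (t - P.ψ i x + P.ψ i y) y j = 0 := hzero hy.1 (hy.2.trans hx1)
          fun l hl => by
            have h1 := hmono i hy.2
            have h2 := hmono l hyε
            linarith [hε l hl]
        rw [source_eq_zero_of_eq_zero hv, source_eq_zero_of_eq_zero (P := P.truncate ε) hv]
  have key := hω.eq_zero_of_mem
    (D := {p' : ℝ × ℝ | (0 ≤ p'.2 ∧ p'.2 ≤ 1) ∧ α < p'.1 - P.ψ (Sum.inl p) p'.2})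
    (d := w - w₂) (R := ‖Z₂‖ + ‖Z‖ + ‖Z₂‖) ?_ ?_ ?_ (p := (t, x)) ⟨⟨hx, hx1⟩, ht⟩ i
  · exact sub_eq_zero.1 key
  · rintro ⟨t, x⟩ ⟨⟨hx, hx1⟩, ht⟩ i
    have h0 := htrace t x hx ht i
    have : (w - w₂) t x i = Z₂ (t - P.ψ i x, 0) i + Z (t, x) i - Z₂ (t, x) i := by
      simp only [Pi.sub_apply, hw, hw₂, wave]
      linarith
    rw [this]
    exact (abs_sub _ _).trans (add_le_add ((abs_add_le _ _).trans
      (add_le_add (bcf_abs_le _ _ _ _) (bcf_abs_le _ _ _ _))) (bcf_abs_le _ _ _ _))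
  · rintro ⟨t, x⟩ ⟨⟨hx, hx1⟩, ht⟩ i
    rw [P.coupling_sub (P.integrable_source_wave hg (bcf_measurable Z) (bcf_abs_le Z) i _)
      (P.integrable_source_wave hf₂ (bcf_measurable Z₂) (bcf_abs_le Z₂) i _)]
    have e1 := h.wave_eq hg (bcf_measurable Z) (bcf_abs_le Z) t (x := x) hx i
    have e2 := IsSolution.wave_eq (P := P.truncate ε) h₂ hf₂ (bcf_measurable Z₂) (bcf_abs_le Z₂)
      t (x := x) hx i
    change w₂ t x i = w₂ (t - P.ψ i x) 0 i +
      (P.truncate ε).coupling 0 w₂ i (t - P.ψ i x) x at e2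
    rw [htrunc t x hx hx1 ht i] at e2
    have e3 : w (t - P.ψ i x) 0 i = w₂ (t - P.ψ i x) 0 i := by
      simp only [hw, hw₂, wave, P.ψ_zero, sub_zero, hZ0, add_zero]
      exact htrace t x hx ht i
    simp only [Pi.sub_apply, hw] at e3 ⊢
    rw [e1, e2, e3]
    ring
  · rintro ⟨t, x⟩ ⟨⟨hx, hx1⟩, ht⟩ i y hy hy'
    simp only at hx ht hy ⊢
    rw [uIcc_of_le hx] at hy
    refine ⟨⟨hy.1, hy'.2.le⟩, ?_⟩
    have := hmono i hy.2
    simp only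
    linarith

end

/-- Null controllability in a time smaller than `T₂ = ψ p 1 - ψ q 1`, for the system written along
its characteristics: there is a solution whose value at time `0` is prescribed by the datum `a` and
which vanishes at time `T₂ - δ`. -/
theorem IsSigned.exists_nullControl (hs : P.IsSigned) {B : Matrix (Fin k) (Fin m) ℝ} {p : Fin k}
    {q r : Fin m} (hqr : r ≠ q) (hB : B p r ≠ 0) (hT : 0 ≤ P.T)
    (hp : ∀ i, i ≠ Sum.inl p → ∀ x, P.slope i x < P.slope (Sum.inl p) x)
    (hq : ∀ i, i ≠ Sum.inr q → ∀ x, P.slope (Sum.inr q) x < P.slope i x) :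
    ∃ δ > 0, δ < P.ψ (Sum.inl p) 1 - P.ψ (Sum.inr q) 1 ∧
      ∀ a : Fin k ⊕ Fin m → ℝ → ℝ, IsDatum a →
        ∃ (f : Fin k ⊕ Fin m → ℝ → ℝ)
          (Z : BoundedContinuousFunction (ℝ × ℝ) (Fin k ⊕ Fin m → ℝ)),
          IsDatum f ∧ P.IsSolution (fun _ => 0) 0 f (fun t x => Z (t, x)) ∧
          (∀ i c, 0 < c → f (Sum.inl i) c = ∑ j, B i j * f (Sum.inr j) c) ∧
          (∀ i x, 0 ≤ x → x < 1 → wave P.ψ f (fun t x => Z (t, x)) 0 x i = a i (-P.ψ i x)) ∧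
          ∀ i x, 0 ≤ x → x < 1 → wave P.ψ f (fun t x => Z (t, x))
            (P.ψ (Sum.inl p) 1 - P.ψ (Sum.inr q) 1 - δ) x i = 0 := by
  have : Nonempty (Fin k ⊕ Fin m) := ⟨Sum.inl p⟩
  set n : ℝ := (Fintype.card (Fin k ⊕ Fin m) : ℝ)
  have hn : 0 ≤ n * P.bound := mul_nonneg (Nat.cast_nonneg _) P.bound_nonneg
  -- the coupling restricted to `(0, ε)` is a small perturbation
  set ε : ℝ := (2 * (n * P.bound) + 1)⁻¹ with hεdef
  have hε : 0 < ε := by positivity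
  have hε1 : ε ≤ 1 := inv_le_one_of_one_le₀ (by linarith)
  obtain ⟨ω₁, Ω₁, h₁⟩ := hs.exists_isContractive_forward hT B
  obtain ⟨ω₃, Ω₃, h₃⟩ := P.exists_isContractive_left
  have h₂ : (P.truncate ε).IsContractive (mixedEntry p) 0 (fun _ _ _ => 1) 1 := by
    refine (P.truncate ε).isContractive_of_coeff_eq_zero hε (fun i j x hx => ?_) ?_ _
    · exact indicator_of_notMem (fun h => (mem_Iio.1 h).not_ge hx) _
    · change n * P.bound * ε ≤ 1 / 2
      rw [hεdef, ← div_eq_mul_inv, div_le_iff₀ (by positivity)]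
      linarith
  obtain ⟨δ₀, hδ₀, hmatch⟩ := exists_matching (r := r) h₁ h₂
  set β := -P.ψ (Sum.inr q) 1 with hβ
  have hψp : 0 < P.ψ (Sum.inl p) 1 := by
    have := hs.strictMono p zero_lt_one; rwa [P.ψ_zero] at this
  have hψr : P.ψ (Sum.inr r) 1 < 0 := by
    have := hs.strictAnti r zero_lt_one; rwa [P.ψ_zero] at this
  have hsep : ∀ l, l ≠ Sum.inl p → 0 < P.ψ (Sum.inl p) ε - P.ψ l ε := fun l hl => by
    have := strictMono_sub_of_slope_lt (hp l hl) hε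
    simpa [P.ψ_zero] using this
  -- by the time when the characteristics of the component `p` reach the abscissa `ε`, they are
  -- delayed by at least `η` with respect to all the others
  obtain ⟨η, hη, hηle⟩ : ∃ η > 0, ∀ l, l ≠ Sum.inl p → η ≤ P.ψ (Sum.inl p) ε - P.ψ l ε := by
    let F : Fin k ⊕ Fin m → ℝ := fun l =>
      if l = Sum.inl p then 1 else P.ψ (Sum.inl p) ε - P.ψ l ε
    obtain ⟨l₀, hl₀⟩ := Finite.exists_min F
    refine ⟨F l₀, ?_, fun l hl => ?_⟩
    · by_cases h : l₀ = Sum.inl p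
      · simp [F, h]
      · simpa [F, h] using hsep l₀ h
    · simpa [F, hl] using hl₀ l
  have hrq : 0 < P.ψ (Sum.inr r) 1 - P.ψ (Sum.inr q) 1 := by
    have := strictMono_sub_of_slope_lt (hq (Sum.inr r) (by simpa using hqr)) zero_lt_one
    simpa [P.ψ_zero] using this
  -- `δ ≤ δ₀` for the matching, `δ ≤ η` for the truncation, `δ ≤ ψ r 1 - ψ q 1` for the control
  -- interval of the component `r` not to meet its initial datum
  set δ := min (min δ₀ η) (min (P.ψ (Sum.inl p) 1) (P.ψ (Sum.inr r) 1 - P.ψ (Sum.inr q) 1)) with hδ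
  have hδpos : 0 < δ := lt_min (lt_min hδ₀ hη) (lt_min hψp hrq)
  have hδ1 : δ ≤ δ₀ := (min_le_left _ _).trans (min_le_left _ _)
  have hδ2 : δ ≤ η := (min_le_left _ _).trans (min_le_right _ _)
  have hδ3 : δ ≤ P.ψ (Sum.inl p) 1 := (min_le_right _ _).trans (min_le_left _ _)
  have hδ4 : δ ≤ P.ψ (Sum.inr r) 1 - P.ψ (Sum.inr q) 1 :=
    (min_le_right _ _).trans (min_le_right _ _)
  set α := β - δ with hα
  have hα0 : 0 < α := by linarith
  refine ⟨δ, hδpos, by linarith, fun a ha => ?_⟩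
  obtain ⟨u, Z₁, Z₂, hs₁, hs₂, hu⟩ := hmatch α β hα0.le (by linarith) (by linarith) a ha
  have hf : IsDatum (forwardDatum B p r α β a u) :=
    isDatum_forwardDatum ha u.continuous fun c => u.norm_coe_le_norm c
  have hZ₁ : ∀ t ≤ 0, ∀ x i, Z₁ (t, x) i = 0 := fun t ht x i => hs.eq_zero_of_nonpos hs₁ ht x i
  have hg : IsDatum (gluedDatum β (forwardDatum B p r α β a u) fun t x => Z₁ (t, x)) :=
    isDatum_gluedDatum hf Z₁ fun c hc i => hZ₁ c hc 0 i
  obtain ⟨Z, hZ⟩ := h₃.exists_isSolution hg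
  refine ⟨_, Z, hg, hZ, fun i c hc => ?_, fun i x hx hx1 => ?_, fun i x hx hx1 => ?_⟩
  · by_cases hcβ : c < β
    · simp only [gluedDatum, indicator_of_mem (mem_Iio.2 hcβ)]
      exact trace_inl_of_pos hs₁ hc i
    · have : c ∉ Iio β := hcβ
      simp [gluedDatum, indicator_of_notMem this]
  · have hlt : P.ψ (Sum.inr q) 1 < P.ψ (Sum.inr q) x := hs.strictAnti q hx1
    rw [wave_eq_forward h₃ hq hf hs₁ hg hZ hx (by linarith) i]
    simp only [wave, hZ₁ 0 le_rfl, add_zero, zero_sub]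
    rcases i with i | j
    · refine forwardDatum_inl_of_nonpos i ?_
      have := (hs.strictMono i).monotone hx
      rw [P.ψ_zero] at this
      linarith
    · by_cases hj : j = r
      · subst hj
        refine forwardDatum_inr_of_notMem j fun h => ?_
        have := (hs.strictAnti j).antitone hx1.le
        linarith [h.1]
      · simp [forwardDatum, hj]
  · have hlt : P.ψ (Sum.inl p) x < P.ψ (Sum.inl p) 1 := hs.strictMono p hx1
    rw [wave_eq_mixed h₃ h₂ hp hB hα0.le (fun l hl => by linarith [hηle l hl]) hf hs₂ hu hg hZ
      hx hx1.le (by linarith) i]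
    refine wave_mixed_eq_zero (P' := P.truncate ε) h₂ hp hs₂ hx hx1.le (fun l hl => ?_) i
    change β ≤ _ - P.ψ l x
    rcases l with l | l
    · have h1 := (strictMono_sub_of_slope_lt (hp _ hl)).monotone hε1
      have h2 := (hs.strictMono l).monotone hx1.le
      have h3 := hηle _ hl
      linarith
    · have h2 := (hs.strictAnti l).antitone hx
      rw [P.ψ_zero] at h2
      linarith

end TransportSystem

/-! ### Characteristics of the control system -/

namespace ControlSystem

variable {k m : ℕ} (S : ControlSystem k m)

/-- The (signed) time which the `i`-th characteristics need to travel from `0` to `x`: they are the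
curves `t = c + phase i x`. -/
noncomputable def phase (i : Fin k ⊕ Fin m) (x : ℝ) : ℝ := ∫ y in (0 : ℝ)..x, (S.velocity i y)⁻¹

/-- The derivative of the `i`-th component with respect to `x` along the characteristic with label
`c`. -/
noncomputable def sourceAlong (w : ℝ → ℝ → Fin k ⊕ Fin m → ℝ) (i : Fin k ⊕ Fin m) (c y : ℝ) : ℝ :=
  (S.velocity i y)⁻¹ * ∑ j, S.γ * S.C y i j * w (c + S.phase i y) y j

theorem phase_zero (i : Fin k ⊕ Fin m) : S.phase i 0 = 0 := by simp [phase]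

variable {S}

theorem clamp_mem (x : ℝ) : max 0 (min x 1) ∈ Icc (0 : ℝ) 1 := by simp

theorem velocity_clamp (i : Fin k ⊕ Fin m) (x : ℝ) :
    S.velocity i (max 0 (min x 1)) = S.velocity i x := by
  have h : max 0 (min (max 0 (min x 1)) 1) = max 0 (min x 1) := by
    rw [min_eq_left (clamp_mem x).2, max_eq_right (clamp_mem x).1]
  rcases i with i | j <;> simp only [velocity, h]

theorem continuous_velocity (hl : S.SpeedsLipschitz) (i : Fin k ⊕ Fin m) :
    Continuous (S.velocity i) := by
  obtain ⟨K, hK⟩ := hl i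
  have h : Continuous fun x : ℝ => S.lam i (max 0 (min x 1)) :=
    hK.continuousOn.comp_continuous (by fun_prop) clamp_mem
  rcases i with i | j
  · exact h
  · exact h.neg

theorem velocity_inl_pos (ho : S.SpeedsOrdered) (i : Fin k) (x : ℝ) :
    0 < S.velocity (Sum.inl i) x := (ho _ (clamp_mem x)).1 _

theorem velocity_inr_neg (ho : S.SpeedsOrdered) (j : Fin m) (x : ℝ) :
    S.velocity (Sum.inr j) x < 0 := neg_neg_of_pos ((ho _ (clamp_mem x)).1 _)

theorem velocity_ne_zero (ho : S.SpeedsOrdered) (i : Fin k ⊕ Fin m) (x : ℝ) :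
    S.velocity i x ≠ 0 := by
  rcases i with i | j
  · exact (velocity_inl_pos ho i x).ne'
  · exact (velocity_inr_neg ho j x).ne

theorem velocity_inl_lt (ho : S.SpeedsOrdered) {i i' : Fin k} (h : i < i') (x : ℝ) :
    S.velocity (Sum.inl i') x < S.velocity (Sum.inl i) x :=
  neg_lt_neg_iff.1 ((ho _ (clamp_mem x)).2.1 h)

theorem velocity_inr_lt (ho : S.SpeedsOrdered) {j j' : Fin m} (h : j < j') (x : ℝ) :
    S.velocity (Sum.inr j') x < S.velocity (Sum.inr j) x :=
  neg_lt_neg ((ho _ (clamp_mem x)).2.2 h)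

theorem velocity_ne (ho : S.SpeedsOrdered) {i j : Fin k ⊕ Fin m} (h : i ≠ j) (x : ℝ) :
    S.velocity i x ≠ S.velocity j x := by
  rcases i with i | i <;> rcases j with j | j
  · rcases lt_or_gt_of_ne (fun h' => h (congrArg _ h') : i ≠ j) with h' | h'
    · exact (velocity_inl_lt ho h' x).ne'
    · exact (velocity_inl_lt ho h' x).ne
  · exact ((velocity_inr_neg ho j x).trans (velocity_inl_pos ho i x)).ne'
  · exact ((velocity_inr_neg ho i x).trans (velocity_inl_pos ho j x)).ne
  · rcases lt_or_gt_of_ne (fun h' => h (congrArg _ h') : i ≠ j) with h' | h'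
    · exact (velocity_inr_lt ho h' x).ne'
    · exact (velocity_inr_lt ho h' x).ne

theorem continuous_inv_velocity (ho : S.SpeedsOrdered) (hl : S.SpeedsLipschitz)
    (i : Fin k ⊕ Fin m) : Continuous fun x => (S.velocity i x)⁻¹ :=
  (continuous_velocity hl i).inv₀ (velocity_ne_zero ho i)

theorem hasDerivAt_phase (ho : S.SpeedsOrdered) (hl : S.SpeedsLipschitz) (i : Fin k ⊕ Fin m)
    (x : ℝ) : HasDerivAt (S.phase i) (S.velocity i x)⁻¹ x :=
  have hc := continuous_inv_velocity ho hl i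
  intervalIntegral.integral_hasDerivAt_right (hc.intervalIntegrable _ _)
    (hc.stronglyMeasurableAtFilter _ _) hc.continuousAt

theorem continuous_phase (ho : S.SpeedsOrdered) (hl : S.SpeedsLipschitz) (i : Fin k ⊕ Fin m) :
    Continuous (S.phase i) :=
  continuous_iff_continuousAt.2 fun x => (hasDerivAt_phase ho hl i x).continuousAt

theorem strictMono_phase (ho : S.SpeedsOrdered) (hl : S.SpeedsLipschitz) (i : Fin k) :
    StrictMono (S.phase (Sum.inl i)) :=
  strictMono_of_deriv_pos fun x => by
    rw [(hasDerivAt_phase ho hl _ x).deriv]; exact inv_pos.2 (velocity_inl_pos ho i x)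

theorem strictAnti_phase (ho : S.SpeedsOrdered) (hl : S.SpeedsLipschitz) (j : Fin m) :
    StrictAnti (S.phase (Sum.inr j)) :=
  strictAnti_of_deriv_neg fun x => by
    rw [(hasDerivAt_phase ho hl _ x).deriv]; exact inv_lt_zero.2 (velocity_inr_neg ho j x)

theorem injective_phase (ho : S.SpeedsOrdered) (hl : S.SpeedsLipschitz) (i : Fin k ⊕ Fin m) :
    Function.Injective (S.phase i) := by
  rcases i with i | j
  · exact (strictMono_phase ho hl i).injective
  · exact (strictAnti_phase ho hl j).injective

theorem travelTime_inl (i : Fin k) : S.travelTime (Sum.inl i) = S.phase (Sum.inl i) 1 := by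
  refine intervalIntegral.integral_congr fun y hy => ?_
  rw [uIcc_of_le zero_le_one] at hy
  simp only [velocity]
  rw [min_eq_left hy.2, max_eq_right hy.1, one_div]

theorem travelTime_inr (j : Fin m) : S.travelTime (Sum.inr j) = -S.phase (Sum.inr j) 1 := by
  rw [phase, ← intervalIntegral.integral_neg]
  refine intervalIntegral.integral_congr fun y hy => ?_
  rw [uIcc_of_le zero_le_one] at hy
  simp only [velocity]
  rw [min_eq_left hy.2, max_eq_right hy.1, one_div, inv_neg, neg_neg]

theorem isCharacteristic_characteristic (ho : S.SpeedsOrdered) (hl : S.SpeedsLipschitz)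
    (i : Fin k ⊕ Fin m) (s ξ : ℝ) : S.IsCharacteristic i s ξ (S.characteristic i s ξ) :=
  Classical.epsilon_spec (existsUnique_isCharacteristic ho hl i s ξ).exists

/-- The phase grows at unit rate along a characteristic. -/
theorem phase_characteristic (ho : S.SpeedsOrdered) (hl : S.SpeedsLipschitz) (i : Fin k ⊕ Fin m)
    (s ξ t : ℝ) : S.phase i (S.characteristic i s ξ t) = S.phase i ξ + (t - s) := by
  obtain ⟨h0, hd⟩ := isCharacteristic_characteristic ho hl i s ξ
  have h : ∀ t, HasDerivAt (fun t => S.phase i (S.characteristic i s ξ t) - t) 0 t := fun t => by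
    have h1 := ((hasDerivAt_phase ho hl i (S.characteristic i s ξ t)).comp t (hd t)).sub
      (hasDerivAt_id t)
    rw [inv_mul_cancel₀ (velocity_ne_zero ho i _), sub_self] at h1
    exact h1
  have hc := is_const_of_deriv_eq_zero (fun t => (h t).differentiableAt) (fun t => (h t).deriv) t s
  simp only [h0] at hc
  linarith

theorem characteristic_apply (ho : S.SpeedsOrdered) (hl : S.SpeedsLipschitz) (i : Fin k ⊕ Fin m)
    (s ξ y : ℝ) : S.characteristic i s ξ (s - S.phase i ξ + S.phase i y) = y := by
  apply injective_phase ho hl i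
  rw [phase_characteristic ho hl]
  ring

theorem passageTime_characteristic (ho : S.SpeedsOrdered) (hl : S.SpeedsLipschitz)
    (i : Fin k ⊕ Fin m) (s ξ a : ℝ) :
    passageTime (S.characteristic i s ξ) a = s - S.phase i ξ + S.phase i a := by
  have h : S.characteristic i s ξ (passageTime (S.characteristic i s ξ) a) = a :=
    Function.invFun_eq ⟨_, characteristic_apply ho hl i s ξ a⟩
  have h2 := phase_characteristic ho hl i s ξ (passageTime (S.characteristic i s ξ) a)
  rw [h] at h2
  linarith

/-- The integral along a characteristic with respect to time, written as an integral with respect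
to the abscissa. -/
theorem sourceIntegral_eq (ho : S.SpeedsOrdered) (hl : S.SpeedsLipschitz)
    (w : ℝ → ℝ → Fin k ⊕ Fin m → ℝ) (i : Fin k ⊕ Fin m) (τ ξ t : ℝ) :
    S.sourceIntegral w i τ ξ t =
      ∫ y in (S.characteristic i τ ξ t)..ξ, S.sourceAlong w i (τ - S.phase i ξ) y := by
  set c := τ - S.phase i ξ with hc
  set a := S.characteristic i τ ξ t with ha
  let g : ℝ → ℝ := fun s => ∑ j, S.γ * S.C (S.characteristic i τ ξ s) i j *
    w s (S.characteristic i τ ξ s) j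
  have hd : ∀ y, HasDerivAt (fun y => c + S.phase i y) (S.velocity i y)⁻¹ y := fun y =>
    (hasDerivAt_phase ho hl i y).const_add c
  have hcont : Continuous fun y => c + S.phase i y := (continuous_phase ho hl i).const_add c
  have hsub : ∫ y in a..ξ, (S.velocity i y)⁻¹ • (g ∘ fun y => c + S.phase i y) y =
      ∫ s in (c + S.phase i a)..(c + S.phase i ξ), g s := by
    rcases i with i | j
    · exact intervalIntegral.integral_deriv_smul_comp_of_deriv_nonneg hcont.continuousOn
        (fun y _ => hd y) fun y _ => (inv_pos.2 (velocity_inl_pos ho i y)).le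
    · exact intervalIntegral.integral_deriv_smul_comp_of_deriv_nonpos hcont.continuousOn
        (fun y _ => hd y) fun y _ => (inv_lt_zero.2 (velocity_inr_neg ho j y)).le
  have h1 : c + S.phase i a = t := by rw [ha, phase_characteristic ho hl, hc]; ring
  have h2 : c + S.phase i ξ = τ := by rw [hc]; ring
  rw [h1, h2] at hsub
  rw [sourceIntegral, ← hsub]
  refine intervalIntegral.integral_congr fun y _ => ?_
  simp only [sourceAlong, g, Function.comp_apply, smul_eq_mul, hc]
  rw [characteristic_apply ho hl]

variable (S) in
/-- The abscissa at time `0` of the `i`-th characteristic with label `c`. -/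
noncomputable def foot (i : Fin k ⊕ Fin m) (c : ℝ) : ℝ := S.characteristic i c 0 0

theorem phase_foot (ho : S.SpeedsOrdered) (hl : S.SpeedsLipschitz) (i : Fin k ⊕ Fin m) (c : ℝ) :
    S.phase i (S.foot i c) = -c := by
  rw [foot, phase_characteristic ho hl, phase_zero]; ring

theorem characteristic_zero (ho : S.SpeedsOrdered) (hl : S.SpeedsLipschitz) (i : Fin k ⊕ Fin m)
    (τ ξ : ℝ) : S.characteristic i τ ξ 0 = S.foot i (τ - S.phase i ξ) := by
  apply injective_phase ho hl i
  rw [phase_foot ho hl, phase_characteristic ho hl]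
  ring

open Classical in
variable (S) in
/-- The abscissa at which the `i`-th characteristic with label `c` enters `[0, T] × [0, 1]`. -/
noncomputable def entryPoint (i : Fin k ⊕ Fin m) (c : ℝ) : ℝ :=
  match i with
  | Sum.inl i => if 0 < c then 0 else S.foot (Sum.inl i) c
  | Sum.inr j => if 0 < c + S.phase (Sum.inr j) 1 then 1 else S.foot (Sum.inr j) c

/-- The value of a component of the second kind, in terms of the label `c` of its characteristic. -/
theorem positiveValue_eq (ho : S.SpeedsOrdered) (hl : S.SpeedsLipschitz)
    (w₀ : ℝ → Fin k ⊕ Fin m → ℝ) (W : ℝ → Fin m → ℝ) (w : ℝ → ℝ → Fin k ⊕ Fin m → ℝ) (j : Fin m)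
    (τ ξ : ℝ) {c : ℝ} (hc : c = τ - S.phase (Sum.inr j) ξ) :
    S.positiveValue w₀ W w j τ ξ =
      (∫ y in (S.entryPoint (Sum.inr j) c)..ξ, S.sourceAlong w (Sum.inr j) c y) +
        open Classical in
        if 0 < c + S.phase (Sum.inr j) 1 then W (c + S.phase (Sum.inr j) 1) j
        else w₀ (S.foot (Sum.inr j) c) (Sum.inr j) := by
  subst hc
  have hiff : 1 < S.foot (Sum.inr j) (τ - S.phase (Sum.inr j) ξ) ↔
      0 < τ - S.phase (Sum.inr j) ξ + S.phase (Sum.inr j) 1 := by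
    rw [← (strictAnti_phase ho hl j).lt_iff_gt, phase_foot ho hl]
    constructor <;> intro h <;> linarith
  simp only [positiveValue, sourceIntegral_eq ho hl, passageTime_characteristic ho hl,
    characteristic_apply ho hl, characteristic_zero ho hl, entryPoint, hiff]
  split_ifs <;> rfl

/-- The value of a component of the first kind, in terms of the label `c` of its characteristic,
which is the time of reflection at `x = 0` if it is positive. -/
theorem negativeValue_eq (ho : S.SpeedsOrdered) (hl : S.SpeedsLipschitz)
    (w₀ : ℝ → Fin k ⊕ Fin m → ℝ) (W : ℝ → Fin m → ℝ) (w : ℝ → ℝ → Fin k ⊕ Fin m → ℝ) (i : Fin k)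
    (τ ξ : ℝ) {c : ℝ} (hc : c = τ - S.phase (Sum.inl i) ξ) :
    S.negativeValue w₀ W w i τ ξ =
      (∫ y in (S.entryPoint (Sum.inl i) c)..ξ, S.sourceAlong w (Sum.inl i) c y) +
        open Classical in
        if 0 < c then ∑ j, S.B i j * S.positiveValue w₀ W w j c 0
        else w₀ (S.foot (Sum.inl i) c) (Sum.inl i) := by
  have h1 : S.characteristic (Sum.inl i) τ ξ c = 0 := by
    have := characteristic_apply ho hl (Sum.inl i) τ ξ 0
    rwa [phase_zero, add_zero, ← hc] at this
  have hiff : S.foot (Sum.inl i) c < 0 ↔ 0 < c := by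
    rw [← (strictMono_phase ho hl i).lt_iff_lt, phase_foot ho hl, phase_zero]
    constructor <;> intro h <;> linarith
  simp only [negativeValue, sourceIntegral_eq ho hl, passageTime_characteristic ho hl,
    characteristic_zero ho hl, phase_zero, add_zero, h1, ← hc, entryPoint, hiff]
  split_ifs <;> rfl

/-- Between the entry point and a point of `[0, T] × [0, 1]`, a characteristic stays in
`[0, 1]`, and in the past of the point. -/
theorem mem_of_mem_uIoc_entryPoint (ho : S.SpeedsOrdered) (hl : S.SpeedsLipschitz)
    (i : Fin k ⊕ Fin m) {τ ξ c : ℝ} (hc : c = τ - S.phase i ξ) (hτ : 0 ≤ τ)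
    (hξ : ξ ∈ Icc (0 : ℝ) 1) :
    S.entryPoint i c ∈ Icc (0 : ℝ) 1 ∧ 0 ≤ c + S.phase i (S.entryPoint i c) ∧
      ∀ y ∈ uIcc (S.entryPoint i c) ξ,
        c + S.phase i y ∈ Icc (c + S.phase i (S.entryPoint i c)) τ := by
  have hc' : c + S.phase i ξ = τ := by rw [hc]; ring
  rcases i with i | j
  · have hm := strictMono_phase ho hl i
    have he : S.entryPoint (Sum.inl i) c ∈ Icc 0 ξ ∧
        0 ≤ c + S.phase (Sum.inl i) (S.entryPoint (Sum.inl i) c) := by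
      by_cases h : 0 < c
      · simp only [entryPoint, if_pos h]
        exact ⟨⟨le_rfl, hξ.1⟩, by rw [phase_zero]; linarith⟩
      · simp only [entryPoint, if_neg h, phase_foot ho hl, add_neg_cancel, le_refl, and_true]
        constructor
        · rw [← hm.le_iff_le, phase_foot ho hl, phase_zero]; linarith
        · rw [← hm.le_iff_le, phase_foot ho hl]; linarith
    refine ⟨⟨he.1.1, he.1.2.trans hξ.2⟩, he.2, fun y hy => ?_⟩
    rw [uIcc_of_le he.1.2] at hy
    have h1 := hm.monotone hy.1
    have h2 := hm.monotone hy.2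
    constructor <;> linarith
  · have hm := strictAnti_phase ho hl j
    have he : S.entryPoint (Sum.inr j) c ∈ Icc ξ 1 ∧
        0 ≤ c + S.phase (Sum.inr j) (S.entryPoint (Sum.inr j) c) := by
      by_cases h : 0 < c + S.phase (Sum.inr j) 1
      · simp only [entryPoint, if_pos h]
        exact ⟨⟨hξ.2, le_rfl⟩, h.le⟩
      · simp only [entryPoint, if_neg h, phase_foot ho hl, add_neg_cancel, le_refl, and_true]
        constructor
        · rw [← hm.le_iff_ge, phase_foot ho hl]; linarith
        · rw [← hm.le_iff_ge, phase_foot ho hl]; linarith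
    refine ⟨⟨hξ.1.trans he.1.1, he.1.2⟩, he.2, fun y hy => ?_⟩
    rw [uIcc_of_ge he.1.1] at hy
    have h1 := hm.antitone hy.1
    have h2 := hm.antitone hy.2
    constructor <;> linarith

end ControlSystem

/-! ### The gauge transformation -/

namespace ControlSystem

variable {k m : ℕ} {S : ControlSystem k m}

/-- The coupling matrix has a bounded Borel representative, which vanishes off `(0, 1)`. -/
theorem exists_bounded_representative (hC : S.CouplingBounded) :
    ∃ (D : Fin k ⊕ Fin m → Fin k ⊕ Fin m → ℝ → ℝ) (R : ℝ), 0 ≤ R ∧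
      (∀ i j, Measurable (D i j)) ∧ (∀ i j x, |D i j x| ≤ R) ∧
      (∀ i j x, x ∉ Ioo (0 : ℝ) 1 → D i j x = 0) ∧
      ∀ i j, ∀ᵐ x ∂volume.restrict (Ioo (0 : ℝ) 1), S.C x i j = D i j x := by
  have h : ∀ i j, ∃ (d : ℝ → ℝ) (R : ℝ), 0 ≤ R ∧ Measurable d ∧ (∀ x, |d x| ≤ R) ∧
      (∀ x, x ∉ Ioo (0 : ℝ) 1 → d x = 0) ∧
      ∀ᵐ x ∂volume.restrict (Ioo (0 : ℝ) 1), S.C x i j = d x := fun i j => by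
    have hm := (hC i j).1
    obtain ⟨R, hR⟩ : ∃ R : ℝ, ∀ᵐ x ∂volume.restrict (Ioo (0 : ℝ) 1), ‖S.C x i j‖ ≤ R :=
      ⟨_, by
        have htop : eLpNormEssSup (fun x => S.C x i j) (volume.restrict (Ioo (0 : ℝ) 1)) ≠ ⊤ := by
          simpa using (hC i j).2.ne
        filter_upwards [ae_le_eLpNormEssSup (f := fun x => S.C x i j)
          (μ := volume.restrict (Ioo (0 : ℝ) 1))] with x hx
        simpa using ENNReal.toReal_mono htop hx⟩
    let g := hm.mk _
    have hg : Measurable g := hm.stronglyMeasurable_mk.measurable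
    have hs : MeasurableSet (Ioo (0 : ℝ) 1 ∩ {x | |g x| ≤ R}) :=
      measurableSet_Ioo.inter (measurableSet_le hg.abs measurable_const)
    refine ⟨(Ioo (0 : ℝ) 1 ∩ {x | |g x| ≤ R}).indicator g, |R|, abs_nonneg _, hg.indicator hs,
      fun x => ?_, fun x hx => indicator_of_notMem (fun h => hx h.1) _, ?_⟩
    · by_cases hx : x ∈ Ioo (0 : ℝ) 1 ∩ {x | |g x| ≤ R}
      · rw [indicator_of_mem hx]; exact hx.2.trans (le_abs_self R)
      · rw [indicator_of_notMem hx, abs_zero]; exact abs_nonneg _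
    · filter_upwards [hR, hm.ae_eq_mk, ae_restrict_mem measurableSet_Ioo] with x h1 h2 h3
      rw [Real.norm_eq_abs, h2] at h1
      rw [indicator_of_mem (show x ∈ Ioo (0 : ℝ) 1 ∩ {x | |g x| ≤ R} from ⟨h3, h1⟩), h2]
  choose D R hR0 hm hR hzero hae using h
  refine ⟨D, ∑ i, ∑ j, R i j,
    Finset.sum_nonneg fun i _ => Finset.sum_nonneg fun j _ => hR0 i j, hm,
    fun i j x => (hR i j x).trans ?_, hzero, hae⟩
  exact (Finset.single_le_sum (f := fun j => R i j) (fun j _ => hR0 i j) (Finset.mem_univ j)).trans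
    (Finset.single_le_sum (f := fun i => ∑ j, R i j)
      (fun i _ => Finset.sum_nonneg fun j _ => hR0 i j) (Finset.mem_univ i))

variable (S) in
/-- The exponent of the gauge factor: its derivative is the diagonal coefficient. -/
noncomputable def gaugeLog (D : Fin k ⊕ Fin m → Fin k ⊕ Fin m → ℝ → ℝ) (i : Fin k ⊕ Fin m) (x : ℝ) :
    ℝ := ∫ y in (0 : ℝ)..x, S.γ * (S.velocity i y)⁻¹ * D i i y

variable (S) in
/-- The gauge factor. The functions `w i / gauge i` satisfy a system without diagonal coupling. -/
noncomputable def gauge (D : Fin k ⊕ Fin m → Fin k ⊕ Fin m → ℝ → ℝ) (i : Fin k ⊕ Fin m) (x : ℝ) :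
    ℝ := Real.exp (S.gaugeLog D i x)

/-- A positive continuous function which is constant on both sides of `[0, 1]` is bounded away from
zero. -/
theorem exists_pos_le_of_continuous {F : ℝ → ℝ} (hF : Continuous F) (hpos : ∀ x, 0 < F x)
    (hclamp : ∀ x, F (max 0 (min x 1)) = F x) : ∃ κ > 0, ∀ x, κ ≤ F x := by
  obtain ⟨p, -, hp⟩ := isCompact_Icc.exists_isMinOn (nonempty_Icc.2 (zero_le_one (α := ℝ)))
    hF.continuousOn
  exact ⟨F p, hpos p, fun x => hclamp x ▸ hp (clamp_mem x)⟩

theorem exists_abs_inv_velocity_le (ho : S.SpeedsOrdered) (hl : S.SpeedsLipschitz) :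
    ∃ R, 0 ≤ R ∧ ∀ i x, |(S.velocity i x)⁻¹| ≤ R := by
  have h : ∀ i, ∃ R, ∀ x, |(S.velocity i x)⁻¹| ≤ R := fun i => by
    obtain ⟨p, -, hp⟩ := isCompact_Icc.exists_isMaxOn (nonempty_Icc.2 (zero_le_one (α := ℝ)))
      (continuous_inv_velocity ho hl i).abs.continuousOn
    refine ⟨|(S.velocity i p)⁻¹|, fun x => ?_⟩
    have : |(S.velocity i (max 0 (min x 1)))⁻¹| ≤ |(S.velocity i p)⁻¹| := hp (clamp_mem x)
    rwa [velocity_clamp] at this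
  choose R hR using h
  have h0 : ∀ i, 0 ≤ R i := fun i => (abs_nonneg _).trans (hR i 0)
  exact ⟨∑ i, R i, Finset.sum_nonneg fun i _ => h0 i, fun i x => (hR i x).trans
    (Finset.single_le_sum (fun i _ => h0 i) (Finset.mem_univ i))⟩

/-- The characteristics are transversal to the boundaries and to each other, uniformly. -/
theorem exists_le_abs_inv_velocity (ho : S.SpeedsOrdered) (hl : S.SpeedsLipschitz) :
    ∃ κ > 0, (∀ i x, κ ≤ |(S.velocity i x)⁻¹|) ∧
      ∀ i j, i ≠ j → ∀ x, κ ≤ |(S.velocity i x)⁻¹ - (S.velocity j x)⁻¹| := by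
  classical
  -- `none` stands for the bound `1`, so that the index type is nonempty
  let F : Option ((Fin k ⊕ Fin m) × (Fin k ⊕ Fin m)) → ℝ → ℝ := fun o x =>
    match o with
    | none => 1
    | some (i, j) => if i = j then |(S.velocity i x)⁻¹|
        else |(S.velocity i x)⁻¹ - (S.velocity j x)⁻¹|
  have hF : ∀ o, ∃ κ > 0, ∀ x, κ ≤ F o x := by
    rintro (_ | ⟨i, j⟩)
    · exact ⟨1, one_pos, fun _ => le_rfl⟩
    · by_cases hij : i = j
      · simp only [F, if_pos hij]
        exact exists_pos_le_of_continuous (continuous_inv_velocity ho hl i).abs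
          (fun x => abs_pos.2 (inv_ne_zero (velocity_ne_zero ho i x)))
          fun x => by rw [velocity_clamp]
      · simp only [F, if_neg hij]
        exact exists_pos_le_of_continuous
          ((continuous_inv_velocity ho hl i).sub (continuous_inv_velocity ho hl j)).abs
          (fun x => abs_pos.2 (sub_ne_zero.2 fun h => velocity_ne ho hij x (inv_injective h)))
          fun x => by rw [velocity_clamp, velocity_clamp]
  choose κ hκ hle using hF
  obtain ⟨o, hmin⟩ := Finite.exists_min κ
  refine ⟨κ o, hκ o, fun i x => ?_, fun i j hij x => ?_⟩
  · simpa [F] using (hmin (some (i, i))).trans (hle _ x)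
  · simpa [F, hij] using (hmin (some (i, j))).trans (hle _ x)

section gauge

variable {D : Fin k ⊕ Fin m → Fin k ⊕ Fin m → ℝ → ℝ} {R : ℝ}

theorem measurable_diagonal (ho : S.SpeedsOrdered) (hl : S.SpeedsLipschitz)
    (hm : ∀ i j, Measurable (D i j)) (i j : Fin k ⊕ Fin m) :
    Measurable fun y => S.γ * (S.velocity i y)⁻¹ * D i j y :=
  ((continuous_inv_velocity ho hl i).measurable.const_mul _).mul (hm i j)

theorem exists_abs_diagonal_le (ho : S.SpeedsOrdered) (hl : S.SpeedsLipschitz)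
    (hR0 : 0 ≤ R) (hR : ∀ i j x, |D i j x| ≤ R) :
    ∃ A, 0 ≤ A ∧ ∀ i j y, |S.γ * (S.velocity i y)⁻¹ * D i j y| ≤ A := by
  obtain ⟨V, hV0, hV⟩ := exists_abs_inv_velocity_le ho hl
  refine ⟨|S.γ| * V * R, by positivity, fun i j y => ?_⟩
  rw [abs_mul, abs_mul]
  exact mul_le_mul (mul_le_mul_of_nonneg_left (hV i y) (abs_nonneg _)) (hR i j y) (abs_nonneg _)
    (by positivity)

theorem intervalIntegrable_diagonal (ho : S.SpeedsOrdered) (hl : S.SpeedsLipschitz)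
    (hm : ∀ i j, Measurable (D i j)) (hR0 : 0 ≤ R) (hR : ∀ i j x, |D i j x| ≤ R)
    (i : Fin k ⊕ Fin m) (a b : ℝ) :
    IntervalIntegrable (fun y => S.γ * (S.velocity i y)⁻¹ * D i i y) volume a b := by
  obtain ⟨A, -, hA⟩ := exists_abs_diagonal_le ho hl hR0 hR
  exact (intervalIntegrable_const (c := A)).mono_fun'
    (measurable_diagonal ho hl hm i i).aestronglyMeasurable (Eventually.of_forall fun y => hA i i y)

theorem gauge_zero (i : Fin k ⊕ Fin m) : S.gauge D i 0 = 1 := by simp [gauge, gaugeLog]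

theorem gauge_pos (i : Fin k ⊕ Fin m) (x : ℝ) : 0 < S.gauge D i x := Real.exp_pos _

theorem exists_lipschitzWith_gaugeLog (ho : S.SpeedsOrdered) (hl : S.SpeedsLipschitz)
    (hm : ∀ i j, Measurable (D i j)) (hR0 : 0 ≤ R) (hR : ∀ i j x, |D i j x| ≤ R) :
    ∃ A : NNReal, ∀ i, LipschitzWith A (S.gaugeLog D i) := by
  obtain ⟨A, hA0, hA⟩ := exists_abs_diagonal_le ho hl hR0 hR
  refine ⟨Real.toNNReal A, fun i => LipschitzWith.of_dist_le_mul fun x y => ?_⟩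
  rw [Real.coe_toNNReal _ hA0, Real.dist_eq, Real.dist_eq, gaugeLog, gaugeLog,
    intervalIntegral.integral_interval_sub_left
    (intervalIntegrable_diagonal ho hl hm hR0 hR i _ _)
    (intervalIntegrable_diagonal ho hl hm hR0 hR i _ _)]
  rw [← Real.norm_eq_abs]
  exact intervalIntegral.norm_integral_le_of_norm_le_const (C := A) fun z _ => hA i i z

/-- The exponent is bounded, as the coefficients are supported in `(0, 1)`. -/
theorem exists_abs_gaugeLog_le (ho : S.SpeedsOrdered) (hl : S.SpeedsLipschitz)
    (hR0 : 0 ≤ R) (hR : ∀ i j x, |D i j x| ≤ R)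
    (hzero : ∀ i j x, x ∉ Ioo (0 : ℝ) 1 → D i j x = 0) :
    ∃ A, 0 ≤ A ∧ ∀ i x, |S.gaugeLog D i x| ≤ A := by
  obtain ⟨A, hA0, hA⟩ := exists_abs_diagonal_le ho hl hR0 hR
  refine ⟨A, hA0, fun i x => ?_⟩
  have hbound : ∀ y, ‖S.γ * (S.velocity i y)⁻¹ * D i i y‖ ≤
      (Ioc (0 : ℝ) 1).indicator (fun _ => A) y := fun y => by
    by_cases hy : y ∈ Ioc (0 : ℝ) 1
    · rw [indicator_of_mem hy]; exact hA i i y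
    · rw [indicator_of_notMem hy, hzero i i y fun h => hy (Ioo_subset_Ioc_self h)]; simp
  have hint : Integrable ((Ioc (0 : ℝ) 1).indicator fun _ : ℝ => A) :=
    (integrable_indicator_iff measurableSet_Ioc).2 (integrableOn_const (by simp))
  calc |S.gaugeLog D i x|
      ≤ |∫ y in (0 : ℝ)..x, (Ioc (0 : ℝ) 1).indicator (fun _ => A) y| :=
        intervalIntegral.norm_integral_le_abs_of_norm_le (Eventually.of_forall hbound)
          hint.intervalIntegrable
    _ ≤ ∫ y in uIoc 0 x, ‖(Ioc (0 : ℝ) 1).indicator (fun _ => A) y‖ :=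
        Real.norm_eq_abs (∫ y in (0 : ℝ)..x, (Ioc (0 : ℝ) 1).indicator (fun _ => A) y) ▸
          intervalIntegral.norm_integral_le_integral_norm_uIoc
    _ ≤ ∫ y, ‖(Ioc (0 : ℝ) 1).indicator (fun _ => A) y‖ :=
        setIntegral_le_integral hint.norm (Eventually.of_forall fun _ => norm_nonneg _)
    _ = ∫ y, (Ioc (0 : ℝ) 1).indicator (fun _ => A) y := by
        congr 1; ext y
        exact Real.norm_of_nonneg (indicator_nonneg (fun _ _ => hA0) _)
    _ = A := by rw [integral_indicator measurableSet_Ioc]; simp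

theorem continuous_gauge (ho : S.SpeedsOrdered) (hl : S.SpeedsLipschitz)
    (hm : ∀ i j, Measurable (D i j)) (hR0 : 0 ≤ R) (hR : ∀ i j x, |D i j x| ≤ R)
    (i : Fin k ⊕ Fin m) : Continuous (S.gauge D i) := by
  obtain ⟨A, hA⟩ := exists_lipschitzWith_gaugeLog ho hl hm hR0 hR
  exact Real.continuous_exp.comp (hA i).continuous

theorem absolutelyContinuousOnInterval_gauge (ho : S.SpeedsOrdered) (hl : S.SpeedsLipschitz)
    (hm : ∀ i j, Measurable (D i j)) (hR0 : 0 ≤ R) (hR : ∀ i j x, |D i j x| ≤ R)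
    (hzero : ∀ i j x, x ∉ Ioo (0 : ℝ) 1 → D i j x = 0) (i : Fin k ⊕ Fin m) (a b : ℝ) :
    AbsolutelyContinuousOnInterval (S.gauge D i) a b := by
  obtain ⟨A, hA⟩ := exists_lipschitzWith_gaugeLog ho hl hm hR0 hR
  obtain ⟨M, -, hM⟩ := exists_abs_gaugeLog_le ho hl hR0 hR hzero
  have hexp : LipschitzOnWith (Real.toNNReal (Real.exp M)) Real.exp (Iic M) := by
    refine (convex_Iic M).lipschitzOnWith_of_nnnorm_hasDerivWithin_le (f' := Real.exp)
      (fun x _ => (Real.hasDerivAt_exp x).hasDerivWithinAt) fun x hx => ?_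
    rw [← NNReal.coe_le_coe, coe_nnnorm, Real.coe_toNNReal _ (Real.exp_pos M).le,
      Real.norm_of_nonneg (Real.exp_pos x).le]
    exact Real.exp_le_exp.2 hx
  exact (hexp.comp (hA i).lipschitzOnWith fun x _ =>
    (le_abs_self _).trans (hM i x)).absolutelyContinuousOnInterval

/-- The system written along its characteristics, after the gauge transformation. -/
theorem exists_transportSystem (ho : S.SpeedsOrdered) (hl : S.SpeedsLipschitz)
    (hm : ∀ i j, Measurable (D i j)) (hR0 : 0 ≤ R) (hR : ∀ i j x, |D i j x| ≤ R)
    (hzero : ∀ i j x, x ∉ Ioo (0 : ℝ) 1 → D i j x = 0) (T : ℝ) :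
    ∃ P : TransportSystem (Fin k ⊕ Fin m), P.ψ = S.phase ∧
      (P.slope = fun i x => (S.velocity i x)⁻¹) ∧ P.T = T ∧
      ∀ i j x, P.coeff i j x = if i = j then 0 else
        S.γ * (S.velocity i x)⁻¹ * D i j x * (S.gauge D j x / S.gauge D i x) := by
  obtain ⟨κ, hκ, hκ1, hκ2⟩ := exists_le_abs_inv_velocity ho hl
  obtain ⟨A, hA0, hA⟩ := exists_abs_diagonal_le ho hl hR0 hR
  obtain ⟨M, hM0, hM⟩ := exists_abs_gaugeLog_le ho hl hR0 hR hzero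
  refine ⟨{ ψ := S.phase
            slope := fun i x => (S.velocity i x)⁻¹
            coeff := fun i j x => if i = j then 0 else
              S.γ * (S.velocity i x)⁻¹ * D i j x * (S.gauge D j x / S.gauge D i x)
            T := T
            κ := κ
            bound := A * Real.exp (M + M)
            hasDerivAt_ψ := hasDerivAt_phase ho hl
            ψ_zero := S.phase_zero
            κ_pos := hκ
            le_abs_slope := hκ1
            le_abs_slope_sub := hκ2
            measurable_coeff := fun i j => ?_
            abs_coeff_le := fun i j x => ?_
            coeff_self := fun i x => if_pos rfl
            coeff_of_notMem := fun i j x hx => ?_ }, rfl, rfl, rfl, fun _ _ _ => rfl⟩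
  · by_cases h : i = j
    · simp only [if_pos h]; exact measurable_const
    · simp only [if_neg h]
      exact (measurable_diagonal ho hl hm i j).mul
        ((continuous_gauge ho hl hm hR0 hR j).measurable.div
          (continuous_gauge ho hl hm hR0 hR i).measurable)
  · by_cases h : i = j
    · rw [if_pos h, abs_zero]; positivity
    · rw [if_neg h, abs_mul]
      refine mul_le_mul (hA i j x) ?_ (abs_nonneg _) hA0
      rw [gauge, gauge, ← Real.exp_sub, Real.abs_exp]
      refine Real.exp_le_exp.2 ?_
      have h1 := abs_le.1 (hM j x)
      have h2 := abs_le.1 (hM i x)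
      linarith
  · simp only [hzero i j x hx, mul_zero, zero_mul, ite_self]

/-- Undoing the gauge transformation: the product of the gauge factor and a solution satisfies the
original equation along the characteristics. -/
theorem gauge_mul_sub_eq (ho : S.SpeedsOrdered) (hl : S.SpeedsLipschitz)
    (hm : ∀ i j, Measurable (D i j)) (hR0 : 0 ≤ R) (hR : ∀ i j x, |D i j x| ≤ R)
    (hzero : ∀ i j x, x ∉ Ioo (0 : ℝ) 1 → D i j x = 0)
    (hae : ∀ i j, ∀ᵐ x ∂volume.restrict (Ioo (0 : ℝ) 1), S.C x i j = D i j x)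
    {P : TransportSystem (Fin k ⊕ Fin m)} (hψ : P.ψ = S.phase)
    (hcoeff : ∀ i j x, P.coeff i j x = if i = j then 0 else
        S.γ * (S.velocity i x)⁻¹ * D i j x * (S.gauge D j x / S.gauge D i x))
    {u : ℝ → ℝ → Fin k ⊕ Fin m → ℝ} {i : Fin k ⊕ Fin m} {c : ℝ}
    (hu : Integrable (P.source u i c))
    (heq : ∀ x ∈ Icc (0 : ℝ) 1, u (c + S.phase i x) x i = u c 0 i + P.coupling 0 u i c x)
    {a b : ℝ} (ha : a ∈ Icc (0 : ℝ) 1) (hb : b ∈ Icc (0 : ℝ) 1)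
    (htime : ∀ y ∈ uIcc a b, c + S.phase i y ∈ Ico 0 P.T) :
    S.gauge D i b * u (c + S.phase i b) b i - S.gauge D i a * u (c + S.phase i a) a i =
      ∫ y in a..b, S.sourceAlong (fun t x j => S.gauge D j x * u t x j) i c y := by
  have hE := absolutelyContinuousOnInterval_gauge ho hl hm hR0 hR hzero i a b
  set G : ℝ → ℝ := fun x => u c 0 i + P.coupling 0 u i c x with hG
  have hab : uIcc a b ⊆ Icc 0 1 := uIcc_subset_Icc ha hb
  have hGac : AbsolutelyContinuousOnInterval G a b := by
    have h1 : AbsolutelyContinuousOnInterval (fun x => ∫ y in a..x, P.source u i c y) a b :=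
      hu.intervalIntegrable.absolutelyContinuousOnInterval_intervalIntegral (by simp)
    have h2 : AbsolutelyContinuousOnInterval
        (fun _ : ℝ => u c 0 i + ∫ y in (0 : ℝ)..a, P.source u i c y) a b :=
      (LipschitzWith.const _).lipschitzOnWith.absolutelyContinuousOnInterval (K := 0)
    have h3 : G = (fun _ : ℝ => u c 0 i + ∫ y in (0 : ℝ)..a, P.source u i c y) +
        fun x => ∫ y in a..x, P.source u i c y := by
      ext x
      simp only [hG, TransportSystem.coupling, Pi.add_apply]
      rw [add_assoc, intervalIntegral.integral_add_adjacent_intervals hu.intervalIntegrable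
        hu.intervalIntegrable]
    rw [h3]
    exact h2.add h1
  -- integration of the derivative of the product, which is absolutely continuous
  have key := hE.integral_deriv_mul_eq_sub hGac
  rw [heq a ha, heq b hb]
  change S.gauge D i b * G b - S.gauge D i a * G a = _
  rw [← key]
  refine intervalIntegral.integral_congr_ae ?_
  have hC : ∀ j, ∀ᵐ x : ℝ, x ∈ Ioo (0 : ℝ) 1 → S.C x i j = D i j x := fun j =>
    (ae_restrict_iff' measurableSet_Ioo).1 (hae i j)
  have hdE :=
    (intervalIntegrable_diagonal (a := 0) (b := 1) ho hl hm hR0 hR i).ae_hasDerivAt_integral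
  have hdG := (hu.intervalIntegrable (a := 0) (b := 1)).ae_hasDerivAt_integral
  have hne : ∀ᵐ y : ℝ, c + S.phase i y ≠ 0 := by
    have : {y | c + S.phase i y = 0}.Subsingleton := fun y hy y' hy' =>
      injective_phase ho hl i (add_left_cancel (hy.trans (Eq.symm hy')))
    exact this.finite.countable.ae_notMem volume
  have h01 : ∀ᵐ y : ℝ, y ∉ ({0, 1} : Set ℝ) :=
    (Set.toFinite ({0, 1} : Set ℝ)).countable.ae_notMem volume
  filter_upwards [ae_all_iff.2 hC, hdE, hdG, hne, h01] with y hCy hEy hGy hy0 hy01 hy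
  have hyI : y ∈ uIcc a b := uIoc_subset_uIcc hy
  have hy1 : y ∈ Icc (0 : ℝ) 1 := hab hyI
  have hyo : y ∈ Ioo (0 : ℝ) 1 := by
    simp only [mem_insert_iff, mem_singleton_iff, not_or] at hy01
    exact ⟨lt_of_le_of_ne hy1.1 (Ne.symm hy01.1), lt_of_le_of_ne hy1.2 hy01.2⟩
  have hy1' : y ∈ uIcc (0 : ℝ) 1 := by rwa [uIcc_of_le zero_le_one]
  have hcut : P.cut (c + P.ψ i y) = 1 := by
    rw [hψ]
    have := htime y hyI
    exact P.cut_of_mem ⟨lt_of_le_of_ne this.1 (Ne.symm hy0), this.2⟩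
  have e1 : deriv (S.gauge D i) y = S.gauge D i y * (S.γ * (S.velocity i y)⁻¹ * D i i y) :=
    ((hEy hy1' 0 (by simp)).exp).deriv
  have e2 : deriv G y = P.source u i c y := ((hGy hy1' 0 (by simp)).const_add _).deriv
  have e3 : G y = u (c + S.phase i y) y i := (heq y hy1).symm
  rw [e1, e2, e3, sourceAlong, TransportSystem.source, Finset.mul_sum, Finset.mul_sum,
    ← Finset.add_sum_erase _ _ (Finset.mem_univ i), ← Finset.add_sum_erase _ _ (Finset.mem_univ i),
    hcoeff i i y, if_pos rfl, hcut, hCy i hyo]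
  have hsum : ∑ j ∈ Finset.univ.erase i, S.gauge D i y *
        (P.coeff i j y * 1 * u (c + P.ψ i y) y j) =
      ∑ j ∈ Finset.univ.erase i, (S.velocity i y)⁻¹ *
        (S.γ * S.C y i j * (S.gauge D j y * u (c + S.phase i y) y j)) :=
    Finset.sum_congr rfl fun j hj => by
      rw [hcoeff i j y, if_neg (Finset.ne_of_mem_erase hj).symm, hCy j hyo, hψ]
      have := (gauge_pos (S := S) (D := D) i y).ne'
      field_simp
  rw [hsum]
  ring

end gauge

end ControlSystem

/-! ### Continuous curves in `L²` -/

/-- Translations act continuously on `L²`. -/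
theorem tendsto_eLpNorm_translate_sub {f : ℝ → ℝ} (hf : MemLp f 2 volume) :
    Tendsto (fun h : ℝ => eLpNorm (fun s => f (h + s) - f s) 2 volume) (𝓝 0) (𝓝 0) := by
  have : Fact ((2 : ENNReal) ≠ ⊤) := ⟨ENNReal.ofNat_ne_top⟩
  have hc : Continuous fun h : ℝ => (DomAddAct.mk h) +ᵥ hf.toLp f :=
    (DomAddAct.continuous_mk.vadd continuous_const)
  have h0 := (tendsto_iff_edist_tendsto_0.1 (hc.tendsto 0))
  refine h0.congr fun h => ?_
  rw [DomAddAct.mk_vadd_toLp, DomAddAct.mk_vadd_toLp, Lp.edist_toLp_toLp]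
  simp only [vadd_eq_add, zero_add]
  rfl

namespace ContinuousInL2

variable {u v : ℝ → ℝ → ℝ} {J I : Set ℝ}

theorem add (hu : ContinuousInL2 u J I) (hv : ContinuousInL2 v J I) :
    ContinuousInL2 (fun t x => u t x + v t x) J I := by
  refine ⟨fun t ht => (hu.1 t ht).add (hv.1 t ht), fun t₀ ht₀ => ?_⟩
  have h := (hu.2 t₀ ht₀).add (hv.2 t₀ ht₀)
  rw [add_zero] at h
  refine tendsto_of_tendsto_of_tendsto_of_le_of_le' tendsto_const_nhds h
    (Eventually.of_forall fun _ => zero_le) ?_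
  filter_upwards [self_mem_nhdsWithin] with t ht
  have := eLpNorm_add_le ((hu.1 t ht).sub (hu.1 t₀ ht₀)).1 ((hv.1 t ht).sub (hv.1 t₀ ht₀)).1
    one_le_two
  refine le_trans (le_of_eq ?_) this
  congr 1
  ext x
  simp only [Pi.add_apply, Pi.sub_apply]
  ring

theorem sub (hu : ContinuousInL2 u J I) (hv : ContinuousInL2 v J I) :
    ContinuousInL2 (fun t x => u t x - v t x) J I := by
  refine ⟨fun t ht => (hu.1 t ht).sub (hv.1 t ht), fun t₀ ht₀ => ?_⟩
  have h := (hu.2 t₀ ht₀).add (hv.2 t₀ ht₀)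
  rw [add_zero] at h
  refine tendsto_of_tendsto_of_tendsto_of_le_of_le' tendsto_const_nhds h
    (Eventually.of_forall fun _ => zero_le) ?_
  filter_upwards [self_mem_nhdsWithin] with t ht
  have := eLpNorm_sub_le ((hu.1 t ht).sub (hu.1 t₀ ht₀)).1 ((hv.1 t ht).sub (hv.1 t₀ ht₀)).1
    one_le_two
  refine le_trans (le_of_eq ?_) this
  congr 1
  ext x
  simp only [Pi.sub_apply]
  ring

/-- Multiplication by a continuous function, which is uniformly continuous on the compact
set `K`. -/
theorem continuous_mul (hu : ContinuousInL2 u J I) (hI : MeasurableSet I) {K : Set ℝ}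
    (hK : IsCompact K) (hIK : I ⊆ K) {h : ℝ → ℝ → ℝ} (hh : Continuous fun p : ℝ × ℝ => h p.1 p.2) :
    ContinuousInL2 (fun t x => h t x * u t x) J I := by
  have hbound : ∀ t, ∃ M : ℝ, 0 ≤ M ∧ ∀ x ∈ K, |h t x| ≤ M := fun t => by
    obtain ⟨M, hM⟩ := hK.exists_bound_of_continuousOn
      (hh.comp (continuous_const (y := t) |>.prodMk continuous_id)).continuousOn
    exact ⟨|M|, abs_nonneg _, fun x hx => (hM x hx).trans (le_abs_self M)⟩
  have hsl : ∀ t, Continuous (h t) := fun t =>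
    hh.comp (continuous_const (y := t) |>.prodMk continuous_id)
  have hle : ∀ (g : ℝ → ℝ) (v : ℝ → ℝ) (M : ℝ), (∀ x ∈ K, |g x| ≤ M) →
      eLpNorm (fun x => g x * v x) 2 (volume.restrict I) ≤
        ENNReal.ofReal M * eLpNorm v 2 (volume.restrict I) := fun g v M hM =>
    eLpNorm_le_mul_eLpNorm_of_ae_le_mul (by
      filter_upwards [ae_restrict_mem hI] with x hx
      rw [norm_mul]
      exact mul_le_mul_of_nonneg_right (hM x (hIK hx)) (norm_nonneg _)) 2
  have hmem : ∀ (g v : ℝ → ℝ), Continuous g → MemLp v 2 (volume.restrict I) →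
      (∃ M : ℝ, 0 ≤ M ∧ ∀ x ∈ K, |g x| ≤ M) →
      MemLp (fun x => g x * v x) 2 (volume.restrict I) := fun g v hg hv ⟨M, _, hM⟩ =>
    ⟨hg.aestronglyMeasurable.mul hv.1,
      (hle g v M hM).trans_lt (ENNReal.mul_lt_top ENNReal.ofReal_lt_top hv.2)⟩
  refine ⟨fun t ht => hmem _ _ (hsl t) (hu.1 t ht) (hbound t), fun t₀ ht₀ => ?_⟩
  obtain ⟨M, hM0, hM⟩ := hbound t₀
  have hunif : TendstoUniformlyOn (fun t x => h t x) (h t₀) (𝓝 t₀) K :=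
    ContinuousMap.tendsto_iff_forall_isCompact_tendstoUniformlyOn.1
      ((ContinuousMap.curry ⟨_, hh⟩).continuous.tendsto t₀) K hK
  rw [ENNReal.tendsto_nhds_zero]
  intro ε hε
  have hε2 : ε / 2 ≠ 0 := (ENNReal.half_pos hε.ne').ne'
  obtain ⟨η, hη, hηε⟩ := ENNReal.exists_nnreal_pos_mul_lt (hu.1 t₀ ht₀).2.ne hε2
  have h1 : Tendsto (fun t => ENNReal.ofReal (M + 1) *
      eLpNorm (fun x => u t x - u t₀ x) 2 (volume.restrict I)) (𝓝[J] t₀) (𝓝 0) := by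
    simpa using ENNReal.Tendsto.const_mul (hu.2 t₀ ht₀) (Or.inr ENNReal.ofReal_ne_top)
  have h2 : ∀ᶠ t in 𝓝[J] t₀, ∀ x ∈ K, |h t x - h t₀ x| < min 1 (η : ℝ) := by
    filter_upwards [(Metric.tendstoUniformlyOn_iff.1 hunif _
      (lt_min one_pos (NNReal.coe_pos.2 hη))).filter_mono nhdsWithin_le_nhds] with t ht x hx
    have := ht x hx
    rwa [dist_comm, Real.dist_eq] at this
  filter_upwards [h2, ENNReal.tendsto_nhds_zero.1 h1 _ (pos_iff_ne_zero.2 hε2), self_mem_nhdsWithin]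
    with t ht h3 htJ
  have hbt : ∀ x ∈ K, |h t x| ≤ M + 1 := fun x hx => by
    have h4 := (ht x hx).trans_le (min_le_left _ _)
    have h5 := abs_sub_abs_le_abs_sub (h t x) (h t₀ x)
    have h6 := hM x hx
    linarith
  have hsplit : (fun x => h t x * u t x - h t₀ x * u t₀ x) =
      (fun x => h t x * (u t x - u t₀ x)) + fun x => (h t x - h t₀ x) * u t₀ x := by
    ext x; simp only [Pi.add_apply]; ring
  rw [hsplit]
  calc _ ≤ _ := eLpNorm_add_le
        (hmem _ _ (hsl t) ((hu.1 t htJ).sub (hu.1 t₀ ht₀)) ⟨_, by positivity, hbt⟩).1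
        (((hsl t).sub (hsl t₀)).aestronglyMeasurable.mul (hu.1 t₀ ht₀).1) one_le_two
    _ ≤ ε / 2 + ε / 2 := by
        refine add_le_add ((hle _ _ _ hbt).trans h3) ?_
        refine (hle (fun x => h t x - h t₀ x) _ (η : ℝ) fun x hx =>
          ((ht x hx).trans_le (min_le_right _ _)).le).trans ?_
        rw [ENNReal.ofReal_coe_nnreal]
        exact hηε.le
    _ = ε := ENNReal.add_halves ε

/-- Continuous functions. -/
theorem of_continuous (hI : MeasurableSet I) {K : Set ℝ} (hK : IsCompact K) (hIK : I ⊆ K)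
    {h : ℝ → ℝ → ℝ} (hh : Continuous fun p : ℝ × ℝ => h p.1 p.2) : ContinuousInL2 h J I := by
  have : IsFiniteMeasure (volume.restrict I) :=
    ⟨by rw [Measure.restrict_apply_univ]; exact (measure_mono hIK).trans_lt hK.measure_lt_top⟩
  have h1 : ContinuousInL2 (fun _ _ => (1 : ℝ)) J I :=
    ⟨fun _ _ => memLp_const 1, fun _ _ => by simpa using tendsto_const_nhds⟩
  simpa using h1.continuous_mul hI hK hIK hh

/-- Functions which are transported, transversally to the slices. -/
theorem of_transport {f : ℝ → ℝ} (hf : Measurable f) (hf2 : MemLp f 2 volume) {η η' σ : ℝ → ℝ}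
    {κ : ℝ} (hκ : 0 < κ) (hη : ∀ x, HasDerivAt η (η' x) x) (hle : ∀ x, κ ≤ |η' x|)
    (hσ : Continuous σ) (hI : MeasurableSet I) : ContinuousInL2 (fun t x => f (σ t + η x)) J I := by
  have hηc : Continuous η := continuous_iff_continuousAt.2 fun x => (hη x).continuousAt
  refine ⟨fun t _ => ⟨(hf.comp (hηc.measurable.const_add _)).aestronglyMeasurable, ?_⟩,
    fun t₀ _ => ?_⟩
  · exact (eLpNorm_comp_le hκ (fun x => (hη x).const_add (σ t)) hle f hI).trans_lt
      (ENNReal.mul_lt_top ENNReal.ofReal_lt_top hf2.2)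
  · have h1 : Tendsto (fun t => σ t - σ t₀) (𝓝[J] t₀) (𝓝 0) := by
      have := ((hσ.sub continuous_const).tendsto t₀ (f := fun t => σ t - σ t₀))
      rw [sub_self] at this
      exact this.mono_left nhdsWithin_le_nhds
    have h2 := ENNReal.Tendsto.const_mul ((tendsto_eLpNorm_translate_sub hf2).comp h1)
      (Or.inr (ENNReal.ofReal_ne_top (r := (√κ)⁻¹)))
    rw [mul_zero] at h2
    refine tendsto_of_tendsto_of_tendsto_of_le_of_le tendsto_const_nhds h2 (fun _ => zero_le)
      fun t => ?_
    have := eLpNorm_comp_le hκ (fun x => (hη x).const_add (σ t₀)) hle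
      (fun s => f (σ t - σ t₀ + s) - f s) hI
    simpa [← add_assoc] using this

end ContinuousInL2

/-! ### Formulas for broad solutions along characteristics -/

namespace ControlSystem

variable {k m : ℕ} {S : ControlSystem k m}

variable (S) in
/-- The equation holds, in integrated form, along every characteristic segment in
`[0, T) × [0, 1]`. -/
def IsTransported (T : ℝ) (w : ℝ → ℝ → Fin k ⊕ Fin m → ℝ) : Prop :=
  ∀ i c a b, a ∈ Icc (0 : ℝ) 1 → b ∈ Icc (0 : ℝ) 1 →
    (∀ y ∈ uIcc a b, c + S.phase i y ∈ Ico 0 T) →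
    w (c + S.phase i b) b i - w (c + S.phase i a) a i = ∫ y in a..b, S.sourceAlong w i c y

section formulas

variable {T : ℝ} {w₀ : ℝ → Fin k ⊕ Fin m → ℝ} {w : ℝ → ℝ → Fin k ⊕ Fin m → ℝ} {τ ξ c : ℝ}

/-- The value at a point is the integral of the source term from the entry point, plus the value at
the entry point. -/
theorem IsTransported.eq_entryPoint (h : S.IsTransported T w) (ho : S.SpeedsOrdered)
    (hl : S.SpeedsLipschitz) (i : Fin k ⊕ Fin m) (hτ : τ ∈ Ico 0 T) (hξ : ξ ∈ Icc (0 : ℝ) 1)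
    (hc : c = τ - S.phase i ξ) :
    (∫ y in (S.entryPoint i c)..ξ, S.sourceAlong w i c y) +
      w (c + S.phase i (S.entryPoint i c)) (S.entryPoint i c) i = w τ ξ i := by
  obtain ⟨h1, h2, h3⟩ := mem_of_mem_uIoc_entryPoint ho hl i hc hτ.1 hξ
  rw [← h i c _ ξ h1 hξ fun y hy => ⟨h2.trans (h3 y hy).1, (h3 y hy).2.trans_lt hτ.2⟩]
  rw [sub_add_cancel, hc, sub_add_cancel]

theorem IsTransported.positiveValue_eq (h : S.IsTransported T w) (ho : S.SpeedsOrdered)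
    (hl : S.SpeedsLipschitz) (j : Fin m) (hτ : τ ∈ Ico 0 T) (hξ : ξ ∈ Icc (0 : ℝ) 1)
    (hc : c = τ - S.phase (Sum.inr j) ξ)
    (h0 : S.foot (Sum.inr j) c ∈ Icc (0 : ℝ) 1 →
      w 0 (S.foot (Sum.inr j) c) (Sum.inr j) = w₀ (S.foot (Sum.inr j) c) (Sum.inr j)) :
    w τ ξ (Sum.inr j) = S.positiveValue w₀ (fun t j => w t 1 (Sum.inr j)) w j τ ξ := by
  have he := (mem_of_mem_uIoc_entryPoint ho hl (Sum.inr j) hc hτ.1 hξ).1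
  rw [ControlSystem.positiveValue_eq ho hl _ _ _ _ _ _ hc, ← h.eq_entryPoint ho hl _ hτ hξ hc]
  congr 1
  by_cases h' : 0 < c + S.phase (Sum.inr j) 1
  · simp only [entryPoint, if_pos h']
  · simp only [entryPoint, if_neg h'] at he ⊢
    rw [phase_foot ho hl, add_neg_cancel, h0 he]

theorem IsTransported.negativeValue_eq (h : S.IsTransported T w) (ho : S.SpeedsOrdered)
    (hl : S.SpeedsLipschitz) (i : Fin k) (hτ : τ ∈ Ico 0 T) (hξ : ξ ∈ Icc (0 : ℝ) 1)
    (hc : c = τ - S.phase (Sum.inl i) ξ)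
    (hB : 0 < c → w c 0 (Sum.inl i) = ∑ j, S.B i j * w c 0 (Sum.inr j))
    (h0 : ∀ i, S.foot i c ∈ Icc (0 : ℝ) 1 → w 0 (S.foot i c) i = w₀ (S.foot i c) i) :
    w τ ξ (Sum.inl i) = S.negativeValue w₀ (fun t j => w t 1 (Sum.inr j)) w i τ ξ := by
  obtain ⟨he, -, h3⟩ := mem_of_mem_uIoc_entryPoint ho hl (Sum.inl i) hc hτ.1 hξ
  rw [ControlSystem.negativeValue_eq ho hl _ _ _ _ _ _ hc, ← h.eq_entryPoint ho hl _ hτ hξ hc]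
  congr 1
  by_cases h' : 0 < c
  · have hcT : c < T := by
      have := (h3 _ left_mem_uIcc).2
      simp only [entryPoint, if_pos h', phase_zero, add_zero] at this
      exact this.trans_lt hτ.2
    simp only [entryPoint, if_pos h', phase_zero, add_zero]
    rw [hB h']
    refine Finset.sum_congr rfl fun j _ => ?_
    rw [← h.positiveValue_eq ho hl j ⟨h'.le, hcT⟩ ⟨le_rfl, zero_le_one⟩ (c := c)
      (by rw [phase_zero, sub_zero]) (h0 _)]
  · simp only [entryPoint, if_neg h'] at he ⊢
    rw [phase_foot ho hl, add_neg_cancel, h0 _ he]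

end formulas

/-- The passage from the points `(t, x)` to the labels `c = t - φ x` of the curves `t = c + φ x`
preserves the Lebesgue measure. -/
theorem measurePreserving_label {φ : ℝ → ℝ} (hφ : Measurable φ) :
    MeasurePreserving (fun p : ℝ × ℝ => (p.1 - φ p.2, p.2)) := by
  have h : MeasurePreserving (fun p : ℝ × ℝ => (p.1, p.2 - φ p.1))
      ((volume : Measure ℝ).prod volume) ((volume : Measure ℝ).prod volume) :=
    (MeasurePreserving.id volume).skew_product (g := fun x t => t - φ x)
      (measurable_snd.sub (hφ.comp measurable_fst))
      (Eventually.of_forall fun x => (measurePreserving_sub_right volume (φ x)).map_eq)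
  exact (Measure.measurePreserving_swap.comp h).comp Measure.measurePreserving_swap

/-- A property of almost every label holds for the curves through almost every point. -/
theorem ae_label {φ : ℝ → ℝ} (hφ : Measurable φ) {q : ℝ → Prop} (hq : ∀ᵐ c, q c) :
    ∀ᵐ p : ℝ × ℝ, q (p.1 - φ p.2) :=
  (Measure.quasiMeasurePreserving_fst.comp
    (measurePreserving_label hφ).quasiMeasurePreserving).ae hq

theorem foot_neg_phase (ho : S.SpeedsOrdered) (hl : S.SpeedsLipschitz)
    (i : Fin k ⊕ Fin m) (x : ℝ) : S.foot i (-S.phase i x) = x := by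
  apply injective_phase ho hl i
  rw [phase_foot ho hl, neg_neg]

/-- A property of almost every abscissa holds for the foot of the characteristics with almost every
label. -/
theorem ae_comp_foot (ho : S.SpeedsOrdered) (hl : S.SpeedsLipschitz)
    (i : Fin k ⊕ Fin m) {q : ℝ → Prop} (hq : ∀ᵐ x, q x) :
    ∀ᵐ c, q (S.foot i c) := by
  have h := addHaar_image_eq_zero_of_differentiableOn_of_addHaar_eq_zero (μ := volume)
    (f := fun x => -S.phase i x) (s := {x | ¬ q x})
    (fun x _ => (hasDerivAt_phase ho hl i x).neg.differentiableAt.differentiableWithinAt) hq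
  refine measure_mono_null (fun c (hc : ¬ q (S.foot i c)) => ?_) h
  exact ⟨S.foot i c, hc, by simp only [phase_foot ho hl, neg_neg]⟩

theorem measurable_foot (ho : S.SpeedsOrdered) (hl : S.SpeedsLipschitz)
    (i : Fin k ⊕ Fin m) : Measurable (S.foot i) := by
  rcases i with i | j
  · have : Antitone (S.foot (Sum.inl i)) := fun c c' h => by
      rw [← (strictMono_phase ho hl i).le_iff_le, phase_foot ho hl, phase_foot ho hl]
      exact neg_le_neg h
    exact this.measurable
  · have : Monotone (S.foot (Sum.inr j)) := fun c c' h => by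
      rw [← (strictAnti_phase ho hl j).le_iff_ge, phase_foot ho hl, phase_foot ho hl]
      exact neg_le_neg h
    exact this.measurable

theorem memLp_comp_foot (ho : S.SpeedsOrdered) (hl : S.SpeedsLipschitz)
    (i : Fin k ⊕ Fin m) {g : ℝ → ℝ} (hg : Measurable g)
    (hg2 : MemLp g 2 volume) : MemLp (fun c => g (S.foot i c)) 2 volume := by
  obtain ⟨V, hV0, hV⟩ := exists_abs_inv_velocity_le ho hl
  refine ⟨(hg.comp (measurable_foot ho hl i)).aestronglyMeasurable, ?_⟩
  rw [eLpNorm_lt_top_iff_lintegral_rpow_enorm_lt_top two_ne_zero ENNReal.ofNat_ne_top]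
  have h := lintegral_image_eq_lintegral_abs_deriv_mul (s := univ) MeasurableSet.univ
    (fun x _ => (hasDerivAt_phase ho hl i x).neg.hasDerivWithinAt)
    (fun x _ y _ hxy => injective_phase ho hl i (neg_injective hxy))
    (fun c => ‖g (S.foot i c)‖ₑ ^ (2 : ENNReal).toReal)
  have himage : (-S.phase i) '' univ = univ := by
    refine eq_univ_of_forall fun c => ⟨S.foot i c, mem_univ _, ?_⟩
    simp [phase_foot ho hl]
  rw [himage, Measure.restrict_univ] at h
  rw [h]
  have hfin := (eLpNorm_lt_top_iff_lintegral_rpow_enorm_lt_top two_ne_zero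
    ENNReal.ofNat_ne_top).1 hg2.2
  calc _ ≤ ∫⁻ x, ENNReal.ofReal V * ‖g x‖ₑ ^ (2 : ENNReal).toReal := by
        refine lintegral_mono fun x => ?_
        simp only [Pi.neg_apply, foot_neg_phase ho hl, abs_neg]
        exact mul_le_mul_left (ENNReal.ofReal_le_ofReal (hV i x)) _
    _ = ENNReal.ofReal V * ∫⁻ x, ‖g x‖ₑ ^ (2 : ENNReal).toReal :=
        lintegral_const_mul' _ _ ENNReal.ofReal_ne_top
    _ < ⊤ := ENNReal.mul_lt_top ENNReal.ofReal_lt_top hfin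

end ControlSystem

/-! ### Existence of a control -/

namespace ControlSystem

variable {k m : ℕ} {S : ControlSystem k m}
  {D : Fin k ⊕ Fin m → Fin k ⊕ Fin m → ℝ → ℝ} {R : ℝ}

/-- A square integrable initial datum, transported to the labels of the characteristics and divided
by the gauge factor. -/
theorem exists_isDatum_initial (ho : S.SpeedsOrdered) (hl : S.SpeedsLipschitz)
    (hm : ∀ i j, Measurable (D i j)) (hR0 : 0 ≤ R) (hR : ∀ i j x, |D i j x| ≤ R)
    (hzero : ∀ i j x, x ∉ Ioo (0 : ℝ) 1 → D i j x = 0) {w₀ : ℝ → Fin k ⊕ Fin m → ℝ}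
    (hw₀ : ∀ i, MemLp (fun x => w₀ x i) 2 (volume.restrict (Ioo 0 1))) :
    ∃ a : Fin k ⊕ Fin m → ℝ → ℝ, TransportSystem.IsDatum a ∧
      ∀ i, ∀ᵐ x, x ∈ Ioo (0 : ℝ) 1 → S.gauge D i x * a i (-S.phase i x) = w₀ x i := by
  obtain ⟨M, -, hM⟩ := exists_abs_gaugeLog_le ho hl hR0 hR hzero
  have h : ∀ i, ∃ g : ℝ → ℝ, Measurable g ∧ MemLp g 2 volume ∧
      ∀ᵐ x, x ∈ Ioo (0 : ℝ) 1 → S.gauge D i x * g x = w₀ x i := fun i => by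
    set v := (hw₀ i).1.mk _ with hv
    have hvm : Measurable v := (hw₀ i).1.stronglyMeasurable_mk.measurable
    have hEm : Measurable (S.gauge D i) := (continuous_gauge ho hl hm hR0 hR i).measurable
    have hgm : Measurable fun x => (S.gauge D i x)⁻¹ * v x := hEm.inv.mul hvm
    refine ⟨(Ioo (0 : ℝ) 1).indicator fun x => (S.gauge D i x)⁻¹ * v x,
      hgm.indicator measurableSet_Ioo, ?_, ?_⟩
    · rw [memLp_indicator_iff_restrict measurableSet_Ioo]
      have hv2 : MemLp v 2 (volume.restrict (Ioo 0 1)) :=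
        (memLp_congr_ae (hw₀ i).1.ae_eq_mk).1 (hw₀ i)
      refine (hv2.const_mul (Real.exp M)).mono hgm.aestronglyMeasurable
        (Eventually.of_forall fun x => ?_)
      rw [norm_mul, norm_mul]
      refine mul_le_mul_of_nonneg_right ?_ (norm_nonneg _)
      rw [gauge, ← Real.exp_neg, Real.norm_eq_abs, Real.norm_eq_abs, Real.abs_exp, Real.abs_exp]
      exact Real.exp_le_exp.2 ((neg_le_abs _).trans (hM i x))
    · have := (ae_restrict_iff' measurableSet_Ioo).1 (hw₀ i).1.ae_eq_mk
      filter_upwards [this] with x hx hx1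
      rw [indicator_of_mem hx1, hx hx1, mul_inv_cancel_left₀ (gauge_pos i x).ne']
  choose g hgm hg2 hgae using h
  refine ⟨fun i c => g i (S.foot i c), fun i => ⟨(hgm i).comp (measurable_foot ho hl i),
    memLp_comp_foot ho hl i (hgm i) (hg2 i)⟩, fun i => ?_⟩
  filter_upwards [hgae i] with x hx hx1
  rw [foot_neg_phase ho hl, hx hx1]

/-- A solution of the system written along its characteristics gives a broad solution of the
control system, the control being its trace at `x = 1`. -/
theorem exists_isBroadSolution_of_wave (ho : S.SpeedsOrdered) (hl : S.SpeedsLipschitz)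
    (hm : ∀ i j, Measurable (D i j)) (hR0 : 0 ≤ R) (hR : ∀ i j x, |D i j x| ≤ R)
    (hzero : ∀ i j x, x ∉ Ioo (0 : ℝ) 1 → D i j x = 0)
    (hae : ∀ i j, ∀ᵐ x ∂volume.restrict (Ioo (0 : ℝ) 1), S.C x i j = D i j x)
    [Nonempty (Fin k ⊕ Fin m)]
    {P : TransportSystem (Fin k ⊕ Fin m)} (hψ : P.ψ = S.phase)
    (hcoeff : ∀ i j x, P.coeff i j x = if i = j then 0 else
        S.γ * (S.velocity i x)⁻¹ * D i j x * (S.gauge D j x / S.gauge D i x))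
    {f : Fin k ⊕ Fin m → ℝ → ℝ} (hf : TransportSystem.IsDatum f)
    {Z : BoundedContinuousFunction (ℝ × ℝ) (Fin k ⊕ Fin m → ℝ)}
    (hZ : P.IsSolution (fun _ => 0) 0 f fun t x => Z (t, x))
    (hB : ∀ i c, 0 < c → f (Sum.inl i) c = ∑ j, S.B i j * f (Sum.inr j) c)
    {T : ℝ} (hT : T ≤ P.T) {w₀ : ℝ → Fin k ⊕ Fin m → ℝ} {w : ℝ → ℝ → Fin k ⊕ Fin m → ℝ}
    (hw : w = fun t x i => S.gauge D i x * wave P.ψ f (fun t x => Z (t, x)) t x i)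
    (h0 : ∀ i, ∀ᵐ x, x ∈ Ioo (0 : ℝ) 1 → w 0 x i = w₀ x i) :
    (∀ j, MemLp (fun t => w t 1 (Sum.inr j)) 2 (volume.restrict (Ioo 0 T))) ∧
      S.IsBroadSolution T w₀ (fun t j => w t 1 (Sum.inr j)) w := by
  have hbm := TransportSystem.bcf_measurable Z
  have hba := TransportSystem.bcf_abs_le Z
  have hE : ∀ i, Continuous (S.gauge D i) := continuous_gauge ho hl hm hR0 hR
  have hZc : ∀ i, Continuous fun p : ℝ × ℝ => Z (p.1, p.2) i := fun i =>
    (continuous_apply i).comp Z.continuous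
  have hZc' : ∀ i, Continuous fun p : ℝ × ℝ => Z (p.2, p.1) i := fun i =>
    (hZc i).comp continuous_swap
  have htr : S.IsTransported T w := by
    intro i c a b ha hb htime
    rw [hw]
    refine gauge_mul_sub_eq ho hl hm hR0 hR hzero hae hψ hcoeff
      (P.integrable_source_wave hf hbm hba i c) (fun x hx => ?_) ha hb fun y hy =>
      ⟨(htime y hy).1, (htime y hy).2.trans_le hT⟩
    have := hZ.wave_eq hf hbm hba (c + S.phase i x) hx.1 i
    rw [← hψ] at this ⊢
    rwa [add_sub_cancel_right] at this
  -- the bounded part and the exponent of the gauge factor vanish at `x = 0`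
  have htrace : ∀ i c, w c 0 i = f i c := fun i c => by
    rw [hw]
    simp only [gauge_zero, wave, P.ψ_zero, sub_zero, one_mul]
    rw [TransportSystem.trace_eq_of_entry hZ rfl c, add_zero]
  -- the initial datum is attained along the characteristics with almost every label
  have hinit : ∀ᵐ c, ∀ i, S.foot i c ∈ Icc (0 : ℝ) 1 → w 0 (S.foot i c) i = w₀ (S.foot i c) i := by
    refine ae_all_iff.2 fun i => ae_comp_foot ho hl i
      (q := fun x => x ∈ Icc (0 : ℝ) 1 → w 0 x i = w₀ x i) ?_
    filter_upwards [h0 i, (Set.toFinite ({0, 1} : Set ℝ)).countable.ae_notMem volume] with x hx hx'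
      hx1
    simp only [mem_insert_iff, mem_singleton_iff, not_or] at hx'
    exact hx ⟨lt_of_le_of_ne hx1.1 (Ne.symm hx'.1), lt_of_le_of_ne hx1.2 hx'.2⟩
  have hlabel : ∀ i, ∀ᵐ p : ℝ × ℝ ∂volume.restrict (Ioo 0 T ×ˢ Ioo 0 1),
      (p.1 ∈ Ico 0 T ∧ p.2 ∈ Icc (0 : ℝ) 1) ∧
        ∀ i', S.foot i' (p.1 - S.phase i p.2) ∈ Icc (0 : ℝ) 1 →
        w 0 (S.foot i' (p.1 - S.phase i p.2)) i' = w₀ (S.foot i' (p.1 - S.phase i p.2)) i' :=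
    fun i => by
      filter_upwards [ae_restrict_mem (measurableSet_Ioo.prod measurableSet_Ioo),
        ae_restrict_of_ae (ae_label (continuous_phase ho hl i).measurable hinit)] with p hp hp'
      exact ⟨⟨Ioo_subset_Ico_self hp.1, Ioo_subset_Icc_self hp.2⟩, hp'⟩
  have hspace : ∀ i, ContinuousInL2 (fun x t => w t x i) (Icc 0 1) (Ioo 0 T) := fun i => by
    have h1 : ContinuousInL2 (fun x t => f i (-S.phase i x + t)) (Icc 0 1) (Ioo 0 T) :=
      ContinuousInL2.of_transport (hf i).1 (hf i).2 one_pos (η' := fun _ => 1)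
        (fun x => hasDerivAt_id x) (fun x => by simp) (continuous_phase ho hl i).neg
        measurableSet_Ioo
    have h2 := (h1.add (ContinuousInL2.of_continuous (h := fun x t => Z (t, x) i)
      measurableSet_Ioo isCompact_Icc Ioo_subset_Icc_self (hZc' i))).continuous_mul
      measurableSet_Ioo isCompact_Icc Ioo_subset_Icc_self (h := fun x _ => S.gauge D i x)
      ((hE i).comp continuous_fst)
    simpa only [hw, wave, hψ, neg_add_eq_sub] using h2
  refine ⟨fun j => (hspace (Sum.inr j)).1 1 ⟨zero_le_one, le_rfl⟩, ?_, ?_, hspace, ?_, ?_⟩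
  · intro i
    rw [hw]
    refine Measurable.aestronglyMeasurable (((hE i).measurable.comp measurable_snd).mul ?_)
    simp only [wave]
    exact ((hf i).1.comp (measurable_fst.sub
      ((P.continuous_ψ i).measurable.comp measurable_snd))).add (hbm i)
  · intro i
    have h1 : ContinuousInL2 (fun t x => f i (t + -S.phase i x)) (Icc 0 T) (Ioo 0 1) := by
      obtain ⟨κ, hκ, hκ1, -⟩ := exists_le_abs_inv_velocity ho hl
      exact ContinuousInL2.of_transport (hf i).1 (hf i).2 hκ
        (fun x => (hasDerivAt_phase ho hl i x).neg) (fun x => by rw [abs_neg]; exact hκ1 i x)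
        continuous_id measurableSet_Ioo
    have h2 := (h1.add (ContinuousInL2.of_continuous (h := fun t x => Z (t, x) i)
      measurableSet_Ioo isCompact_Icc Ioo_subset_Icc_self (hZc i))).continuous_mul
      measurableSet_Ioo isCompact_Icc Ioo_subset_Icc_self (h := fun _ x => S.gauge D i x)
      ((hE i).comp continuous_snd)
    simpa only [hw, wave, hψ, ← sub_eq_add_neg] using h2
  · intro j
    filter_upwards [hlabel (Sum.inr j)] with p hp
    exact htr.positiveValue_eq ho hl j hp.1.1 hp.1.2 rfl (hp.2 _)
  · intro i
    filter_upwards [hlabel (Sum.inl i)] with p hp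
    refine htr.negativeValue_eq ho hl i hp.1.1 hp.1.2 rfl (fun hc => ?_) hp.2
    simp only [htrace]
    exact hB i _ hc

/-- For `T = T₂ - δ`, every initial datum is driven to zero by some control. -/
theorem exists_control_isBroadSolution (ho : S.SpeedsOrdered) (hl : S.SpeedsLipschitz)
    (hC : S.CouplingBounded) {p : Fin k} {q r : Fin m} (hp : ∀ i, i ≤ p) (hq : ∀ j, q ≤ j)
    (hqr : r ≠ q) (hB : S.B p r ≠ 0) :
    ∃ δ > 0, δ < S.travelTime (Sum.inl p) + S.travelTime (Sum.inr q) ∧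
      ∀ w₀ : ℝ → Fin k ⊕ Fin m → ℝ,
        (∀ i, MemLp (fun x => w₀ x i) 2 (volume.restrict (Ioo 0 1))) →
        ∃ (W : ℝ → Fin m → ℝ) (w : ℝ → ℝ → Fin k ⊕ Fin m → ℝ),
          (∀ j, MemLp (fun t => W t j) 2 (volume.restrict
            (Ioo 0 (S.travelTime (Sum.inl p) + S.travelTime (Sum.inr q) - δ)))) ∧
          S.IsBroadSolution (S.travelTime (Sum.inl p) + S.travelTime (Sum.inr q) - δ) w₀ W w ∧
          ∀ i, ∀ x ∈ Ioo (0 : ℝ) 1,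
            w (S.travelTime (Sum.inl p) + S.travelTime (Sum.inr q) - δ) x i = 0 := by
  have : Nonempty (Fin k ⊕ Fin m) := ⟨Sum.inl p⟩
  obtain ⟨D, R, hR0, hm, hR, hzero, hae⟩ := exists_bounded_representative hC
  rw [travelTime_inl, travelTime_inr, ← sub_eq_add_neg]
  have h0 : 0 ≤ S.phase (Sum.inl p) 1 - S.phase (Sum.inr q) 1 := by
    have h1 := (strictMono_phase ho hl p).monotone zero_le_one
    have h2 := (strictAnti_phase ho hl q).antitone zero_le_one
    rw [phase_zero] at h1 h2
    linarith
  obtain ⟨P, hψ, hslope, hPT, hcoeff⟩ := exists_transportSystem ho hl hm hR0 hR hzero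
    (S.phase (Sum.inl p) 1 - S.phase (Sum.inr q) 1)
  have hs : P.IsSigned :=
    ⟨fun i x => by rw [hslope]; exact inv_pos.2 (velocity_inl_pos ho i x),
      fun j x => by rw [hslope]; exact inv_lt_zero.2 (velocity_inr_neg ho j x)⟩
  obtain ⟨δ, hδ, hδT, hnull⟩ := hs.exists_nullControl hqr hB (by rw [hPT]; exact h0)
    (fun i hi x => by
      rcases i with i | j
      · have hlt : i < p := lt_of_le_of_ne (hp i) fun h => hi (congrArg _ h)
        rw [hslope]
        exact inv_strictAnti₀ (velocity_inl_pos ho p x) (velocity_inl_lt ho hlt x)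
      · exact (hs.slope_inr j x).trans (hs.slope_inl p x))
    (fun i hi x => by
      rcases i with i | j
      · exact (hs.slope_inr q x).trans (hs.slope_inl i x)
      · have hlt : q < j := lt_of_le_of_ne (hq j) fun h => hi (congrArg _ h.symm)
        rw [hslope]
        exact (inv_lt_inv_of_neg (velocity_inr_neg ho q x) (velocity_inr_neg ho j x)).2
          (velocity_inr_lt ho hlt x))
  rw [hψ] at hδT hnull
  refine ⟨δ, hδ, hδT, fun w₀ hw₀ => ?_⟩
  obtain ⟨a, ha, haw⟩ := exists_isDatum_initial ho hl hm hR0 hR hzero hw₀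
  obtain ⟨f, Z, hf, hZ, hfB, hinit, hfinal⟩ := hnull a ha
  set w : ℝ → ℝ → Fin k ⊕ Fin m → ℝ :=
    fun t x i => S.gauge D i x * wave P.ψ f (fun t x => Z (t, x)) t x i with hw
  obtain ⟨h1, h2⟩ := exists_isBroadSolution_of_wave ho hl hm hR0 hR hzero hae hψ hcoeff hf hZ hfB
    (T := S.phase (Sum.inl p) 1 - S.phase (Sum.inr q) 1 - δ) (by rw [hPT]; linarith) (w₀ := w₀) hw
    (fun i => by
      filter_upwards [haw i] with x hx hx1
      rw [← hx hx1, hw]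
      simp only [hψ]
      rw [hinit i x hx1.1.le hx1.2])
  refine ⟨_, w, h1, h2, fun i x hx => ?_⟩
  simp only [hw, hψ]
  rw [hfinal i x hx.1.le hx.2, mul_zero]

end ControlSystem

/-! ### Source terms of broad solutions -/

/-- A continuous curve in `L²` is bounded on compact sets. -/
theorem ContinuousInL2.exists_eLpNorm_le {u : ℝ → ℝ → ℝ} {J I : Set ℝ}
    (hu : ContinuousInL2 u J I) (hJ : IsCompact J) :
    ∃ M : ENNReal, M ≠ ⊤ ∧ ∀ t ∈ J, eLpNorm (u t) 2 (volume.restrict I) ≤ M := by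
  refine hJ.induction_on (p := fun s => ∃ M : ENNReal, M ≠ ⊤ ∧
    ∀ t ∈ s ∩ J, eLpNorm (u t) 2 (volume.restrict I) ≤ M) ⟨0, by simp, by simp⟩
    (fun s s' h ⟨M, hM, hle⟩ => ⟨M, hM, fun t ht => hle t ⟨h ht.1, ht.2⟩⟩)
    (fun s s' ⟨M, hM, hle⟩ ⟨M', hM', hle'⟩ => ⟨M + M', ENNReal.add_ne_top.2 ⟨hM, hM'⟩,
      fun t ht => ht.1.elim (fun h => (hle t ⟨h, ht.2⟩).trans le_self_add)
        fun h => (hle' t ⟨h, ht.2⟩).trans le_add_self⟩) (fun t₀ ht₀ => ?_) |>.imp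
      fun M h => ⟨h.1, fun t ht => h.2 t ⟨ht, ht⟩⟩
  have h1 : ∀ᶠ t in 𝓝[J] t₀,
      eLpNorm (fun x => u t x - u t₀ x) 2 (volume.restrict I) ≤ 1 :=
    ENNReal.tendsto_nhds_zero.1 (hu.2 t₀ ht₀) 1 one_pos
  refine ⟨_, h1, 1 + eLpNorm (u t₀) 2 (volume.restrict I),
    ENNReal.add_ne_top.2 ⟨ENNReal.one_ne_top, (hu.1 t₀ ht₀).2.ne⟩, fun t ht => ?_⟩
  have h2 := eLpNorm_add_le ((hu.1 t ht.2).sub (hu.1 t₀ ht₀)).1 (hu.1 t₀ ht₀).1 one_le_two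
  rw [sub_add_cancel] at h2
  exact h2.trans (add_le_add_left ht.1 _)

/-- A continuous curve in `L²` which vanishes almost everywhere vanishes at its final time. -/
theorem ContinuousInL2.ae_eq_zero_final {u : ℝ → ℝ → ℝ} {I : Set ℝ} {T : ℝ}
    (hT : 0 < T) (hu : ContinuousInL2 u (Icc 0 T) I)
    (hzero : ∀ᵐ t ∂volume.restrict (Ioo 0 T), ∀ᵐ x ∂volume.restrict I, u t x = 0) :
    ∀ᵐ x ∂volume.restrict I, u T x = 0 := by
  have hTm : T ∈ Icc 0 T := ⟨hT.le, le_rfl⟩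
  suffices h : eLpNorm (u T) 2 (volume.restrict I) = 0 from
    (eLpNorm_eq_zero_iff (hu.1 T hTm).1 two_ne_zero).1 h
  by_contra hne
  have h1 := (hu.2 T hTm).mono_left (nhdsWithin_mono T Ioo_subset_Icc_self)
  have h2 : ∀ᶠ t in 𝓝[Ioo 0 T] T,
      eLpNorm (fun x => u t x - u T x) 2 (volume.restrict I) <
        eLpNorm (u T) 2 (volume.restrict I) :=
    h1.eventually (gt_mem_nhds (pos_iff_ne_zero.2 hne))
  rw [nhdsWithin_Ioo_eq_nhdsLT hT] at h2
  obtain ⟨l, hl, hlt⟩ := (mem_nhdsLT_iff_exists_Ioo_subset' hT).1 h2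
  -- the times close to `T` form a set of positive measure
  have hsub : Ioo (max 0 l) T ⊆ Ioo 0 T := Ioo_subset_Ioo_left (le_max_left _ _)
  have hae := ae_restrict_of_ae_restrict_of_subset hsub hzero
  have : NeBot (ae (volume.restrict (Ioo (max 0 l) T))) := by
    rw [ae_neBot, Ne, Measure.restrict_eq_zero, Real.volume_Ioo, ENNReal.ofReal_eq_zero, not_le,
      sub_pos]
    exact max_lt hT hl
  obtain ⟨t, ht, ht'⟩ := (hae.and (ae_restrict_mem measurableSet_Ioo)).exists
  have h3 : eLpNorm (fun x => u t x - u T x) 2 (volume.restrict I) <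
      eLpNorm (u T) 2 (volume.restrict I) := hlt ⟨(le_max_right _ _).trans_lt ht'.1, ht'.2⟩
  have h4 : eLpNorm (fun x => u t x - u T x) 2 (volume.restrict I) =
      eLpNorm (u T) 2 (volume.restrict I) := by
    rw [← eLpNorm_neg]
    refine eLpNorm_congr_ae ?_
    filter_upwards [ht] with x hx
    simp [hx]
  exact h3.ne h4

/-- A property of almost every point holds at almost every point of almost every curve
`t = c + φ y`. -/
theorem ae_ae_characteristic {φ : ℝ → ℝ} (hφ : Measurable φ) {q : ℝ × ℝ → Prop}
    (hq : ∀ᵐ p, q p) : ∀ᵐ c, ∀ᵐ y, q (c + φ y, y) := by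
  have h := (ControlSystem.measurePreserving_label hφ.neg).quasiMeasurePreserving.ae hq
  simp only [Pi.neg_apply, sub_neg_eq_add] at h
  exact Measure.ae_ae_of_ae_prod h

theorem ae_integrable_characteristic {φ : ℝ → ℝ} (hφ : Measurable φ) {F : ℝ × ℝ → ℝ}
    (hF : Integrable F) : ∀ᵐ c, Integrable fun y => F (c + φ y, y) := by
  have h := (ControlSystem.measurePreserving_label hφ.neg).integrable_comp_of_integrable hF
  simp only [Function.comp_def, Pi.neg_apply, sub_neg_eq_add] at h
  exact Integrable.prod_right_ae h

namespace ControlSystem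

variable {k m : ℕ} {S : ControlSystem k m} {T : ℝ} {w w' : ℝ → ℝ → Fin k ⊕ Fin m → ℝ}

/-- Broad solutions are bounded in `L²(0, 1)`, uniformly in time, hence integrable. -/
theorem IsBroadSolution.integrable {w₀ : ℝ → Fin k ⊕ Fin m → ℝ} {W : ℝ → Fin m → ℝ}
    (h : S.IsBroadSolution T w₀ W w) (i : Fin k ⊕ Fin m) :
    Integrable (fun p : ℝ × ℝ => w p.1 p.2 i) (volume.restrict (Ioo 0 T ×ˢ Ioo 0 1)) := by
  refine ⟨h.aestronglyMeasurable i, ?_⟩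
  obtain ⟨M, hM, hle⟩ := (h.continuous_time i).exists_eLpNorm_le isCompact_Icc
  have hm := h.aestronglyMeasurable i
  rw [Measure.volume_eq_prod, ← Measure.prod_restrict] at hm ⊢
  rw [HasFiniteIntegral, lintegral_prod _ hm.enorm]
  calc ∫⁻ t in Ioo 0 T, ∫⁻ x in Ioo (0 : ℝ) 1, ‖w t x i‖ₑ
      ≤ ∫⁻ _ in Ioo 0 T, M := setLIntegral_mono' measurableSet_Ioo fun t ht => by
        have ht' := Ioo_subset_Icc_self ht
        rw [← eLpNorm_one_eq_lintegral_enorm]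
        exact (eLpNorm_le_eLpNorm_of_exponent_le one_le_two
          ((h.continuous_time i).1 t ht').1).trans (hle t ht')
    _ < ⊤ := by
        rw [setLIntegral_const]
        exact ENNReal.mul_lt_top (lt_top_iff_ne_top.2 hM) (by simp)

/-- The source term is integrable along almost every characteristic. -/
theorem ae_integrableOn_sourceAlong (ho : S.SpeedsOrdered) (hl : S.SpeedsLipschitz)
    (hC : S.CouplingBounded)
    (hw : ∀ j, Integrable (fun p : ℝ × ℝ => w p.1 p.2 j)
      (volume.restrict (Ioo 0 T ×ˢ Ioo 0 1))) (i : Fin k ⊕ Fin m) :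
    ∀ᵐ c, IntegrableOn (S.sourceAlong w i c) {y | (c + S.phase i y, y) ∈ Ioo 0 T ×ˢ Ioo 0 1} := by
  obtain ⟨D, R, hR0, hm, hR, -, hae⟩ := exists_bounded_representative hC
  obtain ⟨A, hA0, hA⟩ := exists_abs_diagonal_le ho hl hR0 hR
  have hQ : MeasurableSet (Ioo 0 T ×ˢ Ioo (0 : ℝ) 1) := measurableSet_Ioo.prod measurableSet_Ioo
  have hC' : ∀ᵐ y : ℝ, ∀ j, y ∈ Ioo (0 : ℝ) 1 → S.C y i j = D i j y := ae_all_iff.2 fun j =>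
    (ae_restrict_iff' measurableSet_Ioo).1 (hae i j)
  have hF := ae_all_iff.2 fun j =>
    ae_integrable_characteristic (continuous_phase ho hl i).measurable
      ((integrable_indicator_iff hQ).2 (hw j))
  filter_upwards [hF] with c hc
  have hset : MeasurableSet {y | (c + S.phase i y, y) ∈ Ioo 0 T ×ˢ Ioo (0 : ℝ) 1} :=
    hQ.preimage (((continuous_phase ho hl i).measurable.const_add c).prodMk measurable_id)
  have hint : Integrable fun y => ∑ j, (S.γ * (S.velocity i y)⁻¹ * D i j y) *
      (Ioo 0 T ×ˢ Ioo (0 : ℝ) 1).indicator (fun p : ℝ × ℝ => w p.1 p.2 j) (c + S.phase i y, y) :=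
    integrable_finsetSum _ fun j _ => (hc j).bdd_mul (c := A)
      (measurable_diagonal ho hl hm i j).aestronglyMeasurable
      (Eventually.of_forall fun y => hA i j y)
  refine hint.integrableOn.congr ?_
  filter_upwards [ae_restrict_mem hset, ae_restrict_of_ae hC'] with y hy hCy
  rw [sourceAlong, Finset.mul_sum]
  refine Finset.sum_congr rfl fun j _ => ?_
  rw [indicator_of_mem (show (c + S.phase i y, y) ∈ _ from hy), hCy j hy.2]
  ring

/-- The source term is controlled by the unknown along almost every characteristic. -/
theorem exists_enorm_sourceAlong_sub_le (ho : S.SpeedsOrdered) (hl : S.SpeedsLipschitz)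
    (hC : S.CouplingBounded) :
    ∃ A : NNReal, ∀ (w w' : ℝ → ℝ → Fin k ⊕ Fin m → ℝ) (i : Fin k ⊕ Fin m) (c : ℝ), ∀ᵐ y,
      y ∈ Ioo (0 : ℝ) 1 → ‖S.sourceAlong w i c y - S.sourceAlong w' i c y‖ₑ ≤
        A * ∑ j, ‖w (c + S.phase i y) y j - w' (c + S.phase i y) y j‖ₑ := by
  obtain ⟨D, R, hR0, hm, hR, -, hae⟩ := exists_bounded_representative hC
  obtain ⟨A, hA0, hA⟩ := exists_abs_diagonal_le ho hl hR0 hR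
  refine ⟨A.toNNReal, fun w w' i c => ?_⟩
  have hC' : ∀ᵐ y : ℝ, ∀ j, y ∈ Ioo (0 : ℝ) 1 → S.C y i j = D i j y := ae_all_iff.2 fun j =>
    (ae_restrict_iff' measurableSet_Ioo).1 (hae i j)
  filter_upwards [hC'] with y hCy hy
  have : S.sourceAlong w i c y - S.sourceAlong w' i c y =
      ∑ j, (S.γ * (S.velocity i y)⁻¹ * D i j y) *
        (w (c + S.phase i y) y j - w' (c + S.phase i y) y j) := by
    rw [sourceAlong, sourceAlong, ← mul_sub, ← Finset.sum_sub_distrib, Finset.mul_sum]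
    refine Finset.sum_congr rfl fun j _ => ?_
    rw [hCy j hy]
    ring
  rw [this, Finset.mul_sum]
  refine (enorm_sum_le _ _).trans (Finset.sum_le_sum fun j _ => ?_)
  rw [enorm_mul]
  refine mul_le_mul_left ?_ _
  rw [Real.enorm_eq_ofReal_abs]
  exact ENNReal.ofReal_le_ofReal (hA i j y)

/-- For almost every label, the difference of the integrals of the source terms between the entry
point and a point `(τ, ξ)` of a characteristic is controlled by the integral of the difference of
the unknowns over the past of `(τ, ξ)`. -/
theorem exists_enorm_integral_sub_le (ho : S.SpeedsOrdered) (hl : S.SpeedsLipschitz)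
    (hC : S.CouplingBounded) :
    ∃ A : NNReal, ∀ (T : ℝ) (w w' : ℝ → ℝ → Fin k ⊕ Fin m → ℝ) (g : ℝ × ℝ → ENNReal),
      (∀ j, Integrable (fun p : ℝ × ℝ => w p.1 p.2 j) (volume.restrict (Ioo 0 T ×ˢ Ioo 0 1))) →
      (∀ j, Integrable (fun p : ℝ × ℝ => w' p.1 p.2 j) (volume.restrict (Ioo 0 T ×ˢ Ioo 0 1))) →
      (∀ᵐ p ∂volume.restrict (Ioo 0 T ×ˢ Ioo 0 1), ∑ j, ‖w p.1 p.2 j - w' p.1 p.2 j‖ₑ = g p) →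
      ∀ i, ∀ᵐ c, ∀ τ ∈ Ioo 0 T, ∀ ξ ∈ Icc (0 : ℝ) 1, c = τ - S.phase i ξ →
        ‖(∫ y in (S.entryPoint i c)..ξ, S.sourceAlong w i c y) -
            ∫ y in (S.entryPoint i c)..ξ, S.sourceAlong w' i c y‖ₑ ≤
          A * ∫⁻ y in {y | c + S.phase i y ≤ τ}, g (c + S.phase i y, y) := by
  obtain ⟨A, hA⟩ := exists_enorm_sourceAlong_sub_le ho hl hC
  refine ⟨A, fun T w w' g hw hw' hg i => ?_⟩
  have hQ : MeasurableSet (Ioo 0 T ×ˢ Ioo (0 : ℝ) 1) := measurableSet_Ioo.prod measurableSet_Ioo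
  have hφ := (continuous_phase ho hl i).measurable
  have h01 : ∀ᵐ y : ℝ, y ∉ ({0, 1} : Set ℝ) :=
    (Set.toFinite ({0, 1} : Set ℝ)).countable.ae_notMem volume
  filter_upwards [ae_integrableOn_sourceAlong ho hl hC hw i,
    ae_integrableOn_sourceAlong ho hl hC hw' i,
    ae_ae_characteristic hφ ((ae_restrict_iff' hQ).1 hg)] with c hc hc' hgc τ hτ ξ hξ hcτ
  obtain ⟨he, he0, hseg⟩ := mem_of_mem_uIoc_entryPoint ho hl i hcτ hτ.1.le hξ
  have hne : ∀ᵐ y : ℝ, c + S.phase i y ≠ 0 := by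
    have : {y | c + S.phase i y = 0}.Subsingleton := fun y hy y' hy' =>
      injective_phase ho hl i (add_left_cancel (hy.trans (Eq.symm hy')))
    exact this.finite.countable.ae_notMem volume
  have hmem : ∀ᵐ y, y ∈ uIoc (S.entryPoint i c) ξ →
      (c + S.phase i y, y) ∈ Ioo 0 T ×ˢ Ioo (0 : ℝ) 1 := by
    filter_upwards [hne, h01] with y hy0 hy01 hy
    have hyI := uIoc_subset_uIcc hy
    have hy1 := uIcc_subset_Icc he hξ hyI
    have ht := hseg y hyI
    simp only [mem_insert_iff, mem_singleton_iff, not_or] at hy01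
    exact ⟨⟨lt_of_le_of_ne (he0.trans ht.1) hy0.symm, ht.2.trans_lt hτ.2⟩,
      lt_of_le_of_ne hy1.1 (Ne.symm hy01.1), lt_of_le_of_ne hy1.2 hy01.2⟩
  have hsub : (uIoc (S.entryPoint i c) ξ : Set ℝ) ≤ᵐ[volume]
      {y | (c + S.phase i y, y) ∈ Ioo 0 T ×ˢ Ioo (0 : ℝ) 1} := hmem
  have hi : IntervalIntegrable (S.sourceAlong w i c) volume (S.entryPoint i c) ξ :=
    intervalIntegrable_iff.2 (hc.mono_set_ae hsub)
  have hi' : IntervalIntegrable (S.sourceAlong w' i c) volume (S.entryPoint i c) ξ :=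
    intervalIntegrable_iff.2 (hc'.mono_set_ae hsub)
  rw [← intervalIntegral.integral_sub hi hi', ← ofReal_norm,
    intervalIntegral.norm_integral_eq_norm_integral_uIoc, ofReal_norm]
  refine (enorm_integral_le_lintegral_enorm _).trans ?_
  rw [← lintegral_const_mul' _ _ ENNReal.coe_ne_top]
  calc _ ≤ ∫⁻ y in uIoc (S.entryPoint i c) ξ, A * g (c + S.phase i y, y) := by
        refine lintegral_mono_ae ((ae_restrict_iff' measurableSet_uIoc).2 ?_)
        filter_upwards [hA w w' i c, hgc, hmem] with y h1 h2 h3 hy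
        have := h1 (h3 hy).2
        rwa [h2 (h3 hy)] at this
    _ ≤ _ := lintegral_mono_set fun y hy => (hseg y (uIoc_subset_uIcc hy)).2

end ControlSystem

/-! ### A weighted estimate over the past of a point -/

theorem measurable_lintegral_kernel {φ χ : ℝ → ℝ} (hφ : Measurable φ) (hχ : Measurable χ)
    {k g : ℝ × ℝ → ENNReal} (hk : Measurable k) (hg : Measurable g) :
    Measurable fun p : ℝ × ℝ => ∫⁻ y, k (p.2, y) * g (p.1 - φ p.2 + χ y, y) := by
  have h : Measurable fun z : (ℝ × ℝ) × ℝ =>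
      k (z.1.2, z.2) * g (z.1.1 - φ z.1.2 + χ z.2, z.2) := by fun_prop
  exact h.lintegral_prod_right'

/-- A weighted estimate for integrals over the past along characteristics. The gain `ε` comes from
the integral of the weight `E` over the target points. -/
theorem lintegral_kernel_le {φ χ : ℝ → ℝ} (hφ : Measurable φ) (hχ : Measurable χ)
    {k g : ℝ × ℝ → ENNReal} (hk : Measurable k) (hg : Measurable g) {E : ℝ → ENNReal}
    (hE : Measurable E) (hmul : ∀ s t, E (s + t) = E s * E t) {ε : ENNReal}
    (hε : ∀ y, ∫⁻ ξ, k (ξ, y) * E (φ ξ - χ y) ≤ ε) :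
    ∫⁻ p : ℝ × ℝ, E p.1 * ∫⁻ y, k (p.2, y) * g (p.1 - φ p.2 + χ y, y) ≤
      ε * ∫⁻ p : ℝ × ℝ, E p.1 * g p := by
  have hm2 := measurable_lintegral_kernel hφ hχ hk hg
  have hM : Measurable fun y => ∫⁻ s, E s * g (s, y) :=
    Measurable.lintegral_prod_left' (f := fun p : ℝ × ℝ => E p.1 * g p) (by fun_prop)
  calc ∫⁻ p : ℝ × ℝ, E p.1 * ∫⁻ y, k (p.2, y) * g (p.1 - φ p.2 + χ y, y)
      = ∫⁻ ξ, ∫⁻ τ, E τ * ∫⁻ y, k (ξ, y) * g (τ - φ ξ + χ y, y) :=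
        lintegral_prod_symm' _ ((hE.comp measurable_fst).mul hm2)
    _ = ∫⁻ ξ, ∫⁻ τ, ∫⁻ y, E τ * (k (ξ, y) * g (τ - φ ξ + χ y, y)) := by
        refine lintegral_congr fun ξ => lintegral_congr fun τ => ?_
        rw [lintegral_const_mul _ (by fun_prop)]
    _ = ∫⁻ ξ, ∫⁻ y, ∫⁻ τ, E τ * (k (ξ, y) * g (τ - φ ξ + χ y, y)) := by
        refine lintegral_congr fun ξ => lintegral_lintegral_swap ?_
        exact Measurable.aemeasurable (by fun_prop)
    _ = ∫⁻ ξ, ∫⁻ y, k (ξ, y) * E (φ ξ - χ y) * ∫⁻ s, E s * g (s, y) := by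
        refine lintegral_congr fun ξ => lintegral_congr fun y => ?_
        rw [← lintegral_sub_right_eq_self (fun s => E s * g (s, y)) (φ ξ - χ y),
          ← lintegral_const_mul _ (by fun_prop)]
        refine lintegral_congr fun τ => ?_
        have h1 : E τ = E (φ ξ - χ y) * E (τ - (φ ξ - χ y)) := by
          rw [← hmul, add_sub_cancel]
        rw [h1, show τ - φ ξ + χ y = τ - (φ ξ - χ y) by ring]
        ring
    _ = ∫⁻ y, ∫⁻ ξ, k (ξ, y) * E (φ ξ - χ y) * ∫⁻ s, E s * g (s, y) := by
        refine lintegral_lintegral_swap (Measurable.aemeasurable ?_)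
        exact Measurable.mul (by fun_prop) (hM.comp measurable_snd)
    _ = ∫⁻ y, (∫⁻ ξ, k (ξ, y) * E (φ ξ - χ y)) * ∫⁻ s, E s * g (s, y) := by
        refine lintegral_congr fun y => ?_
        rw [lintegral_mul_const _ (by fun_prop)]
    _ ≤ ∫⁻ y, ε * ∫⁻ s, E s * g (s, y) := lintegral_mono fun y => mul_le_mul_left (hε y) _
    _ = ε * ∫⁻ y, ∫⁻ s, E s * g (s, y) := lintegral_const_mul _ hM
    _ = ε * ∫⁻ p : ℝ × ℝ, E p.1 * g p := by
        rw [Measure.volume_eq_prod, lintegral_prod_symm' (fun p : ℝ × ℝ => E p.1 * g p)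
          (by fun_prop)]

/-- The exponential weight. -/
noncomputable def decay (L t : ℝ) : ENNReal := ENNReal.ofReal (Real.exp (-L * t))

theorem measurable_decay (L : ℝ) : Measurable (decay L) := by unfold decay; fun_prop

theorem decay_add (L s t : ℝ) : decay L (s + t) = decay L s * decay L t := by
  rw [decay, decay, decay, ← ENNReal.ofReal_mul (Real.exp_pos _).le, ← Real.exp_add, mul_add]

theorem lintegral_decay {L : ℝ} (hL : 0 < L) :
    ∫⁻ t in Ici 0, decay L t = ENNReal.ofReal L⁻¹ := by
  have h1 := integral_exp_mul_Ioi (a := -L) (by linarith) 0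
  have h2 : IntegrableOn (fun t => Real.exp (-L * t)) (Ioi 0) := exp_neg_integrableOn_Ioi 0 hL
  rw [setLIntegral_congr Ioi_ae_eq_Ici.symm]
  unfold decay
  rw [← ofReal_integral_eq_lintegral_ofReal h2 (Eventually.of_forall fun _ => (Real.exp_pos _).le),
    h1]
  congr 1
  simp [neg_div_neg_eq]

/-- The gain in the weighted estimate: the targets are crossed with speed at least `κ`. -/
theorem lintegral_decay_comp_le {η η' : ℝ → ℝ} {κ L : ℝ} (hκ : 0 < κ) (hL : 0 < L)
    (hη : ∀ x, HasDerivAt η (η' x) x) (hle : ∀ x, κ ≤ |η' x|) :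
    ∫⁻ ξ in Ioo (0 : ℝ) 1, (Ici (0 : ℝ)).indicator (decay L) (η ξ) ≤ ENNReal.ofReal (κ * L)⁻¹ := by
  have h := ofReal_mul_lintegral_comp_le hκ hη hle ((Ici (0 : ℝ)).indicator (decay L))
    (measurableSet_Ioo (a := (0 : ℝ)) (b := 1))
  rw [lintegral_indicator measurableSet_Ici, lintegral_decay hL] at h
  rw [mul_inv, ENNReal.ofReal_mul (inv_pos.2 hκ).le, ENNReal.ofReal_inv_of_pos hκ, mul_comm,
    ← div_eq_mul_inv, ENNReal.le_div_iff_mul_le (Or.inl (by simpa using hκ))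
    (Or.inl ENNReal.ofReal_ne_top), mul_comm]
  exact h

/-! ### The difference of two broad solutions -/

namespace ControlSystem

variable {k m : ℕ} {S : ControlSystem k m} {T : ℝ} {w w' : ℝ → ℝ → Fin k ⊕ Fin m → ℝ}
  {w₀ : ℝ → Fin k ⊕ Fin m → ℝ} {W : ℝ → Fin m → ℝ}

variable (S) in
/-- The kernel of the source points which influence a target point on the same characteristic. -/
noncomputable def directKernel (i : Fin k ⊕ Fin m) : ℝ × ℝ → ENNReal :=
  {p : ℝ × ℝ | p.1 ∈ Ioo (0 : ℝ) 1 ∧ S.phase i p.2 ≤ S.phase i p.1}.indicator 1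

variable (S) in
/-- The kernel of the source points which influence a target point through the reflection at
`x = 0`. -/
noncomputable def reflectedKernel (i j : Fin k ⊕ Fin m) : ℝ × ℝ → ENNReal :=
  {p : ℝ × ℝ | p.1 ∈ Ioo (0 : ℝ) 1 ∧ 0 ≤ S.phase i p.1 ∧ S.phase j p.2 ≤ 0}.indicator 1

theorem directKernel_eq_one {i : Fin k ⊕ Fin m} {ξ y : ℝ} (hξ : ξ ∈ Ioo (0 : ℝ) 1)
    (h : S.phase i y ≤ S.phase i ξ) : S.directKernel i (ξ, y) = 1 :=
  indicator_of_mem (s := {p : ℝ × ℝ | p.1 ∈ Ioo (0 : ℝ) 1 ∧ S.phase i p.2 ≤ S.phase i p.1})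
    ⟨hξ, h⟩ 1

theorem directKernel_eq_zero {i : Fin k ⊕ Fin m} {ξ y : ℝ}
    (h : ¬ (ξ ∈ Ioo (0 : ℝ) 1 ∧ S.phase i y ≤ S.phase i ξ)) : S.directKernel i (ξ, y) = 0 :=
  indicator_of_notMem
    (s := {p : ℝ × ℝ | p.1 ∈ Ioo (0 : ℝ) 1 ∧ S.phase i p.2 ≤ S.phase i p.1}) h 1

theorem reflectedKernel_eq_one {i j : Fin k ⊕ Fin m} {ξ y : ℝ} (hξ : ξ ∈ Ioo (0 : ℝ) 1)
    (h : 0 ≤ S.phase i ξ) (h' : S.phase j y ≤ 0) : S.reflectedKernel i j (ξ, y) = 1 :=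
  indicator_of_mem (s := {p : ℝ × ℝ | p.1 ∈ Ioo (0 : ℝ) 1 ∧ 0 ≤ S.phase i p.1 ∧ S.phase j p.2 ≤ 0})
    ⟨hξ, h, h'⟩ 1

theorem reflectedKernel_eq_zero {i j : Fin k ⊕ Fin m} {ξ y : ℝ}
    (h : ¬ (ξ ∈ Ioo (0 : ℝ) 1 ∧ 0 ≤ S.phase i ξ ∧ S.phase j y ≤ 0)) :
    S.reflectedKernel i j (ξ, y) = 0 :=
  indicator_of_notMem
    (s := {p : ℝ × ℝ | p.1 ∈ Ioo (0 : ℝ) 1 ∧ 0 ≤ S.phase i p.1 ∧ S.phase j p.2 ≤ 0}) h 1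

theorem measurable_directKernel (ho : S.SpeedsOrdered) (hl : S.SpeedsLipschitz)
    (i : Fin k ⊕ Fin m) : Measurable (S.directKernel i) := by
  have h := (continuous_phase ho hl i).measurable
  exact measurable_one.indicator ((measurableSet_Ioo.preimage measurable_fst).inter
    (measurableSet_le (h.comp measurable_snd) (h.comp measurable_fst)))

theorem measurable_reflectedKernel (ho : S.SpeedsOrdered) (hl : S.SpeedsLipschitz)
    (i j : Fin k ⊕ Fin m) : Measurable (S.reflectedKernel i j) := by
  have h := (continuous_phase ho hl i).measurable
  have h' := (continuous_phase ho hl j).measurable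
  exact measurable_one.indicator ((measurableSet_Ioo.preimage measurable_fst).inter
    ((measurableSet_le measurable_const (h.comp measurable_fst)).inter
      (measurableSet_le (h'.comp measurable_snd) measurable_const)))

theorem lintegral_directKernel_le (ho : S.SpeedsOrdered) (hl : S.SpeedsLipschitz) {κ L : ℝ}
    (hκ : 0 < κ) (hle : ∀ i x, κ ≤ |(S.velocity i x)⁻¹|) (hL : 0 < L) (i : Fin k ⊕ Fin m)
    (y : ℝ) : ∫⁻ ξ, S.directKernel i (ξ, y) * decay L (S.phase i ξ - S.phase i y) ≤
      ENNReal.ofReal (κ * L)⁻¹ := by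
  refine le_trans ?_ (lintegral_decay_comp_le hκ hL
    (fun x => (hasDerivAt_phase ho hl i x).sub_const (S.phase i y)) (hle i))
  rw [← lintegral_indicator measurableSet_Ioo]
  refine lintegral_mono fun ξ => ?_
  by_cases h : ξ ∈ Ioo (0 : ℝ) 1 ∧ S.phase i y ≤ S.phase i ξ
  · rw [directKernel_eq_one h.1 h.2, indicator_of_mem h.1,
      indicator_of_mem (show _ ∈ Ici (0 : ℝ) from sub_nonneg.2 h.2), one_mul]
  · rw [directKernel_eq_zero h, zero_mul]
    exact zero_le

theorem lintegral_reflectedKernel_le (ho : S.SpeedsOrdered) (hl : S.SpeedsLipschitz) {κ L : ℝ}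
    (hκ : 0 < κ) (hle : ∀ i x, κ ≤ |(S.velocity i x)⁻¹|) (hL : 0 < L) (i j : Fin k ⊕ Fin m)
    (y : ℝ) : ∫⁻ ξ, S.reflectedKernel i j (ξ, y) * decay L (S.phase i ξ - S.phase j y) ≤
      ENNReal.ofReal (κ * L)⁻¹ := by
  refine le_trans ?_ (lintegral_decay_comp_le hκ hL (hasDerivAt_phase ho hl i) (hle i))
  rw [← lintegral_indicator measurableSet_Ioo]
  refine lintegral_mono fun ξ => ?_
  by_cases h : ξ ∈ Ioo (0 : ℝ) 1 ∧ 0 ≤ S.phase i ξ ∧ S.phase j y ≤ 0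
  · rw [reflectedKernel_eq_one h.1 h.2.1 h.2.2, indicator_of_mem h.1,
      indicator_of_mem (show _ ∈ Ici (0 : ℝ) from h.2.1), one_mul]
    refine ENNReal.ofReal_le_ofReal (Real.exp_le_exp.2 ?_)
    nlinarith [h.2.2]
  · rw [reflectedKernel_eq_zero h, zero_mul]
    exact zero_le

/-- The difference of two broad solutions with the same data, at a point, is controlled by its
integrals over the characteristics which determine the value at this point. -/
theorem exists_enorm_sub_le (ho : S.SpeedsOrdered) (hl : S.SpeedsLipschitz)
    (hC : S.CouplingBounded) :
    ∃ A : NNReal, ∀ (T : ℝ) (w₀ : ℝ → Fin k ⊕ Fin m → ℝ) (W : ℝ → Fin m → ℝ)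
      (w w' : ℝ → ℝ → Fin k ⊕ Fin m → ℝ) (g : ℝ × ℝ → ENNReal),
      S.IsBroadSolution T w₀ W w → S.IsBroadSolution T w₀ W w' →
      (∀ᵐ p ∂volume.restrict (Ioo 0 T ×ˢ Ioo 0 1), ∑ j, ‖w p.1 p.2 j - w' p.1 p.2 j‖ₑ = g p) →
      ∀ i, ∀ᵐ p : ℝ × ℝ ∂volume.restrict (Ioo 0 T ×ˢ Ioo 0 1),
        ‖w p.1 p.2 i - w' p.1 p.2 i‖ₑ ≤
          A * ((∫⁻ y, S.directKernel i (p.2, y) * g (p.1 - S.phase i p.2 + S.phase i y, y)) +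
            ∑ j, ∫⁻ y, S.reflectedKernel i j (p.2, y) *
              g (p.1 - S.phase i p.2 + S.phase j y, y)) := by
  obtain ⟨A, hA⟩ := exists_enorm_integral_sub_le ho hl hC
  -- a bound for the entries of the reflection matrix
  set b : NNReal := ∑ i, ∑ j, ‖S.B i j‖₊ with hb
  have hBb : ∀ i j, ‖S.B i j‖ₑ ≤ b := fun i j => by
    rw [enorm_eq_nnnorm, ENNReal.coe_le_coe, hb]
    exact (Finset.single_le_sum (f := fun j => ‖S.B i j‖₊) (fun _ _ => zero_le)
      (Finset.mem_univ j)).trans (Finset.single_le_sum (f := fun i => ∑ j, ‖S.B i j‖₊)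
        (fun _ _ => zero_le) (Finset.mem_univ i))
  refine ⟨A * (1 + b), fun T w₀ W w w' g hw hw' hg i => ?_⟩
  have hA1 : (A : ENNReal) ≤ (A * (1 + b) : NNReal) :=
    ENNReal.coe_le_coe.2 (le_mul_of_one_le_right zero_le le_self_add)
  have hQ : MeasurableSet (Ioo 0 T ×ˢ Ioo (0 : ℝ) 1) := measurableSet_Ioo.prod measurableSet_Ioo
  have hgood := ae_all_iff.2 fun i => hA T w w' g hw.integrable hw'.integrable hg i
  have hlabel := ae_restrict_of_ae (s := Ioo 0 T ×ˢ Ioo (0 : ℝ) 1)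
    (ae_label (continuous_phase ho hl i).measurable hgood)
  -- the contribution of the characteristic through the point itself
  have hdirect : ∀ p : ℝ × ℝ, p ∈ Ioo 0 T ×ˢ Ioo (0 : ℝ) 1 →
      ∫⁻ y in {y | p.1 - S.phase i p.2 + S.phase i y ≤ p.1},
        g (p.1 - S.phase i p.2 + S.phase i y, y) =
      ∫⁻ y, S.directKernel i (p.2, y) * g (p.1 - S.phase i p.2 + S.phase i y, y) := fun p hp => by
    have hset : MeasurableSet {y | p.1 - S.phase i p.2 + S.phase i y ≤ p.1} :=
      measurableSet_le ((continuous_phase ho hl i).measurable.const_add _) measurable_const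
    rw [← lintegral_indicator hset]
    refine lintegral_congr fun y => ?_
    have hiff : y ∈ {y | p.1 - S.phase i p.2 + S.phase i y ≤ p.1} ↔
        S.phase i y ≤ S.phase i p.2 := by
      change p.1 - S.phase i p.2 + S.phase i y ≤ p.1 ↔ _
      constructor <;> intro h <;> linarith
    by_cases h : S.phase i y ≤ S.phase i p.2
    · rw [indicator_of_mem (hiff.2 h), directKernel_eq_one hp.2 h, one_mul]
    · rw [indicator_of_notMem (mt hiff.1 h), directKernel_eq_zero fun h' => h h'.2, zero_mul]
  rcases i with i | j
  · filter_upwards [hw.negative i, hw'.negative i, ae_restrict_mem hQ, hlabel] with p h1 h2 hp hlab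
    set c := p.1 - S.phase (Sum.inl i) p.2 with hc
    have hφ : 0 ≤ S.phase (Sum.inl i) p.2 := by
      have := (strictMono_phase ho hl i).monotone hp.2.1.le
      rwa [phase_zero] at this
    have hd := hlab (Sum.inl i) p.1 hp.1 p.2 (Ioo_subset_Icc_self hp.2) rfl
    rw [hdirect p hp] at hd
    rw [h1, h2, negativeValue_eq ho hl _ _ _ _ _ _ hc, negativeValue_eq ho hl _ _ _ _ _ _ hc]
    by_cases hc0 : 0 < c
    · have hcT : c ∈ Ioo 0 T := ⟨hc0, by rw [hc]; linarith [hp.1.2]⟩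
      -- the contribution of the reflection at the time `c`
      have hrefl : ∀ j, ‖S.positiveValue w₀ W w j c 0 - S.positiveValue w₀ W w' j c 0‖ₑ ≤
          A * ∫⁻ y, S.reflectedKernel (Sum.inl i) (Sum.inr j) (p.2, y) *
            g (c + S.phase (Sum.inr j) y, y) := fun j => by
        have hcj : c = c - S.phase (Sum.inr j) 0 := by rw [phase_zero, sub_zero]
        have := hlab (Sum.inr j) c hcT 0 ⟨le_rfl, zero_le_one⟩ hcj
        rw [positiveValue_eq ho hl _ _ _ _ _ _ hcj, positiveValue_eq ho hl _ _ _ _ _ _ hcj,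
          add_sub_add_right_eq_sub]
        refine this.trans (mul_le_mul_right ?_ _)
        have hset : MeasurableSet {y | c + S.phase (Sum.inr j) y ≤ c} :=
          measurableSet_le ((continuous_phase ho hl (Sum.inr j)).measurable.const_add _)
            measurable_const
        rw [← lintegral_indicator hset]
        refine lintegral_mono fun y => ?_
        by_cases h : S.phase (Sum.inr j) y ≤ 0
        · rw [reflectedKernel_eq_one hp.2 hφ h, one_mul]
          exact indicator_le_self _ _ _
        · have hy : y ∉ {y | c + S.phase (Sum.inr j) y ≤ c} := fun h' => by
            have : c + S.phase (Sum.inr j) y ≤ c := h'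
            exact h (by linarith)
          rw [indicator_of_notMem hy]
          exact zero_le
      rw [if_pos hc0, if_pos hc0, add_sub_add_comm, ← Finset.sum_sub_distrib]
      simp only [← mul_sub]
      have hsum : ‖∑ j, S.B i j * (S.positiveValue w₀ W w j c 0 -
          S.positiveValue w₀ W w' j c 0)‖ₑ ≤ ∑ j : Fin m, (b : ENNReal) * (A *
            ∫⁻ y, S.reflectedKernel (Sum.inl i) (Sum.inr j) (p.2, y) *
              g (c + S.phase (Sum.inr j) y, y)) :=
        (enorm_sum_le _ _).trans (Finset.sum_le_sum fun j _ => by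
          rw [enorm_mul]; exact mul_le_mul' (hBb i j) (hrefl j))
      refine (enorm_add_le _ _).trans ?_
      rw [mul_add]
      refine add_le_add (hd.trans (mul_le_mul_left hA1 _)) (hsum.trans ?_)
      rw [Fintype.sum_sum_type, mul_add]
      refine le_trans ?_ le_add_self
      rw [Finset.mul_sum]
      refine Finset.sum_le_sum fun j _ => ?_
      rw [← mul_assoc, ← ENNReal.coe_mul]
      refine mul_le_mul_left (ENNReal.coe_le_coe.2 ?_) _
      rw [mul_comm]
      exact mul_le_mul_right le_add_self _
    · rw [if_neg hc0, if_neg hc0, add_sub_add_right_eq_sub]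
      exact hd.trans (mul_le_mul' hA1 le_self_add)
  · filter_upwards [hw.positive j, hw'.positive j, ae_restrict_mem hQ, hlabel] with p h1 h2 hp hlab
    have hd := hlab (Sum.inr j) p.1 hp.1 p.2 (Ioo_subset_Icc_self hp.2) rfl
    rw [hdirect p hp] at hd
    rw [h1, h2, positiveValue_eq ho hl _ _ _ _ _ _ rfl, positiveValue_eq ho hl _ _ _ _ _ _ rfl,
      add_sub_add_right_eq_sub]
    exact hd.trans (mul_le_mul' hA1 le_self_add)

end ControlSystem

/-! ### Uniqueness of broad solutions -/

namespace ControlSystem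

variable {k m : ℕ} {S : ControlSystem k m} {T : ℝ} {w w' : ℝ → ℝ → Fin k ⊕ Fin m → ℝ}
  {w₀ : ℝ → Fin k ⊕ Fin m → ℝ} {W : ℝ → Fin m → ℝ}

/-- Broad solutions with the same data coincide almost everywhere: for a fast exponential weight,
the weighted `L¹` norm of their difference is at most half of itself. -/
theorem IsBroadSolution.ae_eq (ho : S.SpeedsOrdered) (hl : S.SpeedsLipschitz)
    (hC : S.CouplingBounded) (hw : S.IsBroadSolution T w₀ W w)
    (hw' : S.IsBroadSolution T w₀ W w') (i : Fin k ⊕ Fin m) :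
    ∀ᵐ p : ℝ × ℝ ∂volume.restrict (Ioo 0 T ×ˢ Ioo 0 1), w p.1 p.2 i - w' p.1 p.2 i = 0 := by
  obtain ⟨κ, hκ, hκ1, -⟩ := exists_le_abs_inv_velocity ho hl
  obtain ⟨A, hA⟩ := exists_enorm_sub_le ho hl hC
  have hQ : MeasurableSet (Ioo 0 T ×ˢ Ioo (0 : ℝ) 1) := measurableSet_Ioo.prod measurableSet_Ioo
  have hint : ∀ j, Integrable (fun p : ℝ × ℝ => w p.1 p.2 j - w' p.1 p.2 j)
      (volume.restrict (Ioo 0 T ×ˢ Ioo 0 1)) := fun j => (hw.integrable j).sub (hw'.integrable j)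
  -- a Borel representative of the size of the difference
  let v : Fin k ⊕ Fin m → ℝ × ℝ → ℝ := fun j => (hint j).1.mk _
  have hv : ∀ j, Measurable (v j) := fun j => (hint j).1.stronglyMeasurable_mk.measurable
  have hva : ∀ᵐ p : ℝ × ℝ ∂volume.restrict (Ioo 0 T ×ˢ Ioo (0 : ℝ) 1), ∀ j,
      w p.1 p.2 j - w' p.1 p.2 j = v j p := ae_all_iff.2 fun j => (hint j).1.ae_eq_mk
  set g : ℝ × ℝ → ENNReal := (Ioo 0 T ×ˢ Ioo (0 : ℝ) 1).indicator fun p => ∑ j, ‖v j p‖ₑ with hg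
  have hgm : Measurable g := (Finset.measurable_sum _ fun j _ => (hv j).enorm).indicator hQ
  have hga : ∀ᵐ p : ℝ × ℝ ∂volume.restrict (Ioo 0 T ×ˢ Ioo (0 : ℝ) 1),
      ∑ j, ‖w p.1 p.2 j - w' p.1 p.2 j‖ₑ = g p := by
    filter_upwards [hva, ae_restrict_mem hQ] with p h1 h2
    rw [hg, indicator_of_mem h2]
    exact Finset.sum_congr rfl fun j _ => by rw [h1]
  set n : ℝ := (Fintype.card (Fin k ⊕ Fin m) : ℝ) with hn
  have hn0 : 0 ≤ n := Nat.cast_nonneg _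
  set q : ℝ := n * (A * (1 + n)) with hq
  have hq0 : 0 ≤ q := by positivity
  -- the weight decays fast enough for the estimate to be contractive
  set L : ℝ := (2 * q + 1) / κ with hL
  have hL0 : 0 < L := by positivity
  set ε := ENNReal.ofReal (κ * L)⁻¹ with hε
  have hE := measurable_decay L
  set N := ∫⁻ p : ℝ × ℝ, decay L p.1 * g p with hN
  have hφ : ∀ i, Measurable (S.phase i) := fun i => (continuous_phase ho hl i).measurable
  have hEd : ∀ j, AEMeasurable (fun p : ℝ × ℝ => decay L p.1 * ‖w p.1 p.2 j - w' p.1 p.2 j‖ₑ)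
      (volume.restrict (Ioo 0 T ×ˢ Ioo 0 1)) := fun j =>
    (hE.comp measurable_fst).aemeasurable.mul (hint j).1.enorm
  have hNQ : N = ∫⁻ p : ℝ × ℝ in Ioo 0 T ×ˢ Ioo 0 1, decay L p.1 * g p := by
    rw [hN, ← lintegral_indicator hQ]
    refine lintegral_congr fun p => ?_
    by_cases hp : p ∈ Ioo 0 T ×ˢ Ioo (0 : ℝ) 1
    · rw [indicator_of_mem hp]
    · rw [indicator_of_notMem hp, hg, indicator_of_notMem hp, mul_zero]
  have hNsum : N = ∑ j, ∫⁻ p : ℝ × ℝ in Ioo 0 T ×ˢ Ioo 0 1,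
      decay L p.1 * ‖w p.1 p.2 j - w' p.1 p.2 j‖ₑ := by
    rw [hNQ, ← lintegral_finsetSum' _ fun j _ => hEd j]
    refine lintegral_congr_ae ?_
    filter_upwards [hga] with p hp
    rw [← hp, Finset.mul_sum]
  have hNtop : N ≠ ⊤ := by
    rw [hNsum]
    refine (ENNReal.sum_lt_top.2 fun j _ => lt_of_le_of_lt ?_ (hint j).2).ne
    refine setLIntegral_mono' hQ fun p hp => mul_le_of_le_one_left zero_le ?_
    rw [decay, ENNReal.ofReal_le_one, Real.exp_le_one_iff]
    have := mul_nonneg hL0.le hp.1.1.le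
    linarith
  have hle : ∀ i, ∫⁻ p : ℝ × ℝ in Ioo 0 T ×ˢ Ioo 0 1,
      decay L p.1 * ‖w p.1 p.2 i - w' p.1 p.2 i‖ₑ ≤ A * ((1 + ENNReal.ofReal n) * (ε * N)) := by
    intro i
    have hE1 : Measurable fun p : ℝ × ℝ => decay L p.1 := hE.comp measurable_fst
    have hmd : Measurable fun p : ℝ × ℝ => decay L p.1 *
        ∫⁻ y, S.directKernel i (p.2, y) * g (p.1 - S.phase i p.2 + S.phase i y, y) :=
      hE1.mul (measurable_lintegral_kernel (hφ i) (hφ i) (measurable_directKernel ho hl i) hgm)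
    have hmr : ∀ j, Measurable fun p : ℝ × ℝ => decay L p.1 *
        ∫⁻ y, S.reflectedKernel i j (p.2, y) * g (p.1 - S.phase i p.2 + S.phase j y, y) := fun j =>
      hE1.mul (measurable_lintegral_kernel (hφ i) (hφ j) (measurable_reflectedKernel ho hl i j) hgm)
    calc _ ≤ ∫⁻ p : ℝ × ℝ in Ioo 0 T ×ˢ Ioo 0 1, A * (decay L p.1 *
          (∫⁻ y, S.directKernel i (p.2, y) * g (p.1 - S.phase i p.2 + S.phase i y, y)) +
            ∑ j, decay L p.1 * ∫⁻ y, S.reflectedKernel i j (p.2, y) *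
              g (p.1 - S.phase i p.2 + S.phase j y, y)) := by
          refine lintegral_mono_ae ?_
          filter_upwards [hA T w₀ W w w' g hw hw' hga i] with p hp
          refine (mul_le_mul_right hp _).trans (le_of_eq ?_)
          rw [← Finset.mul_sum]
          ring
      _ ≤ ∫⁻ p : ℝ × ℝ, A * (decay L p.1 *
          (∫⁻ y, S.directKernel i (p.2, y) * g (p.1 - S.phase i p.2 + S.phase i y, y)) +
            ∑ j, decay L p.1 * ∫⁻ y, S.reflectedKernel i j (p.2, y) *
              g (p.1 - S.phase i p.2 + S.phase j y, y)) := setLIntegral_le_lintegral _ _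
      _ ≤ A * (ε * N + ∑ _j : Fin k ⊕ Fin m, ε * N) := by
          rw [lintegral_const_mul' _ _ ENNReal.coe_ne_top, lintegral_add_left hmd,
            lintegral_finsetSum _ fun j _ => hmr j]
          refine mul_le_mul_right (add_le_add ?_ (Finset.sum_le_sum fun j _ => ?_)) _
          · exact lintegral_kernel_le (hφ i) (hφ i) (measurable_directKernel ho hl i) hgm hE
              (decay_add L) (lintegral_directKernel_le ho hl hκ hκ1 hL0 i)
          · exact lintegral_kernel_le (hφ i) (hφ j) (measurable_reflectedKernel ho hl i j) hgm hE
              (decay_add L) (lintegral_reflectedKernel_le ho hl hκ hκ1 hL0 i j)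
      _ = _ := by
          rw [Finset.sum_const, Finset.card_univ, nsmul_eq_mul, hn, ENNReal.ofReal_natCast]
          ring
  have hhalf : N ≤ ENNReal.ofReal (1 / 2) * N := by
    calc N ≤ ∑ _j : Fin k ⊕ Fin m, A * ((1 + ENNReal.ofReal n) * (ε * N)) :=
          hNsum.le.trans (Finset.sum_le_sum fun j _ => hle j)
      _ = ENNReal.ofReal n * (A * (1 + ENNReal.ofReal n)) * ε * N := by
          rw [Finset.sum_const, Finset.card_univ, nsmul_eq_mul, hn, ENNReal.ofReal_natCast]
          ring
      _ = ENNReal.ofReal (q * (κ * L)⁻¹) * N := by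
          rw [ENNReal.ofReal_mul hq0, hq, ENNReal.ofReal_mul hn0,
            ENNReal.ofReal_mul (NNReal.coe_nonneg A), ENNReal.ofReal_add zero_le_one hn0,
            ENNReal.ofReal_one, ENNReal.ofReal_coe_nnreal]
      _ ≤ ENNReal.ofReal (1 / 2) * N := by
          refine mul_le_mul_left (ENNReal.ofReal_le_ofReal ?_) _
          rw [hL, mul_div_cancel₀ _ hκ.ne', ← div_eq_mul_inv, div_le_iff₀ (by positivity)]
          linarith
  have hN0 : N = 0 := by
    have h1 := ENNReal.toReal_mono (ENNReal.mul_ne_top ENNReal.ofReal_ne_top hNtop) hhalf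
    rw [ENNReal.toReal_mul, ENNReal.toReal_ofReal (by norm_num)] at h1
    have h2 : N.toReal = 0 := le_antisymm (by linarith) ENNReal.toReal_nonneg
    exact (ENNReal.toReal_eq_zero_iff N).1 h2 |>.resolve_right hNtop
  have hzero : ∫⁻ p : ℝ × ℝ in Ioo 0 T ×ˢ Ioo 0 1,
      decay L p.1 * ‖w p.1 p.2 i - w' p.1 p.2 i‖ₑ = 0 := by
    rw [hN0] at hNsum
    exact (Finset.sum_eq_zero_iff.1 hNsum.symm) i (Finset.mem_univ i)
  filter_upwards [(lintegral_eq_zero_iff' (hEd i)).1 hzero] with p hp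
  have hp' : decay L p.1 * ‖w p.1 p.2 i - w' p.1 p.2 i‖ₑ = 0 := hp
  rcases mul_eq_zero.1 hp' with h | h
  · rw [decay, ENNReal.ofReal_eq_zero] at h
    exact absurd h (Real.exp_pos _).not_ge
  · exact enorm_eq_zero.1 h

/-- Broad solutions with the same data coincide at the final time, where the equations of a broad
solution say nothing, by continuity in time. -/
theorem IsBroadSolution.ae_eq_final (ho : S.SpeedsOrdered) (hl : S.SpeedsLipschitz)
    (hC : S.CouplingBounded) (hT : 0 < T) (hw : S.IsBroadSolution T w₀ W w)
    (hw' : S.IsBroadSolution T w₀ W w') (i : Fin k ⊕ Fin m) :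
    ∀ᵐ x ∂volume.restrict (Ioo (0 : ℝ) 1), w T x i - w' T x i = 0 := by
  refine ((hw.continuous_time i).sub (hw'.continuous_time i)).ae_eq_zero_final hT ?_
  have h := hw.ae_eq ho hl hC hw' i
  rw [Measure.volume_eq_prod, ← Measure.prod_restrict] at h
  exact Measure.ae_ae_of_ae_prod h

end ControlSystem

end HyperbolicControl

/-! ### Null controllability -/

theorem mainTheorem5 (k m : ℕ) (hk : 1 ≤ k) (hm : 2 ≤ m)
    (S : HyperbolicControl.ControlSystem k m)
    (hord : S.SpeedsOrdered) (hlip : S.SpeedsLipschitz) (hC : S.CouplingBounded)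
    (hB : S.B ∈ HyperbolicControl.classB k m) :
    ∃ δ : ℝ, 0 < δ ∧
      S.NullControllableAt
        (S.travelTime (Sum.inl ⟨k - 1, by omega⟩) + S.travelTime (Sum.inr ⟨0, by omega⟩) - δ) := by
  -- the `1 × 1` block is available, as `m - 1 ≥ 1`
  have hentry : S.B ⟨k - 1, by omega⟩ ⟨m - 1, by omega⟩ ≠ 0 := by
    have h := hB 1 hk (by omega) le_rfl
    rw [Matrix.isUnit_iff_isUnit_det, Matrix.det_fin_one] at h
    simpa [HyperbolicControl.lastBlock] using h.ne_zero
  obtain ⟨δ, hδ, hδT, hctrl⟩ := HyperbolicControl.ControlSystem.exists_control_isBroadSolution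
    hord hlip hC (p := ⟨k - 1, by omega⟩) (q := ⟨0, by omega⟩) (r := ⟨m - 1, by omega⟩)
    (fun i => Fin.le_def.2 (by simp only; omega)) (fun j => Fin.le_def.2 (Nat.zero_le _))
    (fun h => by simp only [Fin.mk.injEq] at h; omega) hentry
  refine ⟨δ, hδ, sub_pos.2 hδT, fun w₀ hw₀ => ?_⟩
  obtain ⟨W, w, hW, hw, hzero⟩ := hctrl w₀ hw₀
  refine ⟨W, hW, ⟨w, hw⟩, fun w' hw' i => ?_⟩
  filter_upwards [hw'.ae_eq_final hord hlip hC (sub_pos.2 hδT) hw i,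
    ae_restrict_mem measurableSet_Ioo] with x hx hx'
  rwa [hzero i x hx', sub_zero] at hx
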